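/- Let $\mu$ be a probability measure on $\mathbb R$ with $\mathrm{Supp}(\mu)\subset[a,b]$, $\{a,b\}\subset\mathrm{Supp}(\mu)$, $b-a>1$, such that $\frac1n\sum_{i=1}^n\delta_{x^{(n)}_i/n}\to\mu$ weakly for some integers $x^{(n)}_1>\dots>x^{(n)}_n$ ($n\ge1$). Let $\lambda$ be Lebesgue measure and let $\mathcal S:=\{(\chi,\eta)\in[a,b]\times[0,1]: b\ge\chi\ge\chi+\eta-1\ge a\}$. For $(\chi,\eta)\in\mathcal S$ put $$f'_{(\chi,\eta)}(w)=\int_{[\chi,b]}\frac{\mu[dx]}{w-x}-\int_{[\chi+\eta-1,\chi]}\frac{(\lambda-\mu)[dx]}{w-x}+\int_{[a,\chi+\eta-1]}\frac{\mu[dx]}{w-x},$$ an analytic function off $\mathrm{Supp}(\mu|_{[\chi,b]})\cup\mathrm{Supp}((\lambda-\mu)|_{[\chi+\eta-1,\chi]})\cup\mathrm{Supp}(\mu|_{[a,\chi+\eta-1]})$; roots are taken in this domain. Define subsets of $\mathcal S$: $\mathcal E_\mu$ (resp. $\mathcal E_{\lambda-\mu}$) is the set of $(\chi,\eta)$ for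 which $f'_{(\chi,\eta)}$ has a repeated root in $\mathbb R\setminus[\chi+\eta-1,\chi]$ (resp. in $(\chi+\eta-1,\chi)$); $\mathcal E_0$: $\eta=1$ and $\chi$ is a root; $\mathcal E_1$: $\eta<1$ and $\chi$ is a root; $\mathcal E_2$: $\eta<1$ and $\chi+\eta-1$ is a root. Let $C(w)=\int\frac{\mu[dx]}{w-x}$. Put $R_\mu=\{t\in\mathbb R\setminus\mathrm{Supp}(\mu):C(t)\ne0\}$, $R_0=\{t\in\mathbb R\setminus\mathrm{Supp}(\mu):C(t)=0\}$, $R_{\lambda-\mu}=\mathbb R\setminus\mathrm{Supp}(\lambda-\mu)$; $R_1$ (resp. $R_2$) is the set of $t$ contained in an interval $I=(t_2,t_1)$ with $(t,t_1)\subset\mathbb R\setminus\mathrm{Supp}(\mu)$ and $(t_2,t)\subset\mathbb R\setminus\mathrm{Supp}(\lambda-\mu)$ (resp. $(t,t_1)\subset\mathbb R\setminus\mathrm{Supp}(\lambda-\mu)$ and $(t_2,t)\subset\mathbb R\setminus\mathrm{Supp}(\mu)$); call such an $I$ admissible for $t$. Let $R:=R_\mu\cup R_{\lambda-\mu}\cup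 R_0\cup R_1\cup R_2$. For an interval $I$ let $C_I(t)=\int_{[a,b]\setminus I}\frac{\mu[dx]}{t-x}$. On $\mathbb R\setminus\mathrm{Supp}(\mu)$ the functions $e^{C}$ and $C'$ have their usual meaning; on $R_{\lambda-\mu}$ they denote the analytic extensions $e^{C(t)}=e^{C_I(t)}\frac{t-t_2}{t-t_1}$ and $C'(t)=C_I'(t)-\frac1{t-t_1}+\frac1{t-t_2}$, where $I=(t_2,t_1)\ni t$ is any interval in $R_{\lambda-\mu}$. The edge curve $\gamma=(\chi_{\mathcal E},\eta_{\mathcal E})$ on $R$ is $$\chi_{\mathcal E}(t)=t+\frac{e^{C(t)}-1}{e^{C(t)}C'(t)},\quad \eta_{\mathcal E}(t)=1+\frac{(e^{C(t)}-1)^2}{e^{C(t)}C'(t)}\qquad (t\in R_\mu\cup R_0\cup R_{\lambda-\mu}),$$ $(\chi_{\mathcal E}(t),\eta_{\mathcal E}(t))=(t,\,1-e^{C_I(t)}(t-t_2))$ for $t\in R_1$, and $(t-e^{-C_I(t)}(t-t_1),\,1+e^{-C_I(t)}(t-t_1))$ for $t\in R_2$ ($I$ any admissible interval; nothing depends on the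 choice of $I$). Write $f'_t:=f'_{\gamma(t)}$. Finally put $\mathbf x=(1,e^{C(t)}-1)$, $\mathbf y=(e^{C(t)}-1,-1)$ for $t\in R_\mu\cup R_0\cup R_{\lambda-\mu}$; $\mathbf x=(0,1)$, $\mathbf y=(1,0)$ for $t\in R_1$; $\mathbf x=(1,-1)$, $\mathbf y=(1,1)$ for $t\in R_2$. Then the following hold. **(A)** Every $t\in R$ satisfies exactly one of the following nine conditions: (1) $\gamma(t)\in\mathcal E_\mu$, $t\in R_\mu$, and $t$ is a root of $f'_t$ of multiplicity 2; (2) the same with multiplicity 3; (3) $\gamma(t)\in\mathcal E_{\lambda-\mu}$, $t\in R_{\lambda-\mu}$, and $t$ is a root of $f'_t$ of multiplicity 2; (4) the same with multiplicity 3; (5) $\gamma(t)\in\mathcal E_0$, $t\in R_0$, and $t$ is a root of $f'_t$ of multiplicity 1; (6) $\gamma(t)\in\mathcal E_1$, $t\in R_1$, and $t$ is a root of $f'_t$ of multiplicity 1; (7) the same with multiplicity 2; (8) $\gamma(t)\in\mathcal E_2$, $t\in R_2$, and $t$ is a root of $f'_t$ of multiplicity 1; (9) the same with multiplicity 2. **(B)**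 The curve $\gamma$ is smooth at every $t\in R$, the vectors $\mathbf x,\mathbf y$ are non-zero and orthogonal, and there are real $a_1,a_2,b_1,b_2$ (depending on $t$) with $\gamma(s)-\gamma(t)=a(s)\mathbf x+b(s)\mathbf y$ for all $s$ near $t$, where $a(s)=a_1(s-t)+a_2(s-t)^2+O((s-t)^3)$ and $b(s)=b_1(s-t)^2+b_2(s-t)^3+O((s-t)^4)$ as $s\to t$. These satisfy: * In cases (1), (3), (5), (6), (8): $a_1\ne0$, $b_1\ne0$, $\gamma'(t)=a_1\mathbf x$, and the curvature $\frac{\chi_{\mathcal E}'\eta_{\mathcal E}''-\eta_{\mathcal E}'\chi_{\mathcal E}''}{((\chi_{\mathcal E}')^2+(\eta_{\mathcal E}')^2)^{3/2}}$ is negative at $t$; so the edge behaves like a parabola with negative curvature, with tangent vector $\mathbf x$ and normal vector $\mathbf y$. * In cases (2), (4), (7), (9): $a_1=b_1=0$, $a_2\ne0$, $b_2\ne0$; so the edge has a cusp of first order. * In cases (1)-(4), $\gamma(t)$ lies in the interior of $\mathcal S$. In cases (1), (3), $a_1=-\frac{e^{C(t)}-1}{e^{C(t)}C'(t)^2}f_t'''(t)$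 and $b_1=\frac12\frac{e^{C(t)}-1}{C'(t)(1+(e^{C(t)}-1)^2)}f_t'''(t)$. In cases (2), (4), $a_2=-\frac12\frac{e^{C(t)}-1}{e^{C(t)}C'(t)^2}f_t^{(4)}(t)$ and $b_2=\frac13\frac{e^{C(t)}-1}{C'(t)(1+(e^{C(t)}-1)^2)}f_t^{(4)}(t)$. * In case (5), $\gamma(t)=(t,1)$, $\mathbf x=(1,0)$, $\mathbf y=(0,-1)$, $a_1=2$ and $b_1=-C'(t)=-f_t''(t)=\int\frac{\mu[dx]}{(t-x)^2}$. * In cases (6), (7), $\chi_{\mathcal E}(t)=t$ and $\eta_{\mathcal E}(t)\in(0,1)$. For every admissible $I=(t_2,t_1)$: in case (6), $a_1=-2(t-t_2)e^{C_I(t)}f_t''(t)$ and $b_1=-f_t''(t)$; in case (7), $a_2=-\frac32(t-t_2)e^{C_I(t)}f_t'''(t)$ and $b_2=-f_t'''(t)$. * In cases (8), (9), $\chi_{\mathcal E}(t)+\eta_{\mathcal E}(t)-1=t$ and $\eta_{\mathcal E}(t)\in(0,1)$. For every admissible $I=(t_2,t_1)$: in case (8), $a_1=2(t-t_1)e^{-C_I(t)}f_t''(t)$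 and $b_1=\frac12f_t''(t)$; in case (9), $a_2=\frac32(t-t_1)e^{-C_I(t)}f_t'''(t)$ and $b_2=\frac12f_t'''(t)$. **(C)** The set of $t\in R_\mu$ that are roots of $f'_t$ of multiplicity 3, the set of $t\in R_{\lambda-\mu}$ that are roots of $f'_t$ of multiplicity 3, and the set $R_0$ are subsets of $(a,b)$ consisting of isolated points; $R_1$ and $R_2$ are subsets of $[a,b]$ consisting of isolated points. -/

import Mathlib

open MeasureTheory Set Filter Topology Asymptotics
open scoped BoundedContinuousFunction ContDiff

namespace GTEdge

/-- The standing assumption: `μ` has support inside `[a,b]`, both end-points belong to the support,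
`b - a > 1`, and `μ` is the weak limit of the rescaled empirical measures of
`x⁽ⁿ⁾_1 > ⋯ > x⁽ⁿ⁾_n` (integers), i.e. `(1/n) ∑ δ_{x_i/n} → μ`. -/
structure IsTopRowLimit (x : ∀ n : ℕ, Fin n → ℤ) (μ : Measure ℝ) (a b : ℝ) : Prop where
  strictAnti : ∀ n, StrictAnti (x n)
  supp_subset : μ.support ⊆ Icc a b
  left_mem : a ∈ μ.support
  right_mem : b ∈ μ.support
  one_lt : 1 < b - a
  tendsto : ∀ g : ℝ →ᵇ ℝ,
    Tendsto (fun n : ℕ => (1 / (n : ℝ)) * ∑ i, g ((x n i : ℝ) / (n : ℝ))) atTop (𝓝 (∫ y, g y ∂μ))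

/-- The measure `λ - μ`, where `λ` is Lebesgue measure. -/
noncomputable def coMeasure (μ : Measure ℝ) : Measure ℝ := volume - μ

/-- The set `{(χ,η) ∈ [a,b] × [0,1] : b ≥ χ ≥ χ + η - 1 ≥ a}`. -/
def shape (a b : ℝ) : Set (ℝ × ℝ) :=
  {p | p.1 ∈ Icc a b ∧ p.2 ∈ Icc (0 : ℝ) 1 ∧ p.1 ≤ b ∧ p.1 + p.2 - 1 ≤ p.1 ∧ a ≤ p.1 + p.2 - 1}

/-! ### The function `f'_{(χ,η)}` and its roots -/

/-- `f'_{(χ,η)}(w)` for `p = (χ,η)`. -/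
noncomputable def fPrime (μ : Measure ℝ) (a b : ℝ) (p : ℝ × ℝ) (w : ℂ) : ℂ :=
  (∫ x : ℝ in Icc p.1 b, 1 / (w - (x : ℂ)) ∂μ)
    - (∫ x : ℝ in Icc (p.1 + p.2 - 1) p.1, 1 / (w - (x : ℂ)) ∂(coMeasure μ))
    + ∫ x : ℝ in Icc a (p.1 + p.2 - 1), 1 / (w - (x : ℂ)) ∂μ

/-- The real closed set `S = S₁ ∪ S₂ ∪ S₃` such that `f'_{(χ,η)}` is analytic on `ℂ ∖ S`. -/
def fSupport (μ : Measure ℝ) (a b : ℝ) (p : ℝ × ℝ) : Set ℝ :=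
  (μ.restrict (Icc p.1 b)).support
    ∪ ((coMeasure μ).restrict (Icc (p.1 + p.2 - 1) p.1)).support
    ∪ (μ.restrict (Icc a (p.1 + p.2 - 1))).support

/-- The real point `s` belongs to the domain of `f'_{(χ,η)}` and is a root of multiplicity `m`. -/
def IsRootOfMult (μ : Measure ℝ) (a b : ℝ) (p : ℝ × ℝ) (s : ℝ) (m : ℕ∞) : Prop :=
  s ∉ fSupport μ a b p ∧ 1 ≤ m ∧ analyticOrderAt (fPrime μ a b p) (s : ℂ) = m

/-- `s` is a root of `f'_{(χ,η)}`. -/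
def IsRoot (μ : Measure ℝ) (a b : ℝ) (p : ℝ × ℝ) (s : ℝ) : Prop :=
  s ∉ fSupport μ a b p ∧ fPrime μ a b p (s : ℂ) = 0

/-- `s` is a repeated root of `f'_{(χ,η)}`. -/
def IsRepeatedRoot (μ : Measure ℝ) (a b : ℝ) (p : ℝ × ℝ) (s : ℝ) : Prop :=
  ∃ m : ℕ∞, 2 ≤ m ∧ IsRootOfMult μ a b p s m

/-! ### The edge, in terms of the roots of `f'` -/

def edgeMu (μ : Measure ℝ) (a b : ℝ) : Set (ℝ × ℝ) :=
  {p | p ∈ shape a b ∧ ∃ s : ℝ, s ∉ Icc (p.1 + p.2 - 1) p.1 ∧ IsRepeatedRoot μ a b p s}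

def edgeCoMu (μ : Measure ℝ) (a b : ℝ) : Set (ℝ × ℝ) :=
  {p | p ∈ shape a b ∧ ∃ s : ℝ, s ∈ Ioo (p.1 + p.2 - 1) p.1 ∧ IsRepeatedRoot μ a b p s}

def edgeZero (μ : Measure ℝ) (a b : ℝ) : Set (ℝ × ℝ) :=
  {p | p ∈ shape a b ∧ p.2 = 1 ∧ IsRoot μ a b p p.1}

def edgeOne (μ : Measure ℝ) (a b : ℝ) : Set (ℝ × ℝ) :=
  {p | p ∈ shape a b ∧ p.2 < 1 ∧ IsRoot μ a b p p.1}

def edgeTwo (μ : Measure ℝ) (a b : ℝ) : Set (ℝ × ℝ) :=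
  {p | p ∈ shape a b ∧ p.2 < 1 ∧ IsRoot μ a b p (p.1 + p.2 - 1)}

/-! ### The parameter set `R` -/

/-- The Cauchy transform `C(t) = ∫ μ(dx)/(t - x)` at real points outside the support of `μ`. -/
noncomputable def cauchy (μ : Measure ℝ) (t : ℝ) : ℝ := ∫ x : ℝ, 1 / (t - x) ∂μ

def RMu (μ : Measure ℝ) : Set ℝ := {t | t ∉ μ.support ∧ cauchy μ t ≠ 0}

def RCoMu (μ : Measure ℝ) : Set ℝ := {t | t ∉ (coMeasure μ).support}

def RZero (μ : Measure ℝ) : Set ℝ := {t | t ∉ μ.support ∧ cauchy μ t = 0}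

/-- `I = (t₂,t₁)`, with `t₂ = I.1` and `t₁ = I.2`, is an interval around `t` that does not meet the
support of `λ - μ`. -/
def IsCoGap (μ : Measure ℝ) (t : ℝ) (I : ℝ × ℝ) : Prop :=
  t ∈ Ioo I.1 I.2 ∧ Ioo I.1 I.2 ⊆ (coMeasure μ).supportᶜ

/-- `I = (t₂,t₁)` contains `t`, with `(t,t₁) ⊆ ℝ ∖ Supp μ` and `(t₂,t) ⊆ ℝ ∖ Supp (λ - μ)`. -/
def IsGapOne (μ : Measure ℝ) (t : ℝ) (I : ℝ × ℝ) : Prop :=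
  t ∈ Ioo I.1 I.2 ∧ Ioo t I.2 ⊆ μ.supportᶜ ∧ Ioo I.1 t ⊆ (coMeasure μ).supportᶜ

/-- `I = (t₂,t₁)` contains `t`, with `(t,t₁) ⊆ ℝ ∖ Supp (λ - μ)` and `(t₂,t) ⊆ ℝ ∖ Supp μ`. -/
def IsGapTwo (μ : Measure ℝ) (t : ℝ) (I : ℝ × ℝ) : Prop :=
  t ∈ Ioo I.1 I.2 ∧ Ioo t I.2 ⊆ (coMeasure μ).supportᶜ ∧ Ioo I.1 t ⊆ μ.supportᶜ

def ROne (μ : Measure ℝ) : Set ℝ := {t | ∃ I, IsGapOne μ t I}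

def RTwo (μ : Measure ℝ) : Set ℝ := {t | ∃ I, IsGapTwo μ t I}

def REdge (μ : Measure ℝ) : Set ℝ := RMu μ ∪ RCoMu μ ∪ RZero μ ∪ ROne μ ∪ RTwo μ

/-! ### The edge curve -/

/-- `C_I(t) = ∫_{[a,b] ∖ I} μ(dx)/(t - x)`. -/
noncomputable def cauchyOff (μ : Measure ℝ) (a b : ℝ) (I : ℝ × ℝ) (t : ℝ) : ℝ :=
  ∫ x : ℝ in Icc a b \ Ioo I.1 I.2, 1 / (t - x) ∂μ

open Classical in
/-- The analytic extension of `e^C` to `(ℝ ∖ Supp μ) ∪ (ℝ ∖ Supp (λ - μ))`. On the second set it is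
`e^{C_I(t)} (t - t₂)/(t - t₁)`, for any interval `I = (t₂,t₁)` around `t` in that set (the value
does not depend on the interval). -/
noncomputable def expC (μ : Measure ℝ) (a b t : ℝ) : ℝ :=
  if t ∉ μ.support then Real.exp (cauchy μ t)
  else if h : ∃ I, IsCoGap μ t I then
    Real.exp (cauchyOff μ a b h.choose t) * ((t - h.choose.1) / (t - h.choose.2))
  else 0

open Classical in
/-- The analytic extension of `C'` to `(ℝ ∖ Supp μ) ∪ (ℝ ∖ Supp (λ - μ))`. On the second set it is
`C_I'(t) - 1/(t - t₁) + 1/(t - t₂)`, for any interval `I = (t₂,t₁)` around `t` in that set (the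
value does not depend on the interval). -/
noncomputable def derivC (μ : Measure ℝ) (a b t : ℝ) : ℝ :=
  if t ∉ μ.support then deriv (cauchy μ) t
  else if h : ∃ I, IsCoGap μ t I then
    deriv (cauchyOff μ a b h.choose) t - 1 / (t - h.choose.2) + 1 / (t - h.choose.1)
  else 0

open Classical in
/-- The edge curve `t ↦ (χ(t), η(t))` on `R`. On `R₁` and `R₂` any interval `I = (t₂,t₁)` as in
`IsGapOne`, `IsGapTwo` may be used (the value does not depend on the interval). -/
noncomputable def edgeCurve (μ : Measure ℝ) (a b t : ℝ) : ℝ × ℝ :=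
  if h : ∃ I, IsGapOne μ t I then
    (t, 1 - Real.exp (cauchyOff μ a b h.choose t) * (t - h.choose.1))
  else if h : ∃ I, IsGapTwo μ t I then
    (t - Real.exp (-cauchyOff μ a b h.choose t) * (t - h.choose.2),
      1 + Real.exp (-cauchyOff μ a b h.choose t) * (t - h.choose.2))
  else
    (t + (expC μ a b t - 1) / (expC μ a b t * derivC μ a b t),
      1 + (expC μ a b t - 1) ^ 2 / (expC μ a b t * derivC μ a b t))

/-- `t` is a root of multiplicity `m` of `f'_t`, the function `f'_{(χ,η)}` at the point
`(χ,η) = (χ(t),η(t))` of the edge curve. -/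
def HasMult (μ : Measure ℝ) (a b t : ℝ) (m : ℕ∞) : Prop :=
  IsRootOfMult μ a b (edgeCurve μ a b t) t m

/-- The (real) value at `t` of the `k`-th derivative of `f'_t`, so that `fDer 1, 2, 3` are
`f_t''(t)`, `f_t'''(t)`, `f_t⁗(t)`. -/
noncomputable def fDer (μ : Measure ℝ) (a b t : ℝ) (k : ℕ) : ℝ :=
  (iteratedDeriv k (fPrime μ a b (edgeCurve μ a b t)) (t : ℂ)).re

/-- The nine cases. -/
def EdgeCase (μ : Measure ℝ) (a b t : ℝ) : ℕ → Prop
  | 1 => edgeCurve μ a b t ∈ edgeMu μ a b ∧ t ∈ RMu μ ∧ HasMult μ a b t 2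
  | 2 => edgeCurve μ a b t ∈ edgeMu μ a b ∧ t ∈ RMu μ ∧ HasMult μ a b t 3
  | 3 => edgeCurve μ a b t ∈ edgeCoMu μ a b ∧ t ∈ RCoMu μ ∧ HasMult μ a b t 2
  | 4 => edgeCurve μ a b t ∈ edgeCoMu μ a b ∧ t ∈ RCoMu μ ∧ HasMult μ a b t 3
  | 5 => edgeCurve μ a b t ∈ edgeZero μ a b ∧ t ∈ RZero μ ∧ HasMult μ a b t 1
  | 6 => edgeCurve μ a b t ∈ edgeOne μ a b ∧ t ∈ ROne μ ∧ HasMult μ a b t 1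
  | 7 => edgeCurve μ a b t ∈ edgeOne μ a b ∧ t ∈ ROne μ ∧ HasMult μ a b t 2
  | 8 => edgeCurve μ a b t ∈ edgeTwo μ a b ∧ t ∈ RTwo μ ∧ HasMult μ a b t 1
  | 9 => edgeCurve μ a b t ∈ edgeTwo μ a b ∧ t ∈ RTwo μ ∧ HasMult μ a b t 2
  | _ => False

/-! ### Local geometry of the curve -/

open Classical in
/-- The tangential vector `𝐱(t)`. -/
noncomputable def xVec (μ : Measure ℝ) (a b t : ℝ) : ℝ × ℝ :=
  if t ∈ ROne μ then (0, 1)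
  else if t ∈ RTwo μ then (1, -1)
  else (1, expC μ a b t - 1)

open Classical in
/-- The normal vector `𝐲(t)`. -/
noncomputable def yVec (μ : Measure ℝ) (a b t : ℝ) : ℝ × ℝ :=
  if t ∈ ROne μ then (1, 0)
  else if t ∈ RTwo μ then (1, 1)
  else (expC μ a b t - 1, -1)

/-- `γ(s) - γ(t) = a(s) 𝐱 + b(s) 𝐲` for `s` near `t`, where
`a(s) = a₁ (s-t) + a₂ (s-t)² + O((s-t)³)` and `b(s) = b₁ (s-t)² + b₂ (s-t)³ + O((s-t)⁴)`. -/
def HasExpansion (γ : ℝ → ℝ × ℝ) (t : ℝ) (x y : ℝ × ℝ) (a₁ a₂ b₁ b₂ : ℝ) : Prop :=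
  ∃ α β : ℝ → ℝ,
    (∀ᶠ s in 𝓝 t, γ s - γ t = α s • x + β s • y) ∧
    (fun s => α s - (a₁ * (s - t) + a₂ * (s - t) ^ 2)) =O[𝓝 t] (fun s => (s - t) ^ 3) ∧
    (fun s => β s - (b₁ * (s - t) ^ 2 + b₂ * (s - t) ^ 3)) =O[𝓝 t] (fun s => (s - t) ^ 4)

/-- The signed curvature `(χ' η'' - η' χ'') / (χ'² + η'²)^{3/2}` of `γ = (χ,η)` at `t`. -/
noncomputable def curvature (γ : ℝ → ℝ × ℝ) (t : ℝ) : ℝ :=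
  let χ : ℝ → ℝ := fun s => (γ s).1
  let η : ℝ → ℝ := fun s => (γ s).2
  (deriv χ t * iteratedDeriv 2 η t - deriv η t * iteratedDeriv 2 χ t)
    / (deriv χ t ^ 2 + deriv η t ^ 2) ^ (3 / 2 : ℝ)

/-- Given the expansion with coefficients `a₁`, `b₁`, the curve looks at `t` like a parabola with
tangent vector `x` and has negative curvature. -/
def IsParabolic (γ : ℝ → ℝ × ℝ) (t : ℝ) (x : ℝ × ℝ) (a₁ b₁ : ℝ) : Prop :=
  a₁ ≠ 0 ∧ b₁ ≠ 0 ∧ HasDerivAt γ (a₁ • x) t ∧ curvature γ t < 0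

/-- Given the expansion with coefficients `a₁`, `a₂`, `b₁`, `b₂`, the curve looks at `t` like
`(a₂ u², b₂ u³)`, a cusp of first order. -/
def IsFirstOrderCusp (a₁ a₂ b₁ b₂ : ℝ) : Prop := a₁ = 0 ∧ b₁ = 0 ∧ a₂ ≠ 0 ∧ b₂ ≠ 0

end GTEdge

open GTEdge

namespace GTEdge

/-! ### Domination by Lebesgue measure and the density -/

/-! Distinct integers put at most n(d-c)+1 of the points x_i/n into [c,d]. Hence μ ≤ λ in the limit,
and μ has a density f with values in [0,1]. With χ₂ = χ+η-1, the function f'_{(χ,η)} is the Cauchy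
transform of the single signed density f - 1_{[χ₂,χ]} (`IsDensity.fPrime_eq`).

Near each t in R, f agrees a.e. with the indicator of an interval [p,q]: p = q off Supp μ, p < t < q
off Supp(λ-μ), t = q on R₁, t = p on R₂. Integrating the indicator explicitly gives e^C = N/D with
D(s) = s-q and N(s) = e^{h(s)}(s-p), where h is the Cauchy transform of f - 1_{[p,q]} and is
analytic near t. In these terms all the formulas for the edge become one, γ = (s + MD/W, 1 + M²/W)
with M = N-D and W = N'D-ND', which stays regular where e^C has a zero or a pole (`IsModelAt`).

Geometry: γ' = k(D,M) for a scalar k, so γ'×γ'' = k²(DM'-MD') = k²W. The bounds 0 ≤ f ≤ 1 force W <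
0 everywhere (`IsDensity.wron_neg`). So the curvature is negative where k ≠ 0, and a simple zero of
k is a cusp of first order. Taylor expansion in the frame (𝐱,𝐲) gives the coefficients
(`hasExpansion_modelCurve`).

Roots: writing e^C with [χ₂,χ] in place of [p,q] gives e^{f'(w)}(w-q)(w-χ₂) = N(w)(w-χ) near t.
Differentiating this up to three times at t shows which derivatives of f'_t must vanish. It also
shows that k, and k' when k = 0, are explicit non-zero multiples of the next two derivatives
(`speed_eq_of_simple`, `speed_eq_of_double`). Only M = 0, that is e^C = 1, needs a separate
treatment: there [χ₂,χ] = {t} and f'_t is C itself.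

Bounds on multiplicity and position: (f - 1_{[χ₂,χ]})(y)·(y-χ)(y-χ₂) ≥ 0, and it is not a.e. zero
because b-a > 1. Integrated against (t-y)^{-n-2} with n even, it gives a strictly positive
combination of three consecutive moments of f - 1_{[χ₂,χ]} (`IsDensity.quad_pos`). For n = 2 this
bounds the multiplicity, so that k and k' never vanish together; for n = 0 it gives η > 0. Linear
weights give χ < b and a < χ₂ in the same way. -/

lemma card_scaled_mem_Icc_le {n : ℕ} (hn : 0 < n) {x : Fin n → ℤ} (hx : Function.Injective x)
    {c d : ℝ} (hcd : c ≤ d) :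
    ((Finset.univ.filter fun i => (x i : ℝ) / n ∈ Icc c d).card : ℝ) ≤ n * (d - c) + 1 := by
  have hn' : (0 : ℝ) < n := by exact_mod_cast hn
  have h1 : (Finset.univ.filter fun i => (x i : ℝ) / n ∈ Icc c d).card
      ≤ (Finset.Icc ⌈n * c⌉ ⌊n * d⌋).card := by
    refine Finset.card_le_card_of_injOn x ?_ hx.injOn
    intro i hi
    have hi' : (x i : ℝ) / n ∈ Icc c d := by simpa using hi
    have h2 := (le_div_iff₀ hn').1 hi'.1
    have h3 := (div_le_iff₀ hn').1 hi'.2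
    simp only [Finset.coe_Icc, mem_Icc]
    exact ⟨Int.ceil_le.2 (by linarith), Int.le_floor.2 (by linarith)⟩
  have h2 : ((Finset.Icc ⌈n * c⌉ ⌊n * d⌋).card : ℝ) ≤ n * (d - c) + 1 := by
    rw [Int.card_Icc]
    rcases le_total 0 (⌊n * d⌋ + 1 - ⌈n * c⌉) with h | h
    · have : (((⌊n * d⌋ + 1 - ⌈n * c⌉).toNat : ℤ) : ℝ) = ((⌊n * d⌋ + 1 - ⌈n * c⌉ : ℤ) : ℝ) := by
        rw [Int.toNat_of_nonneg h]
      have h3 : ((⌊n * d⌋ + 1 - ⌈n * c⌉).toNat : ℝ) = (⌊n * d⌋ : ℝ) + 1 - ⌈n * c⌉ := by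
        have := this; push_cast at this ⊢; exact_mod_cast this
      rw [h3]
      have := Int.floor_le ((n : ℝ) * d)
      have := Int.le_ceil ((n : ℝ) * c)
      linarith
    · rw [Int.toNat_of_nonpos h]
      have : 0 ≤ (n : ℝ) * (d - c) := mul_nonneg hn'.le (by linarith)
      push_cast; linarith
  exact le_trans (by exact_mod_cast h1) h2

/-- A trapezoid equal to `1` on `[c,d]` and to `0` off `[c-δ,d+δ]`. -/
noncomputable def trapezoid (c d δ : ℝ) : ℝ →ᵇ ℝ :=
  BoundedContinuousFunction.ofNormedAddCommGroup
    (fun x => max 0 (min 1 (min ((x - (c - δ)) / δ) ((d + δ - x) / δ))))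
    (by fun_prop) 1 (fun x => by
      rw [Real.norm_eq_abs, abs_of_nonneg (le_max_left _ _)]
      exact max_le zero_le_one (min_le_left _ _))

lemma trapezoid_apply (c d δ x : ℝ) :
    trapezoid c d δ x = max 0 (min 1 (min ((x - (c - δ)) / δ) ((d + δ - x) / δ))) := rfl

lemma trapezoid_nonneg (c d δ x : ℝ) : 0 ≤ trapezoid c d δ x := le_max_left _ _

lemma trapezoid_le_indicator {c d δ : ℝ} (hδ : 0 < δ) (x : ℝ) :
    trapezoid c d δ x ≤ (Icc (c - δ) (d + δ)).indicator 1 x := by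
  by_cases hx : x ∈ Icc (c - δ) (d + δ)
  · rw [indicator_of_mem hx]; exact max_le zero_le_one (min_le_left _ _)
  · rw [indicator_of_notMem hx, trapezoid_apply]
    refine max_le le_rfl ?_
    rw [mem_Icc, not_and_or, not_le, not_le] at hx
    rcases hx with hx | hx
    · exact (min_le_right _ _).trans ((min_le_left _ _).trans
        (div_nonpos_of_nonpos_of_nonneg (by linarith) hδ.le))
    · exact (min_le_right _ _).trans ((min_le_right _ _).trans
        (div_nonpos_of_nonpos_of_nonneg (by linarith) hδ.le))

lemma indicator_le_trapezoid {c d δ : ℝ} (hδ : 0 < δ) (x : ℝ) :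
    (Icc c d).indicator 1 x ≤ trapezoid c d δ x := by
  by_cases hx : x ∈ Icc c d
  · rw [indicator_of_mem hx, trapezoid_apply]
    refine le_max_of_le_right (le_min le_rfl (le_min ?_ ?_))
    · rw [Pi.one_apply, le_div_iff₀ hδ]; linarith [hx.1]
    · rw [Pi.one_apply, le_div_iff₀ hδ]; linarith [hx.2]
  · rw [indicator_of_notMem hx]; exact trapezoid_nonneg _ _ _ _

variable {x : ∀ n : ℕ, Fin n → ℤ} {μ : Measure ℝ} {a b : ℝ}

/-- The trapezoid with margins ε/2 dominates the indicator of [c,d], and its empirical mean is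
controlled by the counting bound on the enlarged interval. The error 1/n of that bound disappears in
the limit. -/
lemma IsTopRowLimit.real_Icc_le [IsProbabilityMeasure μ] (hμ : IsTopRowLimit x μ a b)
    {c d : ℝ} (hcd : c ≤ d) : μ.real (Icc c d) ≤ d - c := by
  refine le_of_forall_pos_le_add fun ε hε => ?_
  set δ := ε / 2 with hδdef
  have hδ : 0 < δ := by positivity
  have h1 : μ.real (Icc c d) ≤ ∫ y, trapezoid c d δ y ∂μ := by
    rw [← integral_indicator_one measurableSet_Icc]
    refine integral_mono ?_ (BoundedContinuousFunction.integrable μ _)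
      (indicator_le_trapezoid hδ)
    exact (integrable_const (1 : ℝ)).indicator measurableSet_Icc
  refine h1.trans ?_
  have hlim : Tendsto (fun n : ℕ => (d - c + ε) + (n : ℝ)⁻¹) atTop (𝓝 (d - c + ε + 0)) :=
    tendsto_const_nhds.add tendsto_inv_atTop_nhds_zero_nat
  rw [add_zero] at hlim
  refine le_of_tendsto_of_tendsto (hμ.tendsto (trapezoid c d δ)) hlim ?_
  filter_upwards [eventually_gt_atTop 0] with n hn
  have hn' : (0 : ℝ) < n := by exact_mod_cast hn
  have h2 : ∑ i, trapezoid c d δ ((x n i : ℝ) / n)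
      ≤ ((Finset.univ.filter fun i => (x n i : ℝ) / n ∈ Icc (c - δ) (d + δ)).card : ℝ) := by
    rw [Finset.card_eq_sum_ones, Finset.sum_filter]
    push_cast
    refine Finset.sum_le_sum fun i _ => (trapezoid_le_indicator hδ _).trans ?_
    by_cases h : (x n i : ℝ) / n ∈ Icc (c - δ) (d + δ)
    · rw [indicator_of_mem h, if_pos h]; exact le_rfl
    · rw [indicator_of_notMem h, if_neg h]
  have h3 := card_scaled_mem_Icc_le hn (hμ.strictAnti n).injective
    (show c - δ ≤ d + δ by linarith)
  rw [one_div, inv_mul_le_iff₀ hn']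
  have : (n : ℝ) * (d - c + ε + (n : ℝ)⁻¹) = n * (d - c + ε) + 1 := by field_simp
  rw [this]
  have : d + δ - (c - δ) = d - c + ε := by rw [hδdef]; ring
  rw [← this]
  exact h2.trans h3

/-- Lebesgue outer measure is the largest outer measure bounded by the length of covering intervals,
so a comparison on intervals suffices. -/
lemma le_volume_of_Icc_le [IsFiniteMeasure μ]
    (h : ∀ c d : ℝ, c ≤ d → μ.real (Icc c d) ≤ d - c) : μ ≤ volume := by
  have key : μ.toOuterMeasure ≤ StieltjesFunction.id.outer := by
    rw [StieltjesFunction.outer, OuterMeasure.le_ofFunction]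
    intro s
    rw [StieltjesFunction.length_eq]
    refine le_iInf fun c => le_iInf fun d => le_iInf fun hs => ?_
    have hs' : s ⊆ Ioc c d := by
      -- The Stieltjes length ignores least elements of the line; ℝ has none, as y - 1 < y.
      intro y hy; exact hs ⟨hy, fun hb => (not_le.2 (sub_one_lt y)) (hb _)⟩
    rcases le_total c d with hcd | hcd
    · have h1 : μ s ≤ μ (Icc c d) := measure_mono (hs'.trans Ioc_subset_Icc_self)
      have h2 : μ (Icc c d) ≤ ENNReal.ofReal (d - c) := by
        rw [← ENNReal.ofReal_toReal (measure_ne_top μ (Icc c d))]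
        exact ENNReal.ofReal_le_ofReal (h c d hcd)
      exact h1.trans h2
    · rw [Ioc_eq_empty (not_lt.2 hcd)] at hs'
      rw [subset_empty_iff.1 hs']
      simp
  rw [Measure.le_iff]
  intro s hs
  rw [Real.volume_eq_stieltjes_id, StieltjesFunction.measure]
  have := key s
  exact this

/-- `f` is the density of the probability measure `μ ≤ λ`; it vanishes off `[a,b]`, and `a`, `b` are
in the support of `μ`. -/
structure IsDensity (μ : Measure ℝ) (a b : ℝ) (f : ℝ → ℝ) : Prop where
  meas : Measurable f
  nonneg : ∀ y, 0 ≤ f y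
  le_one : ∀ y, f y ≤ 1
  zero_off : ∀ y, y ∉ Icc a b → f y = 0
  eq : μ = volume.withDensity fun y => ENNReal.ofReal (f y)
  integral_one : ∫ y, f y = 1
  supp_subset : μ.support ⊆ Icc a b
  left_mem : a ∈ μ.support
  right_mem : b ∈ μ.support
  one_lt : 1 < b - a

lemma IsTopRowLimit.exists_isDensity [IsProbabilityMeasure μ] (hμ : IsTopRowLimit x μ a b) :
    ∃ f, IsDensity μ a b f := by
  have hle : μ ≤ volume := le_volume_of_Icc_le fun c d hcd => hμ.real_Icc_le hcd
  have hac : μ ≪ volume := hle.absolutelyContinuous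
  set r := μ.rnDeriv volume with hr
  have hr1 : r ≤ᵐ[volume] 1 := Measure.rnDeriv_le_one_of_le hle
  have hr0 : ∀ᵐ y, y ∉ Icc a b → r y = 0 := by
    have h0 : μ (Icc a b)ᶜ = 0 :=
      measure_mono_null (compl_subset_compl.2 hμ.supp_subset) Measure.measure_compl_support
    rw [← Measure.withDensity_rnDeriv_eq μ volume hac,
      withDensity_apply _ measurableSet_Icc.compl,
      lintegral_eq_zero_iff (Measure.measurable_rnDeriv _ _)] at h0
    exact (ae_restrict_iff' measurableSet_Icc.compl).1 h0
  -- Truncating at 1 and cutting off outside [a,b] turns a.e. bounds on the Radon-Nikodym derivative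
  -- into bounds at every point.
  set f : ℝ → ℝ := (Icc a b).indicator fun y => min (r y).toReal 1 with hf
  have hmeas : Measurable f :=
    ((Measure.measurable_rnDeriv _ _).ennreal_toReal.min measurable_const).indicator
      measurableSet_Icc
  have hnn : ∀ y, 0 ≤ f y := fun y =>
    indicator_nonneg (fun _ _ => le_min ENNReal.toReal_nonneg zero_le_one) y
  have heq : μ = volume.withDensity fun y => ENNReal.ofReal (f y) := by
    conv_lhs => rw [← Measure.withDensity_rnDeriv_eq μ volume hac]
    refine withDensity_congr_ae ?_
    filter_upwards [hr1, hr0] with y h1 h0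
    by_cases hy : y ∈ Icc a b
    · have h1' : r y ≤ 1 := h1
      have hne : r y ≠ ⊤ := ne_top_of_le_ne_top ENNReal.one_ne_top h1'
      rw [hf, indicator_of_mem hy, min_eq_left, ENNReal.ofReal_toReal hne]
      exact ENNReal.toReal_le_of_le_ofReal zero_le_one (by simpa using h1')
    · rw [hf, indicator_of_notMem hy, ENNReal.ofReal_zero]; exact h0 hy
  refine ⟨f, hmeas, hnn, fun y => ?_, fun y hy => indicator_of_notMem hy _, heq, ?_,
    hμ.supp_subset, hμ.left_mem, hμ.right_mem, hμ.one_lt⟩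
  · exact indicator_le' (fun _ _ => min_le_right _ _) (fun _ _ => zero_le_one) y
  · have h1 : μ univ = 1 := measure_univ
    rw [heq, withDensity_apply _ MeasurableSet.univ, Measure.restrict_univ] at h1
    rw [integral_eq_lintegral_of_nonneg_ae (Eventually.of_forall hnn) hmeas.aestronglyMeasurable,
      h1]
    simp

/-! ### Supports in terms of densities -/

lemma notMem_support_withDensity_iff {g : ℝ → ℝ} (hg : Measurable g) (h0 : ∀ y, 0 ≤ g y) {t : ℝ} :
    t ∉ (volume.withDensity fun y => ENNReal.ofReal (g y)).support ↔
      ∃ r > 0, ∀ᵐ y, |y - t| < r → g y = 0 := by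
  rw [Metric.nhds_basis_ball.notMem_measureSupport]
  refine exists_congr fun r => and_congr_right fun _ => ?_
  rw [withDensity_apply_eq_zero hg.ennreal_ofReal, measure_eq_zero_iff_ae_notMem]
  refine eventually_congr (Eventually.of_forall fun y => ?_)
  simp only [mem_inter_iff, mem_ofPred_eq, Metric.mem_ball, Real.dist_eq, ne_eq,
    ENNReal.ofReal_eq_zero, not_and, not_le]
  constructor
  · intro h hy
    by_contra hne
    exact h (lt_of_le_of_ne (h0 y) (Ne.symm hne)) hy
  · intro h hpos hy
    exact hpos.ne' (h hy)

lemma restrict_withDensity_ofReal {g : ℝ → ℝ} {S : Set ℝ} (hS : MeasurableSet S) :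
    (volume.withDensity fun y => ENNReal.ofReal (g y)).restrict S
      = volume.withDensity fun y => ENNReal.ofReal (S.indicator g y) := by
  rw [restrict_withDensity hS, ← withDensity_indicator hS]
  congr 1
  ext y
  by_cases hy : y ∈ S <;> simp [hy]

lemma notMem_support_restrict_withDensity {g : ℝ → ℝ} (hg : Measurable g) (h0 : ∀ y, 0 ≤ g y)
    {S : Set ℝ} (hS : MeasurableSet S) {t r : ℝ} (hr : 0 < r)
    (h : ∀ᵐ y, |y - t| < r → y ∈ S → g y = 0) :
    t ∉ ((volume.withDensity fun y => ENNReal.ofReal (g y)).restrict S).support := by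
  rw [restrict_withDensity_ofReal hS, notMem_support_withDensity_iff (hg.indicator hS)
    (fun y => indicator_nonneg (fun z _ => h0 z) y)]
  refine ⟨r, hr, ?_⟩
  filter_upwards [h] with y hy hyt
  exact indicator_apply_eq_zero.2 (hy hyt)

lemma subset_compl_support_withDensity_iff {g : ℝ → ℝ} (hg : Measurable g) (h0 : ∀ y, 0 ≤ g y)
    {U : Set ℝ} (hU : IsOpen U) :
    U ⊆ (volume.withDensity fun y => ENNReal.ofReal (g y)).supportᶜ ↔ ∀ᵐ y, y ∈ U → g y = 0 := by
  have key : (volume.withDensity fun y => ENNReal.ofReal (g y)) U = 0 ↔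
      ∀ᵐ y, y ∈ U → g y = 0 := by
    rw [withDensity_apply_eq_zero hg.ennreal_ofReal, measure_eq_zero_iff_ae_notMem]
    refine eventually_congr (Eventually.of_forall fun y => ?_)
    simp only [mem_inter_iff, mem_ofPred_eq, ne_eq, ENNReal.ofReal_eq_zero, not_and, not_le]
    constructor
    · intro h hy
      by_contra hne
      exact h (lt_of_le_of_ne (h0 y) (Ne.symm hne)) hy
    · intro h hpos hy
      exact hpos.ne' (h hy)
  rw [← key]
  exact ⟨fun h => measure_mono_null h Measure.measure_compl_support,
    fun h => Measure.subset_compl_support_of_isOpen hU h⟩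

/-! ### Supports and integrals of μ and λ - μ in terms of the density -/

namespace IsDensity

variable {μ : Measure ℝ} {a b : ℝ} {f : ℝ → ℝ}

lemma integrable_of_bound (hf : IsDensity μ a b f) {g : ℝ → ℝ} (hg : Measurable g)
    (h : ∀ y, |g y| ≤ f y) : Integrable g := by
  have : Integrable f := by
    by_contra hne
    have := hf.integral_one
    rw [integral_undef hne] at this
    exact zero_ne_one this
  exact this.mono' hg.aestronglyMeasurable (Eventually.of_forall h)

lemma integrable (hf : IsDensity μ a b f) : Integrable f :=
  hf.integrable_of_bound hf.meas fun y => (abs_of_nonneg (hf.nonneg y)).le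

lemma measurable_one_sub (hf : IsDensity μ a b f) : Measurable fun y => 1 - f y :=
  measurable_const.sub hf.meas

/-- Subtraction of measures is not linear, so λ is first written as (1-f)λ + μ, and then the finite
measure μ is cancelled. -/
lemma coMeasure_eq [IsProbabilityMeasure μ] (hf : IsDensity μ a b f) :
    coMeasure μ = volume.withDensity fun y => ENNReal.ofReal (1 - f y) := by
  have h1 : (volume : Measure ℝ)
      = (volume.withDensity fun y => ENNReal.ofReal (1 - f y)) + μ := by
    conv_rhs => rw [hf.eq]
    refine Eq.trans ?_ (withDensity_add_left hf.measurable_one_sub.ennreal_ofReal _)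
    conv_lhs => rw [← withDensity_one (μ := (volume : Measure ℝ))]
    congr 1
    ext y
    rw [Pi.add_apply, ← ENNReal.ofReal_add (sub_nonneg.2 (hf.le_one y)) (hf.nonneg y)]
    simp
  rw [coMeasure]
  conv_lhs => rw [h1]
  exact Measure.add_sub_cancel

lemma notMem_support_iff (hf : IsDensity μ a b f) {t : ℝ} :
    t ∉ μ.support ↔ ∃ r > 0, ∀ᵐ y, |y - t| < r → f y = 0 := by
  conv_lhs => rw [hf.eq]
  exact notMem_support_withDensity_iff hf.meas hf.nonneg

lemma notMem_co_support_iff [IsProbabilityMeasure μ] (hf : IsDensity μ a b f) {t : ℝ} :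
    t ∉ (coMeasure μ).support ↔ ∃ r > 0, ∀ᵐ y, |y - t| < r → f y = 1 := by
  rw [hf.coMeasure_eq, notMem_support_withDensity_iff hf.measurable_one_sub
    (fun y => sub_nonneg.2 (hf.le_one y))]
  simp only [sub_eq_zero, eq_comm (a := (1 : ℝ))]

lemma subset_compl_support_iff (hf : IsDensity μ a b f) {U : Set ℝ} (hU : IsOpen U) :
    U ⊆ μ.supportᶜ ↔ ∀ᵐ y, y ∈ U → f y = 0 := by
  conv_lhs => rw [hf.eq]
  exact subset_compl_support_withDensity_iff hf.meas hf.nonneg hU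

lemma subset_compl_co_support_iff [IsProbabilityMeasure μ] (hf : IsDensity μ a b f) {U : Set ℝ}
    (hU : IsOpen U) : U ⊆ (coMeasure μ).supportᶜ ↔ ∀ᵐ y, y ∈ U → f y = 1 := by
  rw [hf.coMeasure_eq, subset_compl_support_withDensity_iff hf.measurable_one_sub
    (fun y => sub_nonneg.2 (hf.le_one y)) hU]
  simp only [sub_eq_zero, eq_comm (a := (1 : ℝ))]

lemma setIntegral_eq {E : Type*} [NormedAddCommGroup E] [NormedSpace ℝ E]
    (hf : IsDensity μ a b f) {S : Set ℝ} (hS : MeasurableSet S) (F : ℝ → E) :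
    ∫ y in S, F y ∂μ = ∫ y, S.indicator f y • F y := by
  rw [hf.eq, setIntegral_withDensity_eq_setIntegral_toReal_smul hf.meas.ennreal_ofReal
    (Eventually.of_forall fun _ => ENNReal.ofReal_lt_top) _ hS, ← integral_indicator hS]
  congr 1
  ext y
  by_cases hy : y ∈ S <;> simp [hy, hf.nonneg y]

lemma setIntegral_co_eq {E : Type*} [NormedAddCommGroup E] [NormedSpace ℝ E]
    [IsProbabilityMeasure μ]
    (hf : IsDensity μ a b f) {S : Set ℝ} (hS : MeasurableSet S) (F : ℝ → E) :
    ∫ y in S, F y ∂(coMeasure μ) = ∫ y, S.indicator (fun z => 1 - f z) y • F y := by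
  rw [hf.coMeasure_eq, setIntegral_withDensity_eq_setIntegral_toReal_smul
    hf.measurable_one_sub.ennreal_ofReal
    (Eventually.of_forall fun _ => ENNReal.ofReal_lt_top) _ hS, ← integral_indicator hS]
  congr 1
  ext y
  by_cases hy : y ∈ S
  · simp only [hy, indicator_of_mem]
    rw [ENNReal.toReal_ofReal (sub_nonneg.2 (hf.le_one y))]
  · simp [hy]

lemma integral_eq {E : Type*} [NormedAddCommGroup E] [NormedSpace ℝ E]
    (hf : IsDensity μ a b f) (F : ℝ → E) : ∫ y, F y ∂μ = ∫ y, f y • F y := by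
  have := hf.setIntegral_eq MeasurableSet.univ F
  simpa using this

end IsDensity

/-! ### Moments `∫ g(y) (w - y)⁻ⁿ dy` -/

section moments

variable {𝕜 : Type*} [RCLike 𝕜]

/-- The function `w ↦ ∫ g(y) (w - y)⁻ⁿ dy`. -/
noncomputable def mom (𝕜 : Type*) [RCLike 𝕜] (g : ℝ → ℝ) (n : ℕ) (w : 𝕜) : 𝕜 :=
  ∫ y : ℝ, (g y : 𝕜) * ((w - (y : 𝕜)) ^ n)⁻¹

lemma le_norm_sub_ofReal {t r y : ℝ} {w : 𝕜} (hy : r ≤ |y - t|) :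
    r - ‖w - (t : 𝕜)‖ ≤ ‖w - (y : 𝕜)‖ := by
  have h1 : |y - t| = ‖((y : 𝕜) - (t : 𝕜))‖ := by
    rw [← RCLike.ofReal_sub, RCLike.norm_ofReal]
  have h2 : ‖((y : 𝕜) - (t : 𝕜))‖ ≤ ‖w - (t : 𝕜)‖ + ‖w - (y : 𝕜)‖ := by
    have : ((y : 𝕜) - (t : 𝕜)) = (w - t) - (w - y) := by ring
    rw [this]; exact norm_sub_le _ _
  linarith

lemma aestronglyMeasurable_kernel {g : ℝ → ℝ} (hg : AEStronglyMeasurable g) (n : ℕ) (w : 𝕜) :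
    AEStronglyMeasurable (fun y : ℝ => (g y : 𝕜) * ((w - (y : 𝕜)) ^ n)⁻¹) := by
  refine (RCLike.continuous_ofReal.comp_aestronglyMeasurable hg).mul ?_
  refine Measurable.aestronglyMeasurable ?_
  exact ((measurable_const.sub RCLike.continuous_ofReal.measurable).pow_const n).inv

lemma norm_kernel_le {g : ℝ → ℝ} {t r y δ : ℝ} (hy : |y - t| < r → g y = 0) {w : 𝕜} (hδ : 0 < δ)
    (hw : ‖w - (t : 𝕜)‖ ≤ r - δ) (n : ℕ) :
    ‖(g y : 𝕜) * ((w - (y : 𝕜)) ^ n)⁻¹‖ ≤ (δ ^ n)⁻¹ * |g y| := by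
  rw [norm_mul, RCLike.norm_ofReal, mul_comm, norm_inv, norm_pow]
  rcases lt_or_ge |y - t| r with h | h
  · rw [hy h]; simp
  · have h1 : δ ≤ ‖w - (y : 𝕜)‖ := by
      have := le_norm_sub_ofReal (w := w) h; linarith
    gcongr

lemma integrable_kernel {g : ℝ → ℝ} (hg : Integrable g) {t r : ℝ}
    (hv : ∀ᵐ y, |y - t| < r → g y = 0) {w : 𝕜} (hw : ‖w - (t : 𝕜)‖ < r) (n : ℕ) :
    Integrable (fun y : ℝ => (g y : 𝕜) * ((w - (y : 𝕜)) ^ n)⁻¹) := by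
  refine (hg.abs.const_mul (((r - ‖w - (t : 𝕜)‖) ^ n)⁻¹)).mono'
    (aestronglyMeasurable_kernel hg.1 n w) ?_
  filter_upwards [hv] with y hy
  exact norm_kernel_le hy (by linarith) (by linarith) n

lemma hasDerivAt_pow_inv (n : ℕ) {w c : 𝕜} (h : w - c ≠ 0) :
    HasDerivAt (fun z : 𝕜 => ((z - c) ^ n)⁻¹) (-(n : 𝕜) * ((w - c) ^ (n + 1))⁻¹) w := by
  have := (((hasDerivAt_id' w).sub_const c).fun_pow n).fun_inv (pow_ne_zero n h)
  refine this.congr_deriv ?_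
  rcases n with _ | n
  · simp
  · rw [Nat.add_sub_cancel]
    field_simp
    ring

lemma hasDerivAt_mom {g : ℝ → ℝ} (hg : Integrable g) {t r : ℝ}
    (hv : ∀ᵐ y, |y - t| < r → g y = 0) {w : 𝕜} (hw : ‖w - (t : 𝕜)‖ < r) (n : ℕ) :
    HasDerivAt (mom 𝕜 g n) (-(n : 𝕜) * mom 𝕜 g (n + 1) w) w := by
  -- Half of the room left: for z within δ of w, every y with |y - t| ≥ r keeps distance at least δ
  -- from z, which gives an integrable bound uniform in z.
  set δ := (r - ‖w - (t : 𝕜)‖) / 2 with hδ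
  have hδ0 : 0 < δ := by rw [hδ]; linarith
  have hball : ∀ z ∈ Metric.ball w δ, ‖z - (t : 𝕜)‖ ≤ r - δ := by
    intro z hz
    have h1 : ‖z - w‖ < δ := by simpa [dist_eq_norm] using hz
    have h2 : ‖z - (t : 𝕜)‖ ≤ ‖z - w‖ + ‖w - (t : 𝕜)‖ := by
      have : z - (t : 𝕜) = (z - w) + (w - t) := by ring
      rw [this]; exact norm_add_le _ _
    rw [hδ] at *; linarith
  have key := hasDerivAt_integral_of_dominated_loc_of_deriv_le (μ := (volume : Measure ℝ))
    (F := fun (z : 𝕜) (y : ℝ) => (g y : 𝕜) * ((z - (y : 𝕜)) ^ n)⁻¹)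
    (F' := fun (z : 𝕜) (y : ℝ) => -(n : 𝕜) * ((g y : 𝕜) * ((z - (y : 𝕜)) ^ (n + 1))⁻¹))
    (bound := fun y => n * ((δ ^ (n + 1))⁻¹ * |g y|))
    (x₀ := w) (Metric.ball_mem_nhds w hδ0)
    (Eventually.of_forall fun z => aestronglyMeasurable_kernel hg.1 n z)
    (integrable_kernel hg hv hw n)
    ((aestronglyMeasurable_kernel hg.1 (n + 1) w).const_mul _) ?_
    ((hg.abs.const_mul _).const_mul _) ?_
  · have h2 := key.2
    rw [integral_const_mul] at h2
    exact h2
  · filter_upwards [hv] with y hy z hz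
    rw [norm_mul, norm_neg, RCLike.norm_natCast]
    exact mul_le_mul_of_nonneg_left (norm_kernel_le hy hδ0 (hball z hz) _) (Nat.cast_nonneg n)
  · filter_upwards [hv] with y hy z hz
    rcases lt_or_ge |y - t| r with h | h
    · simp only [hy h, RCLike.ofReal_zero, zero_mul, mul_zero]
      exact hasDerivAt_const _ _
    · have h1 := le_norm_sub_ofReal (w := z) h
      have h2 := hball z hz
      have h3 : z - (y : 𝕜) ≠ 0 := norm_pos_iff.1 (by linarith)
      have := (hasDerivAt_pow_inv n h3).const_mul (g y : 𝕜)
      exact this.congr_deriv (by ring)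

lemma iteratedDeriv_mom {g : ℝ → ℝ} (hg : Integrable g) {t r : ℝ}
    (hv : ∀ᵐ y, |y - t| < r → g y = 0) (k : ℕ) : ∀ {w : 𝕜}, ‖w - (t : 𝕜)‖ < r →
    iteratedDeriv k (mom 𝕜 g 1) w = (-1) ^ k * (k.factorial : 𝕜) * mom 𝕜 g (k + 1) w := by
  induction k with
  | zero => intro w _; simp
  | succ k ih =>
    intro w hw
    rw [iteratedDeriv_succ]
    have hev : iteratedDeriv k (mom 𝕜 g 1)
        =ᶠ[𝓝 w] fun z => (-1) ^ k * (k.factorial : 𝕜) * mom 𝕜 g (k + 1) z := by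
      have : Metric.ball (t : 𝕜) r ∈ 𝓝 w :=
        Metric.isOpen_ball.mem_nhds (by simpa [dist_eq_norm] using hw)
      filter_upwards [this] with z hz
      exact ih (by simpa [dist_eq_norm] using hz)
    rw [hev.deriv_eq, ((hasDerivAt_mom hg hv hw (k + 1)).const_mul _).deriv, Nat.factorial_succ]
    push_cast
    ring

lemma mom_ofReal (g : ℝ → ℝ) (n : ℕ) (t : ℝ) : mom ℂ g n (t : ℂ) = ((mom ℝ g n t : ℝ) : ℂ) := by
  rw [mom, mom, ← integral_complex_ofReal]
  congr 1
  ext y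
  push_cast
  rfl

lemma analyticAt_mom {g : ℝ → ℝ} (hg : Integrable g) {t r : ℝ} (hr : 0 < r)
    (hv : ∀ᵐ y, |y - t| < r → g y = 0) (n : ℕ) : AnalyticAt ℂ (mom ℂ g n) (t : ℂ) := by
  have : DifferentiableOn ℂ (mom ℂ g n) (Metric.ball (t : ℂ) r) := by
    intro w hw
    have hw' : ‖w - ((t : ℝ) : ℂ)‖ < r := by simpa [dist_eq_norm] using hw
    exact (hasDerivAt_mom (𝕜 := ℂ) hg hv hw' n).differentiableAt.differentiableWithinAt
  exact this.analyticAt (Metric.isOpen_ball.mem_nhds (Metric.mem_ball_self hr))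

lemma analyticAt_mom_real {g : ℝ → ℝ} (hg : Integrable g) {t r : ℝ} (hr : 0 < r)
    (hv : ∀ᵐ y, |y - t| < r → g y = 0) (n : ℕ) : AnalyticAt ℝ (mom ℝ g n) t := by
  have h := (analyticAt_mom hg hr hv n).re_ofReal
  have h2 : (fun x : ℝ => (mom ℂ g n (x : ℂ)).re) = mom ℝ g n := by
    ext x; rw [mom_ofReal, Complex.ofReal_re]
  rwa [h2] at h

end moments

/-! ### Taylor expansions -/

lemma taylor_isBigO {φ : ℝ → ℝ} {t : ℝ} (hφ : AnalyticAt ℝ φ t) (n : ℕ) :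
    (fun s => φ s - ∑ k ∈ Finset.range n, (s - t) ^ k * (iteratedDeriv k φ t / k.factorial))
      =O[𝓝 t] fun s => (s - t) ^ n := by
  have h := hφ.hasFPowerSeriesAt.isBigO_sub_partialSum_pow n
  have ht : Tendsto (fun s : ℝ => s - t) (𝓝 t) (𝓝 0) := by
    have : Tendsto (fun s : ℝ => s - t) (𝓝 t) (𝓝 (t - t)) := tendsto_id.sub_const t
    rwa [sub_self] at this
  have h2 := h.comp_tendsto ht
  refine (h2.congr' ?_ ?_).of_norm_right
  · refine Eventually.of_forall fun s => ?_
    simp [FormalMultilinearSeries.partialSum, smul_eq_mul]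
  · exact Eventually.of_forall fun s => by simp

lemma taylor_two {φ φ₁ : ℝ → ℝ} {t c : ℝ} (hφ : AnalyticAt ℝ φ t) (h0 : φ t = 0)
    (h1 : ∀ᶠ s in 𝓝 t, HasDerivAt φ (φ₁ s) s) (h2 : HasDerivAt φ₁ c t) :
    (fun s => φ s - (φ₁ t * (s - t) + c / 2 * (s - t) ^ 2)) =O[𝓝 t] fun s => (s - t) ^ 3 := by
  have e1 : deriv φ =ᶠ[𝓝 t] φ₁ := h1.mono fun s hs => hs.deriv
  have := taylor_isBigO hφ 3
  simp only [Finset.sum_range_succ, Finset.sum_range_zero, iteratedDeriv_succ, iteratedDeriv_zero,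
    h0, e1.eq_of_nhds, e1.deriv_eq, h2.deriv] at this
  refine this.congr_left fun s => ?_
  norm_num [Nat.factorial]
  ring

lemma taylor_three {φ φ₁ φ₂ : ℝ → ℝ} {t c : ℝ} (hφ : AnalyticAt ℝ φ t) (h0 : φ t = 0)
    (h1 : ∀ᶠ s in 𝓝 t, HasDerivAt φ (φ₁ s) s) (h10 : φ₁ t = 0)
    (h2 : ∀ᶠ s in 𝓝 t, HasDerivAt φ₁ (φ₂ s) s) (h3 : HasDerivAt φ₂ c t) :
    (fun s => φ s - (φ₂ t / 2 * (s - t) ^ 2 + c / 6 * (s - t) ^ 3)) =O[𝓝 t]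
      fun s => (s - t) ^ 4 := by
  have e1 : deriv φ =ᶠ[𝓝 t] φ₁ := h1.mono fun s hs => hs.deriv
  have e2 : deriv (deriv φ) =ᶠ[𝓝 t] φ₂ :=
    e1.deriv.trans (h2.mono fun s hs => hs.deriv)
  have := taylor_isBigO hφ 4
  simp only [Finset.sum_range_succ, Finset.sum_range_zero, iteratedDeriv_succ, iteratedDeriv_zero,
    h0, e1.eq_of_nhds, h10, e2.eq_of_nhds, e2.deriv_eq, h3.deriv] at this
  refine this.congr_left fun s => ?_
  norm_num [Nat.factorial]
  ring

/-! ### The model curve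

Near every parameter the edge curve has the form `(s + M D / W, 1 + M² / W)` with `D s = s - q`,
`M = N - D`, `W = N' D - N D'`, where `N / D` is the function `e^C`. -/

/-- The Wronskian `W = N' D - N D'`, with `D s = s - q`. -/
noncomputable def wron (N : ℝ → ℝ) (q s : ℝ) : ℝ := deriv N s * (s - q) - N s

/-- The curve `(s + M D / W, 1 + M² / W)`. -/
noncomputable def modelCurve (N : ℝ → ℝ) (q s : ℝ) : ℝ × ℝ :=
  (s + (N s - (s - q)) * (s - q) / wron N q s, 1 + (N s - (s - q)) ^ 2 / wron N q s)

/-- The factor `k` in `γ' = k • (D, M)`. -/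
noncomputable def speed (N : ℝ → ℝ) (q s : ℝ) : ℝ :=
  (2 * (deriv N s - 1) * wron N q s - (N s - (s - q)) * (deriv (deriv N) s * (s - q)))
    / wron N q s ^ 2

section model

variable {N : ℝ → ℝ} {q t : ℝ}

lemma hasDerivAt_wron (hN : AnalyticAt ℝ N t) :
    HasDerivAt (wron N q) (deriv (deriv N) t * (t - q)) t := by
  have h1 := hN.deriv.differentiableAt.hasDerivAt
  have h0 := hN.differentiableAt.hasDerivAt
  exact ((h1.mul ((hasDerivAt_id' t).sub_const q)).sub h0).congr_deriv (by ring)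

lemma analyticAt_wron (hN : AnalyticAt ℝ N t) : AnalyticAt ℝ (wron N q) t :=
  (hN.deriv.mul (analyticAt_id.sub analyticAt_const)).sub hN

lemma hasDerivAt_modelCurve_fst (hN : AnalyticAt ℝ N t) (hW : wron N q t ≠ 0) :
    HasDerivAt (fun s => (modelCurve N q s).1) (speed N q t * (t - q)) t := by
  have h0 := hN.differentiableAt.hasDerivAt
  have hD := (hasDerivAt_id' t).sub_const q
  refine ((hasDerivAt_id' t).add
    (((h0.sub hD).mul hD).div (hasDerivAt_wron hN) hW)).congr_deriv ?_
  simp only [Pi.mul_apply, Pi.sub_apply, speed]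
  field_simp
  simp only [wron]
  ring

lemma hasDerivAt_modelCurve_snd (hN : AnalyticAt ℝ N t) (hW : wron N q t ≠ 0) :
    HasDerivAt (fun s => (modelCurve N q s).2) (speed N q t * (N t - (t - q))) t := by
  have h0 := hN.differentiableAt.hasDerivAt
  have hD := (hasDerivAt_id' t).sub_const q
  refine (((((h0.sub hD).pow 2).div (hasDerivAt_wron hN) hW)).const_add 1).congr_deriv ?_
  simp only [Pi.pow_apply, Pi.sub_apply, speed]
  field_simp
  push_cast
  ring

lemma analyticAt_modelCurve_fst (hN : AnalyticAt ℝ N t) (hW : wron N q t ≠ 0) :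
    AnalyticAt ℝ (fun s => (modelCurve N q s).1) t := by
  have hD : AnalyticAt ℝ (fun s : ℝ => s - q) t := analyticAt_id.sub analyticAt_const
  exact analyticAt_id.add (((hN.sub hD).mul hD).div (analyticAt_wron hN) hW)

lemma analyticAt_modelCurve_snd (hN : AnalyticAt ℝ N t) (hW : wron N q t ≠ 0) :
    AnalyticAt ℝ (fun s => (modelCurve N q s).2) t := by
  have hD : AnalyticAt ℝ (fun s : ℝ => s - q) t := analyticAt_id.sub analyticAt_const
  exact analyticAt_const.add (((hN.sub hD).pow 2).div (analyticAt_wron hN) hW)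

lemma contDiffAt_modelCurve (hN : AnalyticAt ℝ N t) (hW : wron N q t ≠ 0) :
    ContDiffAt ℝ ∞ (modelCurve N q) t :=
  (analyticAt_modelCurve_fst hN hW).contDiffAt.prodMk (analyticAt_modelCurve_snd hN hW).contDiffAt

lemma analyticAt_speed (hN : AnalyticAt ℝ N t) (hW : wron N q t ≠ 0) :
    AnalyticAt ℝ (speed N q) t := by
  have hD : AnalyticAt ℝ (fun s : ℝ => s - q) t := analyticAt_id.sub analyticAt_const
  have hw := analyticAt_wron (q := q) hN
  exact (((analyticAt_const.mul (hN.deriv.sub analyticAt_const)).mul hw).sub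
    ((hN.sub hD).mul (hN.deriv.deriv.mul hD))).div (hw.pow 2) (pow_ne_zero 2 hW)

/-- At a zero of a quotient A/W² the quotient rule retains only A'/W². This is the only situation in
which k' is needed. -/
lemma deriv_speed (hN : AnalyticAt ℝ N t) (hW : wron N q t ≠ 0) (hk : speed N q t = 0) :
    deriv (speed N q) t * wron N q t ^ 2 =
      2 * deriv (deriv N) t * wron N q t + (deriv N t - 1) * (deriv (deriv N) t * (t - q))
        - (N t - (t - q)) * (deriv (deriv (deriv N)) t * (t - q) + deriv (deriv N) t) := by
  have h0 := hN.differentiableAt.hasDerivAt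
  have h1 := hN.deriv.differentiableAt.hasDerivAt
  have h2 := hN.deriv.deriv.differentiableAt.hasDerivAt
  have hD := (hasDerivAt_id' t).sub_const q
  have hw := hasDerivAt_wron (q := q) hN
  have key := ((((h1.sub_const 1).const_mul 2).mul hw).sub ((h0.sub hD).mul (h2.mul hD))).div
    (hw.pow 2) (pow_ne_zero 2 hW)
  have hk' : 2 * (deriv N t - 1) * wron N q t - (N t - (t - q)) * (deriv (deriv N) t * (t - q))
      = 0 := by
    rw [speed, div_eq_zero_iff] at hk
    exact hk.resolve_right (pow_ne_zero 2 hW)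
  have key2 := key.deriv
  simp only [Pi.mul_apply, Pi.sub_apply, Pi.pow_apply] at key2
  rw [hk', zero_mul, sub_zero] at key2
  have e : deriv (speed N q) t = _ := key2
  rw [e]
  field_simp
  ring

lemma eventually_analyticAt_and_wron (hN : AnalyticAt ℝ N t) (hW : wron N q t ≠ 0) :
    ∀ᶠ s in 𝓝 t, AnalyticAt ℝ N s ∧ wron N q s ≠ 0 :=
  hN.eventually_analyticAt.and ((analyticAt_wron hN).continuousAt.eventually_ne hW)

/-- From γ' = k(D,M) the terms with k' drop out of γ'×γ'', leaving k²(DM'-MD') = k²W. The speed |γ'|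
is non-zero because D = M = 0 would make W vanish. -/
lemma curvature_neg {γ : ℝ → ℝ × ℝ} (hγ : γ =ᶠ[𝓝 t] modelCurve N q) (hN : AnalyticAt ℝ N t)
    (hW : wron N q t < 0) (hk : speed N q t ≠ 0) : curvature γ t < 0 := by
  have hev := eventually_analyticAt_and_wron hN hW.ne
  have e1 : deriv (fun s => (γ s).1) =ᶠ[𝓝 t] fun s => speed N q s * (s - q) := by
    refine (hγ.fun_comp Prod.fst).deriv.trans (hev.mono fun s hs => ?_)
    exact (hasDerivAt_modelCurve_fst hs.1 hs.2).deriv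
  have e2 : deriv (fun s => (γ s).2) =ᶠ[𝓝 t] fun s => speed N q s * (N s - (s - q)) := by
    refine (hγ.fun_comp Prod.snd).deriv.trans (hev.mono fun s hs => ?_)
    exact (hasDerivAt_modelCurve_snd hs.1 hs.2).deriv
  have hkd := (analyticAt_speed hN hW.ne).differentiableAt.hasDerivAt
  have hD := (hasDerivAt_id' t).sub_const q
  have f1 := (hkd.mul hD).deriv
  have f2 := (hkd.mul (hN.differentiableAt.hasDerivAt.sub hD)).deriv
  have g1 : iteratedDeriv 2 (fun s => (γ s).1) t
      = deriv (speed N q) t * (t - q) + speed N q t * 1 := by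
    rw [iteratedDeriv_succ, iteratedDeriv_one, e1.deriv_eq]; exact f1
  have g2 : iteratedDeriv 2 (fun s => (γ s).2) t
      = deriv (speed N q) t * (N t - (t - q)) + speed N q t * (deriv N t - 1) := by
    rw [iteratedDeriv_succ, iteratedDeriv_one, e2.deriv_eq]; exact f2
  simp only [curvature]
  rw [e1.eq_of_nhds, e2.eq_of_nhds, g1, g2]
  have hnum : speed N q t * (t - q)
        * (deriv (speed N q) t * (N t - (t - q)) + speed N q t * (deriv N t - 1))
      - speed N q t * (N t - (t - q)) * (deriv (speed N q) t * (t - q) + speed N q t * 1)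
      = speed N q t ^ 2 * wron N q t := by
    simp only [wron]; ring
  rw [hnum]
  refine div_neg_of_neg_of_pos (mul_neg_of_pos_of_neg (by positivity) hW) (Real.rpow_pos_of_pos ?_ _)
  have : (speed N q t * (t - q)) ^ 2 + (speed N q t * (N t - (t - q))) ^ 2
      = speed N q t ^ 2 * ((t - q) ^ 2 + (N t - (t - q)) ^ 2) := by ring
  rw [this]
  refine mul_pos (by positivity) ?_
  by_contra hcon
  have hD0 : t - q = 0 := by nlinarith [sq_nonneg (t - q), sq_nonneg (N t - (t - q))]
  have hM0 : N t - (t - q) = 0 := by nlinarith [sq_nonneg (t - q), sq_nonneg (N t - (t - q))]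
  apply hW.ne
  rw [wron, hD0]
  linarith

lemma hasDerivAt_modelCurve {γ : ℝ → ℝ × ℝ} (hγ : γ =ᶠ[𝓝 t] modelCurve N q)
    (hN : AnalyticAt ℝ N t) (hW : wron N q t ≠ 0) {x : ℝ × ℝ} {ρ : ℝ}
    (hx1 : t - q = ρ * x.1) (hx2 : N t - (t - q) = ρ * x.2) :
    HasDerivAt γ ((speed N q t * ρ) • x) t := by
  refine HasDerivAt.congr_of_eventuallyEq ?_ hγ
  refine ((hasDerivAt_modelCurve_fst hN hW).prodMk
    (hasDerivAt_modelCurve_snd hN hW)).congr_deriv ?_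
  ext
  · rw [hx1]; simp; ring
  · simp only [hx2]; simp; ring

/-- The hypotheses say that (D,M) = ρ𝐱 at t and that 𝐲 is 𝐱 turned by a right angle and scaled by σ.
Since γ' = k(D,M), the normal component satisfies β' = kQ, where Q is the normal component of (D,M).
As Q(t) = 0 and Q'(t) = -W/(ρσ|𝐱|²), one gets β'(t) = 0 and β''(t) = kQ', and β'''(t) = 2k'Q' if k =
0. The tangential component has α'(t) = kρ, and α''(t) = k'ρ if k = 0. -/
lemma hasExpansion_modelCurve {γ : ℝ → ℝ × ℝ} (hγ : γ =ᶠ[𝓝 t] modelCurve N q)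
    (hN : AnalyticAt ℝ N t) (hW : wron N q t ≠ 0) {x y : ℝ × ℝ} {ρ σ : ℝ} (hσ : σ ≠ 0)
    (hx1 : t - q = ρ * x.1) (hx2 : N t - (t - q) = ρ * x.2)
    (hy1 : y.1 = σ * x.2) (hy2 : y.2 = -σ * x.1) :
    ∃ a₂ b₂ : ℝ,
      HasExpansion γ t x y (speed N q t * ρ) a₂
        (-(speed N q t * wron N q t) / (2 * (ρ * σ * (x.1 ^ 2 + x.2 ^ 2)))) b₂ ∧
      (speed N q t = 0 → a₂ = deriv (speed N q) t * ρ / 2 ∧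
        b₂ = -(deriv (speed N q) t * wron N q t) / (3 * (ρ * σ * (x.1 ^ 2 + x.2 ^ 2)))) := by
  have hWeq : wron N q t = deriv N t * (ρ * x.1) - (ρ * x.2 + ρ * x.1) := by
    rw [wron, ← hx1, ← hx2]; ring
  have hρ : ρ ≠ 0 := by
    rintro rfl; apply hW; rw [hWeq]; ring
  set r := x.1 ^ 2 + x.2 ^ 2 with hr
  have hr0 : r ≠ 0 := by
    intro h0
    have h1 : x.1 = 0 := by nlinarith [sq_nonneg x.1, sq_nonneg x.2]
    have h2 : x.2 = 0 := by nlinarith [sq_nonneg x.1, sq_nonneg x.2]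
    apply hW; rw [hWeq, h1, h2]; ring
  set k := speed N q with hk
  have hka : AnalyticAt ℝ k t := analyticAt_speed hN hW
  have hev := eventually_analyticAt_and_wron hN hW
  -- the two components
  set α : ℝ → ℝ := fun s => (((modelCurve N q s).1 - (modelCurve N q t).1) * x.1
    + ((modelCurve N q s).2 - (modelCurve N q t).2) * x.2) / r with hα
  set β : ℝ → ℝ := fun s => (((modelCurve N q s).1 - (modelCurve N q t).1) * x.2
    - ((modelCurve N q s).2 - (modelCurve N q t).2) * x.1) / (σ * r) with hβ
  have hαa : AnalyticAt ℝ α t := by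
    have h1 := analyticAt_modelCurve_fst hN hW
    have h2 := analyticAt_modelCurve_snd hN hW
    exact (((h1.sub analyticAt_const).mul analyticAt_const).add
      ((h2.sub analyticAt_const).mul analyticAt_const)).div analyticAt_const hr0
  have hβa : AnalyticAt ℝ β t := by
    have h1 := analyticAt_modelCurve_fst hN hW
    have h2 := analyticAt_modelCurve_snd hN hW
    exact (((h1.sub analyticAt_const).mul analyticAt_const).sub
      ((h2.sub analyticAt_const).mul analyticAt_const)).div analyticAt_const (mul_ne_zero hσ hr0)
  have hα1 : ∀ᶠ s in 𝓝 t,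
      HasDerivAt α (k s * (((s - q) * x.1 + (N s - (s - q)) * x.2) / r)) s := by
    filter_upwards [hev] with s hs
    refine ((((hasDerivAt_modelCurve_fst hs.1 hs.2).sub_const _).mul_const x.1).add
      (((hasDerivAt_modelCurve_snd hs.1 hs.2).sub_const _).mul_const x.2)
      |>.div_const r).congr_deriv ?_
    ring
  have hβ1 : ∀ᶠ s in 𝓝 t,
      HasDerivAt β (k s * (((s - q) * x.2 - (N s - (s - q)) * x.1) / (σ * r))) s := by
    filter_upwards [hev] with s hs
    refine ((((hasDerivAt_modelCurve_fst hs.1 hs.2).sub_const _).mul_const x.2).sub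
      (((hasDerivAt_modelCurve_snd hs.1 hs.2).sub_const _).mul_const x.1)
      |>.div_const (σ * r)).congr_deriv ?_
    ring
  have hkd : ∀ᶠ s in 𝓝 t, HasDerivAt k (deriv k s) s :=
    hka.eventually_analyticAt.mono fun s hs => hs.differentiableAt.hasDerivAt
  have hNd : ∀ᶠ s in 𝓝 t, HasDerivAt N (deriv N s) s :=
    hev.mono fun s hs => hs.1.differentiableAt.hasDerivAt
  have hα2 : HasDerivAt (fun s => k s * (((s - q) * x.1 + (N s - (s - q)) * x.2) / r))
      (deriv k t * ρ + k t * ((x.1 + (deriv N t - 1) * x.2) / r)) t := by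
    have hD := (hasDerivAt_id' t).sub_const q
    refine (hkd.self_of_nhds.mul (((hD.mul_const x.1).add
      ((hNd.self_of_nhds.sub hD).mul_const x.2)).div_const r)).congr_deriv ?_
    simp only [Pi.add_apply, Pi.sub_apply]
    rw [hx2, hx1]
    have : (ρ * x.1 * x.1 + ρ * x.2 * x.2) / r = ρ := by
      rw [div_eq_iff hr0, hr]; ring
    rw [this]; ring
  have hβ2 : ∀ᶠ s in 𝓝 t,
      HasDerivAt (fun s => k s * (((s - q) * x.2 - (N s - (s - q)) * x.1) / (σ * r)))
      (deriv k s * (((s - q) * x.2 - (N s - (s - q)) * x.1) / (σ * r))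
        + k s * ((x.2 - (deriv N s - 1) * x.1) / (σ * r))) s := by
    filter_upwards [hkd, hNd] with s hks hNs
    have hD := (hasDerivAt_id' s).sub_const q
    refine (hks.mul (((hD.mul_const x.2).sub
      ((hNs.sub hD).mul_const x.1)).div_const (σ * r))).congr_deriv ?_
    simp only [Pi.sub_apply]
    ring
  have hQ0 : ((t - q) * x.2 - (N t - (t - q)) * x.1) / (σ * r) = 0 := by
    rw [hx2, hx1]; ring
  have hQ1 : (x.2 - (deriv N t - 1) * x.1) / (σ * r) = -(wron N q t) / (ρ * σ * r) := by
    rw [hWeq]; field_simp; ring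
  have hβ3 : HasDerivAt (fun s =>
      deriv k s * (((s - q) * x.2 - (N s - (s - q)) * x.1) / (σ * r))
        + k s * ((x.2 - (deriv N s - 1) * x.1) / (σ * r)))
      (2 * (deriv k t * (-(wron N q t) / (ρ * σ * r)))
        + k t * (-(deriv (deriv N) t * x.1) / (σ * r))) t := by
    have hD := (hasDerivAt_id' t).sub_const q
    have hk2 := hka.deriv.differentiableAt.hasDerivAt
    have hN2 := hN.deriv.differentiableAt.hasDerivAt
    refine ((hk2.mul (((hD.mul_const x.2).sub
      ((hNd.self_of_nhds.sub hD).mul_const x.1)).div_const (σ * r))).add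
      (hkd.self_of_nhds.mul ((((hN2.sub_const 1).mul_const x.1).const_sub x.2).div_const
        (σ * r)))).congr_deriv ?_
    simp only [Pi.sub_apply]
    rw [hQ0, ← hQ1]
    ring
  refine ⟨(deriv k t * ρ + k t * ((x.1 + (deriv N t - 1) * x.2) / r)) / 2,
    (2 * (deriv k t * (-(wron N q t) / (ρ * σ * r)))
        + k t * (-(deriv (deriv N) t * x.1) / (σ * r))) / 6, ⟨α, β, ?_, ?_, ?_⟩, ?_⟩
  · filter_upwards [hγ] with s hs
    rw [hs, hγ.eq_of_nhds, hα, hβ]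
    ext
    · simp only [Prod.fst_sub, Prod.fst_add, Prod.smul_fst, smul_eq_mul, hy1]
      field_simp
      rw [hr]; ring
    · simp only [Prod.snd_sub, Prod.snd_add, Prod.smul_snd, smul_eq_mul, hy2]
      field_simp
      rw [hr]; ring
  · have := taylor_two hαa (by simp [hα]) hα1 hα2
    refine this.congr_left fun s => ?_
    have e : ((t - q) * x.1 + (N t - (t - q)) * x.2) / r = ρ := by
      rw [hx2, hx1, div_eq_iff hr0, hr]; ring
    rw [e]
  · have := taylor_three hβa (by simp [hβ]) hβ1 (by rw [hQ0, mul_zero]) hβ2 hβ3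
    refine this.congr_left fun s => ?_
    rw [hQ0, hQ1]
    field_simp
    ring
  · intro h0
    rw [h0]
    constructor
    · ring
    · field_simp; ring

end model

/-! ### The speed of the model curve in terms of the derivatives of `f'` -/

lemma eventuallyEq_of_hasDerivAt {F G F₁ G₁ : ℝ → ℝ} {t : ℝ} (h : F =ᶠ[𝓝 t] G)
    (hF : ∀ᶠ s in 𝓝 t, HasDerivAt F (F₁ s) s) (hG : ∀ᶠ s in 𝓝 t, HasDerivAt G (G₁ s) s) :
    F₁ =ᶠ[𝓝 t] G₁ := by
  filter_upwards [h.eventuallyEq_nhds, hF, hG] with s hs hFs hGs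
  exact hFs.unique (hGs.congr_of_eventuallyEq hs)

section jets

variable {N h h₁ h₂ : ℝ → ℝ} {q t χ χ₂ h₃ : ℝ}

/-- The equation `e^h (w - q) (w - χ₂) = N(w) (w - χ)` and its first three derivatives. -/
lemma jets_of_exp_eq (hN : AnalyticAt ℝ N t)
    (H1 : ∀ᶠ s in 𝓝 t, HasDerivAt h (h₁ s) s) (H2 : ∀ᶠ s in 𝓝 t, HasDerivAt h₁ (h₂ s) s)
    (H3 : HasDerivAt h₂ h₃ t)
    (he : ∀ᶠ w in 𝓝 t, Real.exp (h w) * ((w - q) * (w - χ₂)) = N w * (w - χ)) :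
    Real.exp (h t) * ((t - q) * (t - χ₂)) = N t * (t - χ) ∧
    Real.exp (h t) * (h₁ t * ((t - q) * (t - χ₂)) + ((t - q) + (t - χ₂)))
      = deriv N t * (t - χ) + N t ∧
    Real.exp (h t) * (h₁ t ^ 2 * ((t - q) * (t - χ₂)) + 2 * h₁ t * ((t - q) + (t - χ₂))
        + h₂ t * ((t - q) * (t - χ₂)) + 2)
      = deriv (deriv N) t * (t - χ) + 2 * deriv N t ∧
    Real.exp (h t) * (h₁ t * (h₁ t ^ 2 * ((t - q) * (t - χ₂)) + 2 * h₁ t * ((t - q) + (t - χ₂))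
        + h₂ t * ((t - q) * (t - χ₂)) + 2) +
        (2 * h₁ t * h₂ t * ((t - q) * (t - χ₂)) + h₁ t ^ 2 * ((t - q) + (t - χ₂))
          + 3 * h₂ t * ((t - q) + (t - χ₂)) + 4 * h₁ t + h₃ * ((t - q) * (t - χ₂))))
      = deriv (deriv (deriv N)) t * (t - χ) + 3 * deriv (deriv N) t := by
  have hNa := hN.eventually_analyticAt
  have dB : ∀ s : ℝ, HasDerivAt (fun w : ℝ => (w - q) * (w - χ₂)) ((s - q) + (s - χ₂)) s := fun s =>
    (((hasDerivAt_id' s).sub_const q).mul ((hasDerivAt_id' s).sub_const χ₂)).congr_deriv (by ring)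
  have dB1 : ∀ s : ℝ, HasDerivAt (fun w : ℝ => (w - q) + (w - χ₂)) 2 s := fun s =>
    (((hasDerivAt_id' s).sub_const q).add ((hasDerivAt_id' s).sub_const χ₂)).congr_deriv
      (by norm_num)
  have dC : ∀ s : ℝ, HasDerivAt (fun w : ℝ => w - χ) 1 s := fun s => (hasDerivAt_id' s).sub_const χ
  have e1 : (fun s => Real.exp (h s) * (h₁ s * ((s - q) * (s - χ₂)) + ((s - q) + (s - χ₂))))
      =ᶠ[𝓝 t] fun s => deriv N s * (s - χ) + N s := by
    refine eventuallyEq_of_hasDerivAt he ?_ ?_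
    · filter_upwards [H1] with s hs
      exact (hs.exp.mul (dB s)).congr_deriv (by ring)
    · filter_upwards [hNa] with s hs
      exact (hs.differentiableAt.hasDerivAt.mul (dC s)).congr_deriv (by ring)
  have e2 : (fun s => Real.exp (h s) * (h₁ s ^ 2 * ((s - q) * (s - χ₂))
        + 2 * h₁ s * ((s - q) + (s - χ₂)) + h₂ s * ((s - q) * (s - χ₂)) + 2))
      =ᶠ[𝓝 t] fun s => deriv (deriv N) s * (s - χ) + 2 * deriv N s := by
    refine eventuallyEq_of_hasDerivAt e1 ?_ ?_
    · filter_upwards [H1, H2] with s hs hs2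
      refine (hs.exp.mul ((hs2.mul (dB s)).add (dB1 s))).congr_deriv ?_
      simp only [Pi.add_apply, Pi.mul_apply]
      ring
    · filter_upwards [hNa] with s hs
      refine ((hs.deriv.differentiableAt.hasDerivAt.mul (dC s)).add
        hs.differentiableAt.hasDerivAt).congr_deriv (by ring)
  refine ⟨he.self_of_nhds, e1.eq_of_nhds, e2.eq_of_nhds, ?_⟩
  have g1 := H1.self_of_nhds
  have g2 := H2.self_of_nhds
  have f1 := g1.exp.mul (((((g2.pow 2).mul (dB t)).add ((g2.const_mul 2).mul (dB1 t))).add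
    (H3.mul (dB t))).add_const 2)
  have f2 := ((hN.deriv.deriv.differentiableAt.hasDerivAt.mul (dC t)).add
        (hN.deriv.differentiableAt.hasDerivAt.const_mul 2))
  have := f1.unique (f2.congr_of_eventuallyEq e2)
  simp only [Pi.add_apply, Pi.mul_apply, Pi.pow_apply] at this
  push_cast at this
  linear_combination this

/-- Here h plays the role of f'. By the position of χ and χ₂, the products (w-q)(w-χ₂) and N(w)(w-χ)
have the same non-zero value and the same first derivative at t, which forces e^h = 1 and h' = 0.
The second derivative of the identity is then linear in h'' and reproduces the numerator of k; if
h'' = 0, the third one reproduces that of k'. -/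
lemma speed_eq_of_simple (hN : AnalyticAt ℝ N t) (hW : wron N q t ≠ 0)
    (H1 : ∀ᶠ s in 𝓝 t, HasDerivAt h (h₁ s) s) (H2 : ∀ᶠ s in 𝓝 t, HasDerivAt h₁ (h₂ s) s)
    (H3 : HasDerivAt h₂ h₃ t)
    (he : ∀ᶠ w in 𝓝 t, Real.exp (h w) * ((w - q) * (w - χ₂)) = N w * (w - χ))
    (hχ : t - χ = -((N t - (t - q)) * (t - q)) / wron N q t)
    (hχ₂ : t - χ₂ = -((N t - (t - q)) * N t) / wron N q t)
    (hD : t - q ≠ 0) (hNt : N t ≠ 0) (hM : N t - (t - q) ≠ 0) :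
    h t = 0 ∧ h₁ t = 0 ∧
      speed N q t = -((t - q) * (N t - (t - q)) * N t / wron N q t ^ 2) * h₂ t ∧
      (h₂ t = 0 → deriv (speed N q) t
        = -((t - q) * (N t - (t - q)) * N t / wron N q t ^ 2) * h₃) := by
  obtain ⟨d0, d1, d2, d3⟩ := jets_of_exp_eq hN H1 H2 H3 he
  have hB : (t - q) * (t - χ₂) ≠ 0 := by
    rw [hχ₂]
    exact mul_ne_zero hD (div_ne_zero (neg_ne_zero.2 (mul_ne_zero hM hNt)) hW)
  have hAB : N t * (t - χ) = (t - q) * (t - χ₂) := by rw [hχ, hχ₂]; ring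
  have hE : Real.exp (h t) = 1 := by
    rw [hAB] at d0
    exact mul_right_cancel₀ hB (by rw [d0, one_mul])
  rw [hE, one_mul] at d1 d2 d3
  have hAB1 : deriv N t * (t - χ) + N t = (t - q) + (t - χ₂) := by
    rw [hχ, hχ₂]; field_simp; simp only [wron]; ring
  have h10 : h₁ t = 0 := by
    have : h₁ t * ((t - q) * (t - χ₂)) = 0 := by linarith
    exact (mul_eq_zero.1 this).resolve_right hB
  rw [h10] at d2 d3
  have hk : speed N q t = -((t - q) * (N t - (t - q)) * N t / wron N q t ^ 2) * h₂ t := by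
    have d2' : h₂ t * ((t - q) * (t - χ₂)) = deriv (deriv N) t * (t - χ) + 2 * deriv N t - 2 := by
      linear_combination d2
    rw [hχ, hχ₂] at d2'
    rw [speed]
    field_simp at d2' ⊢
    linear_combination -d2'
  refine ⟨by rw [← Real.log_exp (h t), hE, Real.log_one], h10, hk, fun h20 => ?_⟩
  have hds := deriv_speed hN hW (by rw [hk, h20, mul_zero])
  rw [h20] at d2 d3
  have d3' : h₃ * ((t - q) * (t - χ₂)) = deriv (deriv (deriv N)) t * (t - χ)
      + 3 * deriv (deriv N) t := by linear_combination d3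
  rw [hχ, hχ₂] at d3'
  have h4 : deriv (speed N q) t * wron N q t ^ 2
      = -((t - q) * (N t - (t - q)) * N t) * h₃ := by
    rw [hds]
    field_simp at d3'
    have hw : wron N q t = deriv N t * (t - q) - N t := rfl
    linear_combination (-1 : ℝ) * d3' - (deriv (deriv N) t) * hw
  field_simp
  linear_combination h4

/-- Now t-q or t-χ₂ vanishes, so both sides of the identity have a simple zero at t. Each
differentiation therefore reveals one derivative of h less than before: the first gives e^h = 1, the
second gives k through h', and the third gives k' through h'' if h' = 0. -/
lemma speed_eq_of_double (hN : AnalyticAt ℝ N t) (hW : wron N q t ≠ 0)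
    (H1 : ∀ᶠ s in 𝓝 t, HasDerivAt h (h₁ s) s) (H2 : ∀ᶠ s in 𝓝 t, HasDerivAt h₁ (h₂ s) s)
    (H3 : HasDerivAt h₂ h₃ t)
    (he : ∀ᶠ w in 𝓝 t, Real.exp (h w) * ((w - q) * (w - χ₂)) = N w * (w - χ))
    (hχ : t - χ = -((N t - (t - q)) * (t - q)) / wron N q t)
    (hχ₂ : t - χ₂ = -((N t - (t - q)) * N t) / wron N q t)
    (hB : (t - q) * (t - χ₂) = 0) (hB1 : (t - q) + (t - χ₂) ≠ 0) :
    h t = 0 ∧ speed N q t = 2 * ((t - q) + (t - χ₂)) / wron N q t * h₁ t ∧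
      (h₁ t = 0 → deriv (speed N q) t = 3 * ((t - q) + (t - χ₂)) / wron N q t * h₂ t) := by
  obtain ⟨d0, d1, d2, d3⟩ := jets_of_exp_eq hN H1 H2 H3 he
  have hAB1 : deriv N t * (t - χ) + N t = (t - q) + (t - χ₂) := by
    rw [hχ, hχ₂]; field_simp; simp only [wron]; ring
  rw [hB] at d1 d2 d3
  have hE : Real.exp (h t) = 1 := by
    rw [hAB1] at d1
    refine mul_right_cancel₀ hB1 ?_
    linear_combination d1
  rw [hE, one_mul] at d2 d3
  have hk : speed N q t = 2 * ((t - q) + (t - χ₂)) / wron N q t * h₁ t := by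
    have d2' : 2 * h₁ t * ((t - q) + (t - χ₂))
        = deriv (deriv N) t * (t - χ) + 2 * deriv N t - 2 := by linear_combination d2
    have : 2 * ((t - q) + (t - χ₂)) / wron N q t * h₁ t
      = (2 * h₁ t * ((t - q) + (t - χ₂))) / wron N q t := by ring
    rw [this, d2', speed, hχ]
    field_simp
    ring
  refine ⟨by rw [← Real.log_exp (h t), hE, Real.log_one], hk, fun h10 => ?_⟩
  have hds := deriv_speed hN hW (by rw [hk, h10, mul_zero])
  rw [h10] at d3
  have d3' : 3 * h₂ t * ((t - q) + (t - χ₂)) = deriv (deriv (deriv N)) t * (t - χ)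
      + 3 * deriv (deriv N) t := by linear_combination d3
  have h4 : deriv (speed N q) t * wron N q t ^ 2
      = 3 * h₂ t * ((t - q) + (t - χ₂)) * wron N q t := by
    rw [hds, d3', hχ]
    field_simp
    have hw : wron N q t = deriv N t * (t - q) - N t := rfl
    linear_combination -(deriv (deriv N) t) * hw
  field_simp
  refine mul_right_cancel₀ hW ?_
  linear_combination h4

end jets

/-! ### Truncated kernels -/

lemma exists_mem_Ioo_of_ae {P : ℝ → Prop} (h : ∀ᵐ y, P y) {c d : ℝ} (hcd : c < d) :
    ∃ y ∈ Ioo c d, P y := by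
  obtain ⟨y, hy, h1, h2⟩ := (Measure.dense_of_ae h).exists_between hcd
  exact ⟨y, ⟨h1, h2⟩, hy⟩

/-- The kernel `y ↦ 1 / (w - y)`, truncated at distance `ε` from its pole. -/
noncomputable def cut (w ε y : ℝ) : ℝ := if ε ≤ |y - w| then (w - y)⁻¹ else 0

lemma measurable_cut (w ε : ℝ) : Measurable (cut w ε) := by
  refine Measurable.ite ?_ (by fun_prop) measurable_const
  exact measurableSet_le measurable_const (by fun_prop)

lemma abs_cut_le {w ε : ℝ} (hε : 0 < ε) (y : ℝ) : |cut w ε y| ≤ ε⁻¹ := by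
  rw [cut]
  split_ifs with h
  · rw [abs_inv, abs_sub_comm]; gcongr
  · simp [hε.le]

lemma intervalIntegrable_cut {w ε : ℝ} (hε : 0 < ε) (c d : ℝ) :
    IntervalIntegrable (cut w ε) volume c d := by
  refine (intervalIntegrable_const (c := ε⁻¹)).mono_fun
    (measurable_cut w ε).aestronglyMeasurable (Eventually.of_forall fun y => ?_)
  simp only [Real.norm_eq_abs]
  rw [abs_of_pos (inv_pos.2 hε)]
  exact abs_cut_le hε y

lemma integral_cut_of_le {w ε c d : ℝ} (hε : 0 < ε) (h : ∀ y ∈ uIcc c d, ε ≤ |y - w|) :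
    ∫ y in c..d, cut w ε y = Real.log (w - c) - Real.log (w - d) := by
  have h1 : ∫ y in c..d, cut w ε y = ∫ y in c..d, (w - y)⁻¹ :=
    intervalIntegral.integral_congr fun y hy => if_pos (h y hy)
  have hne : ∀ y ∈ uIcc c d, w - y ≠ 0 := fun y hy h0 => by
    have := h y hy
    rw [abs_sub_comm, h0, abs_zero] at this
    linarith
  rw [h1, intervalIntegral.integral_eq_sub_of_hasDerivAt (f := fun y => -Real.log (w - y))]
  · ring
  · intro y hy
    exact (((hasDerivAt_id' y).const_sub w).log (hne y hy)).neg.congr_deriv (by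
      rw [neg_div, neg_neg, one_div])
  · exact (ContinuousOn.inv₀ (by fun_prop) hne).intervalIntegrable

/-- The truncation is symmetric about w, so the boundary terms log ε and log|-ε| cancel and the
value does not depend on ε. Because `Real.log` is log|·|, one formula covers every position of w. -/
lemma integral_cut {w ε c d : ℝ} (hε : 0 < ε) (hcd : c ≤ d) (hc : ε ≤ |c - w|) (hd : ε ≤ |d - w|) :
    ∫ y in c..d, cut w ε y = Real.log (w - c) - Real.log (w - d) := by
  rcases le_total w c with hwc | hwc
  · refine integral_cut_of_le hε fun y hy => ?_
    rw [uIcc_of_le hcd] at hy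
    rw [abs_of_nonneg (by linarith)] at hc
    rw [abs_of_nonneg (by linarith [hy.1])]; linarith [hy.1]
  rcases le_total d w with hwd | hwd
  · refine integral_cut_of_le hε fun y hy => ?_
    rw [uIcc_of_le hcd] at hy
    rw [abs_of_nonpos (by linarith)] at hd
    rw [abs_of_nonpos (by linarith [hy.2])]; linarith [hy.2]
  rw [abs_of_nonpos (by linarith)] at hc
  rw [abs_of_nonneg (by linarith)] at hd
  have hi := fun c d => intervalIntegrable_cut (w := w) hε c d
  rw [← intervalIntegral.integral_add_adjacent_intervals (hi c (w - ε)) (hi (w - ε) d),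
    ← intervalIntegral.integral_add_adjacent_intervals (hi (w - ε) (w + ε)) (hi (w + ε) d)]
  have h1 : ∫ y in c..(w - ε), cut w ε y = Real.log (w - c) - Real.log (w - (w - ε)) := by
    refine integral_cut_of_le hε fun y hy => ?_
    rw [uIcc_of_le (by linarith)] at hy
    rw [abs_of_nonpos (by linarith [hy.2])]; linarith [hy.2]
  have h3 : ∫ y in (w + ε)..d, cut w ε y = Real.log (w - (w + ε)) - Real.log (w - d) := by
    refine integral_cut_of_le hε fun y hy => ?_
    rw [uIcc_of_le (by linarith)] at hy
    rw [abs_of_nonneg (by linarith [hy.1])]; linarith [hy.1]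
  have h2 : ∫ y in (w - ε)..(w + ε), cut w ε y = 0 := by
    rw [intervalIntegral.integral_of_le (by linarith), integral_Ioc_eq_integral_Ioo]
    refine setIntegral_eq_zero_of_forall_eq_zero fun y hy => if_neg ?_
    rw [not_le, abs_lt]
    exact ⟨by linarith [hy.1], by linarith [hy.2]⟩
  rw [h1, h2, h3]
  have e1 : w - (w - ε) = ε := by ring
  have e2 : w - (w + ε) = -ε := by ring
  rw [e1, e2, Real.log_neg_eq_log]
  ring

lemma integral_indicator_mul_cut {w ε c d : ℝ} (hε : 0 < ε) (hcd : c ≤ d) (hc : ε ≤ |c - w|)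
    (hd : ε ≤ |d - w|) :
    Integrable (fun y => (Icc c d).indicator 1 y * cut w ε y) ∧
    ∫ y, (Icc c d).indicator 1 y * cut w ε y = Real.log (w - c) - Real.log (w - d) := by
  have e : (fun y => (Icc c d).indicator 1 y * cut w ε y) = (Icc c d).indicator (cut w ε) := by
    ext y
    by_cases hy : y ∈ Icc c d <;> simp [hy]
  rw [e, integrable_indicator_iff measurableSet_Icc, integral_indicator measurableSet_Icc,
    integral_Icc_eq_integral_Ioc, ← intervalIntegral.integral_of_le hcd, integral_cut hε hcd hc hd]
  refine ⟨?_, rfl⟩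
  rw [integrableOn_Icc_iff_integrableOn_Ioc, ← intervalIntegrable_iff_integrableOn_Ioc_of_le hcd]
  exact intervalIntegrable_cut hε c d

/-! ### Densities that agree with an indicator function near a point -/

/-- The function `f - 1_{[p,q]}`. -/
noncomputable def res (f : ℝ → ℝ) (p q y : ℝ) : ℝ := f y - (Icc p q).indicator 1 y

/-- Almost everywhere near `t`, the function `f` is the indicator function of `[p,q]`. -/
def AgreesNear (f : ℝ → ℝ) (p q t : ℝ) : Prop :=
  ∃ r > 0, ∀ᵐ y, |y - t| < r → res f p q y = 0

lemma res_of_mem {f : ℝ → ℝ} {p q y : ℝ} (h : y ∈ Icc p q) : res f p q y = f y - 1 := by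
  rw [res, indicator_of_mem h, Pi.one_apply]

lemma res_of_notMem {f : ℝ → ℝ} {p q y : ℝ} (h : y ∉ Icc p q) : res f p q y = f y := by
  rw [res, indicator_of_notMem h, sub_zero]

lemma AgreesNear.eventually {f : ℝ → ℝ} {p q t : ℝ} (h : AgreesNear f p q t) :
    ∀ᶠ s in 𝓝 t, AgreesNear f p q s := by
  obtain ⟨r, hr, h⟩ := h
  filter_upwards [Metric.ball_mem_nhds t (half_pos hr)] with s hs
  rw [Metric.mem_ball, Real.dist_eq] at hs
  refine ⟨r / 2, half_pos hr, h.mono fun y hy hys => hy ?_⟩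
  have : y - t = (y - s) + (s - t) := by ring
  rw [this]
  linarith [abs_add_le (y - s) (s - t)]

section

variable {f : ℝ → ℝ} {p q p' q' w : ℝ}

lemma integrable_res (hf : Integrable f) (p q : ℝ) : Integrable (res f p q) :=
  hf.sub ((integrable_indicator_iff measurableSet_Icc).2
    (integrableOn_const (by simp) (by simp)))

/-- The left side does not involve [p,q], which makes two representations of f comparable. The part
`res f p q` vanishes where the kernel is truncated, and the indicator part is integrated exactly. -/
lemma integral_mul_cut_eq (hf : Integrable f) (hpq : p ≤ q) {r ε : ℝ} (hr : ∀ᵐ y, |y - w| < r → res f p q y = 0)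
    (hε : 0 < ε) (hεr : ε ≤ r) (hp : ε ≤ |p - w|) (hq : ε ≤ |q - w|) :
    ∫ y, f y * cut w ε y
      = mom ℝ (res f p q) 1 w + (Real.log (w - p) - Real.log (w - q)) := by
  obtain ⟨h1, h2⟩ := integral_indicator_mul_cut hε hpq hp hq
  have h3 : Integrable fun y => res f p q y * ((w - y) ^ 1)⁻¹ :=
    integrable_kernel (𝕜 := ℝ) (t := w) (integrable_res hf p q) hr
      (by simpa using hε.trans_le hεr) 1
  rw [← h2, mom]
  refine Eq.trans ?_ (integral_add h3 h1)
  refine integral_congr_ae ?_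
  filter_upwards [hr] with y hy
  rcases lt_or_ge |y - w| ε with h | h
  · have h0 := hy (h.trans_le hεr)
    simp only [cut, if_neg (not_le.2 h), mul_zero, add_zero, h0]
    simp
  · simp only [cut, if_pos h, res]
    simp
    ring

/-- At almost every y slightly to the right of w both representations must assign the same value, 0
or 1, to f(y); and such a y lies in [p,q] exactly when w lies in (p,q). -/
lemma mem_Ioo_iff_of_agreesNear (h : AgreesNear f p q w) (h' : AgreesNear f p' q' w) (hp : w ≠ p)
    (hq : w ≠ q) (hp' : w ≠ p') (hq' : w ≠ q') : w ∈ Ioo p q ↔ w ∈ Ioo p' q' := by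
  obtain ⟨r, hr, h⟩ := h
  obtain ⟨r', hr', h'⟩ := h'
  obtain ⟨ε, hε, hεs⟩ : ∃ ε > 0, ε ≤ r ∧ ε ≤ r' ∧ ε ≤ |p - w| ∧ ε ≤ |q - w| ∧ ε ≤ |p' - w|
      ∧ ε ≤ |q' - w| := by
    refine ⟨min r (min r' (min |p - w| (min |q - w| (min |p' - w| |q' - w|)))), ?_, ?_⟩
    · simp [hr, hr', sub_eq_zero, hp.symm, hq.symm, hp'.symm, hq'.symm]
    · simp
  obtain ⟨h1, h2, h3, h4, h5, h6⟩ := hεs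
  obtain ⟨y, hy, hy1, hy2⟩ := exists_mem_Ioo_of_ae (h.and h') (show w < w + ε by linarith)
  have hyw : |y - w| < ε := by rw [abs_lt]; constructor <;> linarith [hy.1, hy.2]
  have e := (hy1 (hyw.trans_le h1)).trans (hy2 (hyw.trans_le h2)).symm
  have key : ∀ {p q : ℝ}, ε ≤ |p - w| → ε ≤ |q - w| → (w ∈ Ioo p q ↔ y ∈ Icc p q) := by
    intro p q hp hq
    rw [mem_Ioo, mem_Icc]
    refine and_congr ⟨fun h => by linarith [hy.1], fun h => ?_⟩
      ⟨fun h => ?_, fun h => by linarith [hy.1]⟩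
    · by_contra hcon
      rw [abs_of_nonneg (by linarith)] at hp
      linarith [hy.2]
    · rw [abs_of_nonneg (by linarith)] at hq
      linarith [hy.2]
  rw [key h3 h4, key h5 h6]
  by_cases c1 : y ∈ Icc p q <;> by_cases c2 : y ∈ Icc p' q'
  · exact iff_of_true c1 c2
  · rw [res_of_mem c1, res_of_notMem c2] at e; linarith
  · rw [res_of_notMem c1, res_of_mem c2] at e; linarith
  · exact iff_of_false c1 c2

/-- The value of `e^C` does not depend on the representation of `f` near the point. -/
lemma exp_mom_mul_eq (hf : Integrable f) (hpq : p ≤ q) (hpq' : p' ≤ q') (h : AgreesNear f p q w)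
    (h' : AgreesNear f p' q' w) (hp : w ≠ p) (hq : w ≠ q) (hp' : w ≠ p') (hq' : w ≠ q') :
    Real.exp (mom ℝ (res f p q) 1 w) * (w - p) * (w - q')
      = Real.exp (mom ℝ (res f p' q') 1 w) * (w - p') * (w - q) := by
  have hmem := mem_Ioo_iff_of_agreesNear h h' hp hq hp' hq'
  obtain ⟨r, hr, h⟩ := h
  obtain ⟨r', hr', h'⟩ := h'
  obtain ⟨ε, hε, hεs⟩ : ∃ ε > 0, ε ≤ r ∧ ε ≤ r' ∧ ε ≤ |p - w| ∧ ε ≤ |q - w| ∧ ε ≤ |p' - w|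
      ∧ ε ≤ |q' - w| := by
    refine ⟨min r (min r' (min |p - w| (min |q - w| (min |p' - w| |q' - w|)))), ?_, ?_⟩
    · simp [hr, hr', sub_eq_zero, hp.symm, hq.symm, hp'.symm, hq'.symm]
    · simp
  obtain ⟨h1, h2, h3, h4, h5, h6⟩ := hεs
  have e1 := integral_mul_cut_eq hf hpq h hε h1 h3 h4
  rw [integral_mul_cut_eq hf hpq' h' hε h2 h5 h6] at e1
  have e2 : mom ℝ (res f p q) 1 w + Real.log (w - p) + Real.log (w - q')
      = mom ℝ (res f p' q') 1 w + Real.log (w - p') + Real.log (w - q) := by linarith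
  have e3 := congrArg Real.exp e2
  rw [Real.exp_add, Real.exp_add, Real.exp_add, Real.exp_add, Real.exp_log_eq_abs (sub_ne_zero.2 hp),
    Real.exp_log_eq_abs (sub_ne_zero.2 hq'), Real.exp_log_eq_abs (sub_ne_zero.2 hp'),
    Real.exp_log_eq_abs (sub_ne_zero.2 hq)] at e3
  rw [mul_assoc, mul_assoc] at e3 ⊢
  -- So far the identity holds with absolute values. The signs match because w lies in both open
  -- intervals or in neither.
  by_cases hw : w ∈ Ioo p q
  · have hw' := hmem.1 hw
    have a1 := hw.1; have a2 := hw.2; have a3 := hw'.1; have a4 := hw'.2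
    rw [abs_of_pos (by linarith), abs_of_neg (by linarith), abs_of_pos (by linarith),
      abs_of_neg (by linarith)] at e3
    linarith
  · have hw' := fun h => hw (hmem.2 h)
    have key : ∀ {p q : ℝ}, p ≤ q → w ≠ p → w ≠ q → w ∉ Ioo p q →
        (w < p ∧ w < q) ∨ (p < w ∧ q < w) := by
      intro p q hpq hp hq hw
      rcases lt_or_gt_of_ne hp with h | h
      · exact Or.inl ⟨h, h.trans_le hpq⟩
      · rcases lt_or_gt_of_ne hq with h2 | h2
        · exact absurd ⟨h, h2⟩ hw
        · exact Or.inr ⟨h, h2⟩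
    rcases key hpq hp hq hw with ⟨a1, a2⟩ | ⟨a1, a2⟩ <;>
    rcases key hpq' hp' hq' hw' with ⟨a3, a4⟩ | ⟨a3, a4⟩
    · rw [abs_of_neg (by linarith), abs_of_neg (by linarith), abs_of_neg (by linarith),
        abs_of_neg (by linarith)] at e3
      linarith
    · rw [abs_of_neg (by linarith), abs_of_pos (by linarith), abs_of_pos (by linarith),
        abs_of_neg (by linarith)] at e3
      linarith
    · rw [abs_of_pos (by linarith), abs_of_neg (by linarith), abs_of_neg (by linarith),
        abs_of_pos (by linarith)] at e3
      linarith
    · rw [abs_of_pos (by linarith), abs_of_pos (by linarith), abs_of_pos (by linarith),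
        abs_of_pos (by linarith)] at e3
      linarith

end

/-! ### Models of `e^C` near a parameter -/

/-- On the interval `I = (I.1,I.2)` the density is almost everywhere the indicator function of
`[p,q] ⊆ [I.1,I.2]`. -/
structure GapModel (f : ℝ → ℝ) (I : ℝ × ℝ) (p q : ℝ) : Prop where
  left_le : I.1 ≤ p
  le : p ≤ q
  le_right : q ≤ I.2
  ae_eq : ∀ᵐ y, y ∈ Ioo I.1 I.2 → res f p q y = 0

/-- The numerator `N` in the representation `e^C = N / D`, `D s = s - q`. -/
noncomputable def modelN (f : ℝ → ℝ) (p q s : ℝ) : ℝ :=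
  Real.exp (mom ℝ (res f p q) 1 s) * (s - p)

lemma ae_ne (c : ℝ) : ∀ᵐ y : ℝ, y ≠ c := compl_mem_ae_iff.2 (measure_singleton c)

lemma modelN_ne_zero {f : ℝ → ℝ} {p q s : ℝ} (h : s ≠ p) : modelN f p q s ≠ 0 :=
  mul_ne_zero (Real.exp_ne_zero _) (sub_ne_zero.2 h)

lemma GapModel.agreesNear {f : ℝ → ℝ} {I : ℝ × ℝ} {p q s : ℝ} (h : GapModel f I p q)
    (hs : s ∈ Ioo I.1 I.2) : AgreesNear f p q s := by
  obtain ⟨r, hr, hrs⟩ := Metric.isOpen_iff.1 isOpen_Ioo s hs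
  refine ⟨r, hr, h.ae_eq.mono fun y hy hys => hy (hrs ?_)⟩
  rwa [Metric.mem_ball, Real.dist_eq]

lemma AgreesNear.hasDerivAt_mom {f : ℝ → ℝ} (hf : Integrable f) {p q s : ℝ}
    (h : AgreesNear f p q s) (n : ℕ) :
    HasDerivAt (mom ℝ (res f p q) n) (-(n : ℝ) * mom ℝ (res f p q) (n + 1) s) s := by
  obtain ⟨r, hr, h⟩ := h
  exact GTEdge.hasDerivAt_mom (𝕜 := ℝ) (t := s) (integrable_res hf p q) h (by simpa using hr) n

lemma AgreesNear.hasDerivAt_modelN {f : ℝ → ℝ} (hf : Integrable f) {p q s : ℝ}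
    (h : AgreesNear f p q s) :
    HasDerivAt (modelN f p q)
      (Real.exp (mom ℝ (res f p q) 1 s) * (1 - mom ℝ (res f p q) 2 s * (s - p))) s := by
  refine ((h.hasDerivAt_mom hf 1).exp.mul ((hasDerivAt_id' s).sub_const p)).congr_deriv ?_
  push_cast
  ring

lemma AgreesNear.analyticAt_modelN {f : ℝ → ℝ} (hf : Integrable f) {p q s : ℝ}
    (h : AgreesNear f p q s) : AnalyticAt ℝ (modelN f p q) s := by
  obtain ⟨r, hr, h⟩ := h
  exact (analyticAt_mom_real (integrable_res hf p q) hr h 1).rexp.mul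
    (analyticAt_id.sub analyticAt_const)

lemma AgreesNear.wron_modelN {f : ℝ → ℝ} (hf : Integrable f) {p q s : ℝ}
    (h : AgreesNear f p q s) :
    wron (modelN f p q) q s = -(Real.exp (mom ℝ (res f p q) 1 s)
      * (mom ℝ (res f p q) 2 s * ((s - p) * (s - q)) + (q - p))) := by
  rw [wron, (h.hasDerivAt_modelN hf).deriv, modelN]
  ring

/-- Near `t`, including `t` itself, two models give the same `e^C`. -/
lemma eventually_modelN_mul_eq {f : ℝ → ℝ} (hf : Integrable f) {p q p' q' t : ℝ} (hpq : p ≤ q)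
    (hpq' : p' ≤ q') (h : AgreesNear f p q t) (h' : AgreesNear f p' q' t)
    (hp : t = p → t = p') (hq : t = q → t = q') (hp' : t = p' → t = p) (hq' : t = q' → t = q)
    : ∀ᶠ s in 𝓝 t, modelN f p q s * (s - q') = modelN f p' q' s * (s - q) := by
  -- An end-point other than t is not met close to t, so s = c forces t = c; the hypotheses then
  -- make both sides vanish there.
  have ev : ∀ c : ℝ, ∀ᶠ s in 𝓝 t, s = c → t = c := fun c => by
    by_cases htc : t = c
    · exact Eventually.of_forall fun _ _ => htc
    · filter_upwards [eventually_ne_nhds htc] with s hs h using absurd h hs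
  filter_upwards [h.eventually, h'.eventually, ev p, ev q, ev p', ev q'] with s h1 h2 e1 e2 e3 e4
  simp only [modelN]
  by_cases c1 : s = p
  · rw [c1, sub_self, show p - p' = 0 by rw [← hp (e1 c1), e1 c1, sub_self]]; ring
  by_cases c2 : s = q
  · rw [c2, sub_self, show q - q' = 0 by rw [← hq (e2 c2), e2 c2, sub_self]]; ring
  by_cases c3 : s = p'
  · exact absurd (c3.trans ((e3 c3).symm.trans (hp' (e3 c3)))) c1
  by_cases c4 : s = q'
  · exact absurd (c4.trans ((e4 c4).symm.trans (hq' (e4 c4)))) c2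
  exact exp_mom_mul_eq hf hpq hpq' h1 h2 c1 c2 c3 c4

/-- The logarithmic derivative of `e^C` does not depend on the model. -/
lemma logDeriv_modelN_eq {f : ℝ → ℝ} (hf : Integrable f) {p q p' q' t : ℝ} (hpq : p ≤ q)
    (hpq' : p' ≤ q') (h : AgreesNear f p q t) (h' : AgreesNear f p' q' t)
    (hp : t ≠ p) (hq : t ≠ q) (hp' : t ≠ p') (hq' : t ≠ q') :
    deriv (modelN f p q) t / modelN f p q t - 1 / (t - q)
      = deriv (mom ℝ (res f p' q') 1) t - 1 / (t - q') + 1 / (t - p') := by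
  have ev := eventually_modelN_mul_eq hf hpq hpq' h h' (absurd · hp) (absurd · hq) (absurd · hp')
    (absurd · hq')
  have d1 := (h.hasDerivAt_modelN hf).differentiableAt.hasDerivAt.mul
    ((hasDerivAt_id' t).sub_const q')
  have d2 := (h'.hasDerivAt_modelN hf).mul ((hasDerivAt_id' t).sub_const q)
  have e1 := d1.unique (d2.congr_of_eventuallyEq ev)
  have e0 := ev.self_of_nhds
  have n1 := modelN_ne_zero (f := f) (q := q) hp
  have s1 := sub_ne_zero.2 hp'
  have s2 := sub_ne_zero.2 hq'
  have s3 := sub_ne_zero.2 hq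
  have hm := (h'.hasDerivAt_mom hf 1).deriv
  rw [hm]
  simp only [modelN] at e0 e1 n1 ⊢
  have hE := Real.exp_ne_zero (mom ℝ (res f p' q') 1 t)
  set N := Real.exp (mom ℝ (res f p q) 1 t) * (t - p)
  set E := Real.exp (mom ℝ (res f p' q') 1 t)
  have hN : N = E * (t - p') * (t - q) / (t - q') := by rw [eq_div_iff s2]; exact e0
  have hdN : deriv (modelN f p q) t
      = (E * (1 - mom ℝ (res f p' q') 2 t * (t - p')) * (t - q) + E * (t - p') - N) / (t - q') := by
    rw [eq_div_iff s2]; linear_combination e1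
  rw [hdN, hN]
  field_simp
  push_cast
  ring

/-! ### `C_I` as a moment, and gap models for the parameter classes -/

section

variable {μ : Measure ℝ} {a b : ℝ} {f : ℝ → ℝ}

lemma res_self_ae (f : ℝ → ℝ) (c : ℝ) : res f c c =ᵐ[volume] f := by
  filter_upwards [ae_ne c] with y hy
  rw [res_of_notMem]
  rw [Icc_self]; exact hy

lemma mom_congr_ae {𝕜 : Type*} [RCLike 𝕜] {g g' : ℝ → ℝ} (h : g =ᵐ[volume] g') (n : ℕ) :
    mom 𝕜 g n = mom 𝕜 g' n := by
  ext w
  refine integral_congr_ae ?_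
  filter_upwards [h] with y hy
  rw [hy]

/-- Up to the null set {p,q}, the interval [p,q] stays inside I, where f is exactly its indicator.
Subtracting that indicator therefore amounts to deleting f on I, which turns C_I into the first
moment of `res f p q`. -/
lemma GapModel.res_eq_indicator {I : ℝ × ℝ} {p q : ℝ} (h : GapModel f I p q) :
    res f p q =ᵐ[volume] (Ioo I.1 I.2)ᶜ.indicator f := by
  filter_upwards [h.ae_eq, ae_ne p, ae_ne q] with y hy hp hq
  by_cases hyI : y ∈ Ioo I.1 I.2
  · rw [hy hyI, indicator_of_notMem (not_not_intro hyI)]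
  · rw [indicator_of_mem (mem_compl hyI), res_of_notMem]
    intro hmem
    exact hyI ⟨h.left_le.trans_lt (lt_of_le_of_ne hmem.1 hp.symm),
      (lt_of_le_of_ne hmem.2 hq).trans_le h.le_right⟩

lemma IsDensity.cauchyOff_eq (hf : IsDensity μ a b f) {I : ℝ × ℝ} {p q : ℝ}
    (h : GapModel f I p q) : cauchyOff μ a b I = mom ℝ (res f p q) 1 := by
  ext s
  rw [cauchyOff, hf.setIntegral_eq (measurableSet_Icc.diff measurableSet_Ioo), mom]
  refine integral_congr_ae ?_
  filter_upwards [h.res_eq_indicator] with y hy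
  have : (Icc a b \ Ioo I.1 I.2).indicator f y = res f p q y := by
    rw [hy]
    by_cases hyI : y ∈ Ioo I.1 I.2
    · rw [indicator_of_notMem (fun h => h.2 hyI), indicator_of_notMem (not_not_intro hyI)]
    · rw [indicator_of_mem (mem_compl hyI)]
      by_cases hab : y ∈ Icc a b
      · exact indicator_of_mem (show y ∈ Icc a b \ Ioo I.1 I.2 from ⟨hab, hyI⟩) f
      · rw [indicator_of_notMem (fun h => hab h.1), hf.zero_off y hab]
  simp [this]

lemma IsDensity.cauchy_eq (hf : IsDensity μ a b f) (c : ℝ) :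
    cauchy μ = mom ℝ (res f c c) 1 := by
  ext s
  rw [mom_congr_ae (res_self_ae f c), cauchy, hf.integral_eq, mom]
  simp

/-- The interval [p,q] degenerates to one point c ≠ t. It only serves to write e^C as N/D with the
artificial common factor s - c, so that this class fits the general model. -/
lemma IsDensity.exists_gapModel_of_notMem (hf : IsDensity μ a b f) {t : ℝ} (ht : t ∉ μ.support) :
    ∃ r > 0, GapModel f (t - r, t + r) (t + r) (t + r) := by
  obtain ⟨r, hr, h⟩ := hf.notMem_support_iff.1 ht
  refine ⟨r, hr, by linarith, le_rfl, le_rfl, ?_⟩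
  filter_upwards [h, res_self_ae f (t + r)] with y hy hy2 hyI
  rw [hy2, hy]
  rw [abs_lt]; constructor <;> linarith [hyI.1, hyI.2]

lemma IsDensity.gapModel_of_isCoGap [IsProbabilityMeasure μ] (hf : IsDensity μ a b f) {t : ℝ} {I : ℝ × ℝ}
    (h : IsCoGap μ t I) : GapModel f I I.1 I.2 := by
  refine ⟨le_rfl, (h.1.1.trans h.1.2).le, le_rfl, ?_⟩
  filter_upwards [(hf.subset_compl_co_support_iff isOpen_Ioo).1 h.2] with y hy hyI
  rw [res_of_mem (Ioo_subset_Icc_self hyI), hy hyI, sub_self]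

lemma IsDensity.gapModel_of_isGapOne [IsProbabilityMeasure μ] (hf : IsDensity μ a b f) {t : ℝ} {I : ℝ × ℝ}
    (h : IsGapOne μ t I) : GapModel f I I.1 t := by
  refine ⟨le_rfl, h.1.1.le, h.1.2.le, ?_⟩
  filter_upwards [(hf.subset_compl_co_support_iff isOpen_Ioo).1 h.2.2,
    (hf.subset_compl_support_iff isOpen_Ioo).1 h.2.1, ae_ne t] with y hy hy' hyt hyI
  rcases lt_or_gt_of_ne hyt with h1 | h1
  · rw [res_of_mem ⟨hyI.1.le, h1.le⟩, hy ⟨hyI.1, h1⟩, sub_self]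
  · rw [res_of_notMem (fun h => not_lt.2 h.2 h1), hy' ⟨h1, hyI.2⟩]

lemma IsDensity.gapModel_of_isGapTwo [IsProbabilityMeasure μ] (hf : IsDensity μ a b f) {t : ℝ} {I : ℝ × ℝ}
    (h : IsGapTwo μ t I) : GapModel f I t I.2 := by
  refine ⟨h.1.1.le, h.1.2.le, le_rfl, ?_⟩
  filter_upwards [(hf.subset_compl_co_support_iff isOpen_Ioo).1 h.2.1,
    (hf.subset_compl_support_iff isOpen_Ioo).1 h.2.2, ae_ne t] with y hy hy' hyt hyI
  rcases lt_or_gt_of_ne hyt with h1 | h1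
  · rw [res_of_notMem (fun h => not_lt.2 h.1 h1), hy' ⟨hyI.1, h1⟩]
  · rw [res_of_mem ⟨h1.le, hyI.2.le⟩, hy ⟨h1, hyI.2⟩, sub_self]

lemma IsDensity.exists_isCoGap [IsProbabilityMeasure μ] (hf : IsDensity μ a b f) {t : ℝ} (ht : t ∉ (coMeasure μ).support) :
    ∃ I, IsCoGap μ t I := by
  obtain ⟨r, hr, h⟩ := hf.notMem_co_support_iff.1 ht
  refine ⟨(t - r, t + r), ⟨by simpa using hr, by simpa using hr⟩, ?_⟩
  rw [hf.subset_compl_co_support_iff isOpen_Ioo]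
  filter_upwards [h] with y hy hyI
  refine hy ?_
  rw [abs_lt]; constructor <;> linarith [hyI.1, hyI.2]

/-! ### The parameter classes are disjoint -/

lemma IsDensity.ae_eq_of_notMem (hf : IsDensity μ a b f) {t : ℝ} (ht : t ∉ μ.support) :
    ∃ r > 0, ∀ᵐ y, y ∈ Ioo (t - r) (t + r) → f y = 0 := by
  obtain ⟨r, hr, h⟩ := hf.notMem_support_iff.1 ht
  refine ⟨r, hr, h.mono fun y hy hyI => hy ?_⟩
  rw [abs_lt]; constructor <;> linarith [hyI.1, hyI.2]

lemma IsDensity.ae_eq_of_notMem_co [IsProbabilityMeasure μ] (hf : IsDensity μ a b f) {t : ℝ}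
    (ht : t ∉ (coMeasure μ).support) :
    ∃ r > 0, ∀ᵐ y, y ∈ Ioo (t - r) (t + r) → f y = 1 := by
  obtain ⟨r, hr, h⟩ := hf.notMem_co_support_iff.1 ht
  refine ⟨r, hr, h.mono fun y hy hyI => hy ?_⟩
  rw [abs_lt]; constructor <;> linarith [hyI.1, hyI.2]

lemma false_of_ae_eq {c d c' d' : ℝ} (h0 : ∀ᵐ y, y ∈ Ioo c d → f y = 0)
    (h1 : ∀ᵐ y, y ∈ Ioo c' d' → f y = 1) (h : max c c' < min d d') : False := by
  obtain ⟨y, hy, e0, e1⟩ := exists_mem_Ioo_of_ae (h0.and h1) h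
  have h2 := e0 ⟨(le_max_left _ _).trans_lt hy.1, hy.2.trans_le (min_le_left _ _)⟩
  have h3 := e1 ⟨(le_max_right _ _).trans_lt hy.1, hy.2.trans_le (min_le_right _ _)⟩
  linarith

lemma IsDensity.mem_support_of_notMem_co [IsProbabilityMeasure μ] (hf : IsDensity μ a b f) {t : ℝ}
    (ht : t ∉ (coMeasure μ).support) : t ∈ μ.support := by
  by_contra hcon
  obtain ⟨r, hr, h⟩ := hf.ae_eq_of_notMem hcon
  obtain ⟨r', hr', h'⟩ := hf.ae_eq_of_notMem_co ht
  exact false_of_ae_eq h h' (by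
      rw [max_lt_iff, lt_min_iff, lt_min_iff]; constructor <;> constructor <;> linarith)

lemma IsDensity.mem_support_of_isGapOne [IsProbabilityMeasure μ] (hf : IsDensity μ a b f) {t : ℝ} {I : ℝ × ℝ}
    (h : IsGapOne μ t I) : t ∈ μ.support ∧ t ∈ (coMeasure μ).support := by
  have h1 := (hf.subset_compl_co_support_iff isOpen_Ioo).1 h.2.2
  have h0 := (hf.subset_compl_support_iff isOpen_Ioo).1 h.2.1
  have a1 := h.1.1
  have a2 := h.1.2
  constructor <;> by_contra hcon
  · obtain ⟨r, hr, h⟩ := hf.ae_eq_of_notMem hcon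
    exact false_of_ae_eq h h1 (by
      rw [max_lt_iff, lt_min_iff, lt_min_iff]; constructor <;> constructor <;> linarith)
  · obtain ⟨r, hr, h⟩ := hf.ae_eq_of_notMem_co hcon
    exact false_of_ae_eq h0 h (by
      rw [max_lt_iff, lt_min_iff, lt_min_iff]; constructor <;> constructor <;> linarith)

lemma IsDensity.mem_support_of_isGapTwo [IsProbabilityMeasure μ] (hf : IsDensity μ a b f) {t : ℝ} {I : ℝ × ℝ}
    (h : IsGapTwo μ t I) : t ∈ μ.support ∧ t ∈ (coMeasure μ).support := by
  have h1 := (hf.subset_compl_co_support_iff isOpen_Ioo).1 h.2.1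
  have h0 := (hf.subset_compl_support_iff isOpen_Ioo).1 h.2.2
  have a1 := h.1.1
  have a2 := h.1.2
  constructor <;> by_contra hcon
  · obtain ⟨r, hr, h⟩ := hf.ae_eq_of_notMem hcon
    exact false_of_ae_eq h h1 (by
      rw [max_lt_iff, lt_min_iff, lt_min_iff]; constructor <;> constructor <;> linarith)
  · obtain ⟨r, hr, h⟩ := hf.ae_eq_of_notMem_co hcon
    exact false_of_ae_eq h0 h (by
      rw [max_lt_iff, lt_min_iff, lt_min_iff]; constructor <;> constructor <;> linarith)

lemma IsDensity.not_isGapOne_and_isGapTwo [IsProbabilityMeasure μ] (hf : IsDensity μ a b f) {t : ℝ} {I J : ℝ × ℝ}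
    (h : IsGapOne μ t I) (h' : IsGapTwo μ t J) : False := by
  have h0 := (hf.subset_compl_support_iff isOpen_Ioo).1 h.2.1
  have h1 := (hf.subset_compl_co_support_iff isOpen_Ioo).1 h'.2.1
  exact false_of_ae_eq h0 h1 (by rw [max_self]; exact lt_min h.1.2 h'.1.2)

end

variable {μ : Measure ℝ} {a b : ℝ} {f : ℝ → ℝ}

/-! ### Negativity of the Wronskian -/

/-- This is where b - a > 1 enters: if f were the indicator of [p,q], mass one would give q - p = 1,
while a and b, being in the support, would both lie in [p,q]. -/
lemma IsDensity.not_res_ae_zero (hf : IsDensity μ a b f) {p q : ℝ} (hpq : p ≤ q) :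
    ¬ ∀ᵐ y, res f p q y = 0 := by
  intro h
  have key : ∀ t ∈ μ.support, t ∈ Icc p q := by
    intro t ht
    by_contra hcon
    obtain ⟨r, hr, hrs⟩ := Metric.isOpen_iff.1 isClosed_Icc.isOpen_compl t hcon
    refine hf.notMem_support_iff.2 ⟨r, hr, ?_⟩ ht
    filter_upwards [h] with y hy hyt
    rw [← hy, res_of_notMem]
    exact hrs (by rwa [Metric.mem_ball, Real.dist_eq])
  have h1 : ∫ y, f y = q - p := by
    have : f =ᵐ[volume] (Icc p q).indicator 1 := by
      filter_upwards [h] with y hy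
      rwa [res, sub_eq_zero] at hy
    rw [integral_congr_ae this, integral_indicator_one measurableSet_Icc]
    simp [hpq]
  rw [hf.integral_one] at h1
  have h2 := key a hf.left_mem
  have h3 := key b hf.right_mem
  linarith [hf.one_lt, h2.1, h3.2]

/-- Source of the strict inequalities for moments: an integrand of one sign could have integral zero
only if `res f p q` vanished a.e. -/
lemma IsDensity.integral_res_mul_pos (hf : IsDensity μ a b f) {p q : ℝ} (hpq : p ≤ q)
    {φ : ℝ → ℝ} (hint : Integrable fun y => res f p q y * φ y)
    (hnn : ∀ᵐ y, 0 ≤ res f p q y * φ y) (hne : ∀ᵐ y, φ y ≠ 0) :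
    0 < ∫ y, res f p q y * φ y := by
  refine lt_of_le_of_ne (integral_nonneg_of_ae hnn) fun h0 => hf.not_res_ae_zero hpq ?_
  have := (integral_eq_zero_iff_of_nonneg_ae hnn hint).1 h0.symm
  filter_upwards [this, hne] with y hy hφ
  exact (mul_eq_zero.1 hy).resolve_right hφ

lemma AgreesNear.integrable_mul {p q t : ℝ} (hf : Integrable f) (h : AgreesNear f p q t) (n : ℕ) :
    Integrable fun y => res f p q y * ((t - y) ^ n)⁻¹ := by
  obtain ⟨r, hr, h⟩ := h
  exact integrable_kernel (𝕜 := ℝ) (t := t) (integrable_res hf p q) h (by simpa using hr) n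

lemma mom_real_eq (g : ℝ → ℝ) (n : ℕ) (t : ℝ) :
    mom ℝ g n t = ∫ y, g y * ((t - y) ^ n)⁻¹ := rfl

lemma IsDensity.mom_two_pos (hf : IsDensity μ a b f) {I : ℝ × ℝ} {p q t : ℝ}
    (h : GapModel f I p q) (ht : t ∈ Ioo I.1 I.2) : 0 < mom ℝ (res f p q) 2 t := by
  refine hf.integral_res_mul_pos h.le ((h.agreesNear ht).integrable_mul hf.integrable 2) ?_ ?_
  · filter_upwards [h.res_eq_indicator] with y hy
    rw [hy]
    exact mul_nonneg (indicator_nonneg (fun z _ => hf.nonneg z) y) (by positivity)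
  · filter_upwards [ae_ne t] with y hy
    exact inv_ne_zero (pow_ne_zero 2 (sub_ne_zero.2 hy.symm))

lemma integral_sq_inv {t c d : ℝ} (hcd : c ≤ d) (h : t ∉ Icc c d) :
    Integrable (fun y => (Icc c d).indicator 1 y * ((t - y) ^ 2)⁻¹) ∧
    ∫ y, (Icc c d).indicator 1 y * ((t - y) ^ 2)⁻¹ = (t - d)⁻¹ - (t - c)⁻¹ := by
  have e : (fun y => (Icc c d).indicator 1 y * ((t - y) ^ 2)⁻¹)
      = (Icc c d).indicator fun y => ((t - y) ^ 2)⁻¹ := by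
    ext y
    by_cases hy : y ∈ Icc c d <;> simp [hy]
  have hne : ∀ y ∈ uIcc c d, t - y ≠ 0 := by
    intro y hy h0
    rw [uIcc_of_le hcd] at hy
    exact h (by rwa [sub_eq_zero.1 h0])
  have hi : IntervalIntegrable (fun y => ((t - y) ^ 2)⁻¹) volume c d :=
    (ContinuousOn.inv₀ (by fun_prop) fun y hy => pow_ne_zero 2 (hne y hy)).intervalIntegrable
  rw [e, integrable_indicator_iff measurableSet_Icc, integral_indicator measurableSet_Icc,
    integral_Icc_eq_integral_Ioc, ← intervalIntegral.integral_of_le hcd,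
    intervalIntegral.integral_eq_sub_of_hasDerivAt (f := fun y => (t - y)⁻¹) ?_ hi]
  · refine ⟨?_, rfl⟩
    rwa [integrableOn_Icc_iff_integrableOn_Ioc,
      ← intervalIntegrable_iff_integrableOn_Ioc_of_le hcd]
  · intro y hy
    refine (((hasDerivAt_id' y).const_sub t).inv (hne y hy)).congr_deriv ?_
    rw [neg_neg, one_div]

/-- Since f ≤ 1, the signed density is at most 0 on [p,q] and at most 1 elsewhere. Integrating
(t-y)⁻² over both full half-lines beyond p and q would give exactly the right side; f lives in
[a,b], so the finite cut-offs A and B make the inequality strict. -/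
lemma IsDensity.mom_two_lt (hf : IsDensity μ a b f) {p q t : ℝ} (h : AgreesNear f p q t)
    (hp : p < t) (hq : t < q) : mom ℝ (res f p q) 2 t < (t - p)⁻¹ + (q - t)⁻¹ := by
  set A := min a p - 1 with hA
  set B := max b q + 1 with hB
  have hAp : A < p := by linarith [min_le_right a p]
  have hBq : q < B := by linarith [le_max_right b q]
  obtain ⟨i1, e1⟩ := integral_sq_inv (t := t) hAp.le (fun h => not_lt.2 h.2 hp)
  obtain ⟨i2, e2⟩ := integral_sq_inv (t := t) hBq.le (fun h => not_lt.2 h.1 hq)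
  have key : mom ℝ (res f p q) 2 t ≤ ∫ y, ((Icc A p).indicator 1 y * ((t - y) ^ 2)⁻¹
      + (Icc q B).indicator 1 y * ((t - y) ^ 2)⁻¹) := by
    refine integral_mono_ae (h.integrable_mul hf.integrable 2) (i1.add i2)
      (Eventually.of_forall fun y => ?_)
    simp only
    rw [← add_mul]
    refine mul_le_mul_of_nonneg_right (show res f p q y ≤ _ from ?_) (by positivity)
    have n1 : (0 : ℝ) ≤ (Icc A p).indicator 1 y := indicator_nonneg (fun _ _ => zero_le_one) y
    have n2 : (0 : ℝ) ≤ (Icc q B).indicator 1 y := indicator_nonneg (fun _ _ => zero_le_one) y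
    by_cases c1 : y ∈ Icc p q
    · rw [res_of_mem c1]; linarith [hf.le_one y]
    rw [res_of_notMem c1]
    by_cases c2 : y ∈ Icc a b
    · rcases lt_or_ge y p with c3 | c3
      · rw [indicator_of_mem (show y ∈ Icc A p from
          ⟨by linarith [min_le_left a p, c2.1], c3.le⟩)]
        simp only [Pi.one_apply]; linarith [hf.le_one y]
      · have c4 : q < y := lt_of_not_ge fun c4 => c1 ⟨c3, c4⟩
        rw [indicator_of_mem (s := Icc q B) (show y ∈ Icc q B from
          ⟨c4.le, by linarith [le_max_left b q, c2.2]⟩)]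
        simp only [Pi.one_apply]; linarith [hf.le_one y]
    · rw [hf.zero_off y c2]; linarith
  rw [integral_add i1 i2, e1, e2] at key
  have h1 : 0 < (t - A)⁻¹ := inv_pos.2 (by linarith)
  have h2 : (t - B)⁻¹ < 0 := inv_lt_zero.2 (by linarith)
  have h3 : (q - t)⁻¹ = -(t - q)⁻¹ := by rw [← inv_neg, neg_sub]
  linarith

/-- Up to a positive factor, -W is m₂(t-p)(t-q) + (q-p), where m₂ > 0 is the second moment. Outside
[p,q] both terms are non-negative and the first is positive. Inside, `mom_two_lt` multiplied by
(t-p)(q-t) bounds the negative term by less than q-p. At an end-point only q-p remains, and it is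
non-zero because p = q = t is excluded. -/
lemma IsDensity.wron_neg (hf : IsDensity μ a b f) {I : ℝ × ℝ} {p q t : ℝ}
    (h : GapModel f I p q) (ht : t ∈ Ioo I.1 I.2) (hne : t = p → t ≠ q) :
    wron (modelN f p q) q t < 0 := by
  have ha := h.agreesNear ht
  rw [ha.wron_modelN hf.integrable, neg_lt_zero]
  refine mul_pos (Real.exp_pos _) ?_
  have hm := hf.mom_two_pos h ht
  have hle := h.le
  rcases lt_trichotomy t p with h1 | h1 | h1
  · have : 0 < (t - p) * (t - q) := mul_pos_of_neg_of_neg (by linarith) (by linarith)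
    have := mul_pos hm this
    linarith
  · have h2 := hne h1
    have h3 : p < q := lt_of_le_of_ne hle (by rwa [← h1])
    rw [h1, sub_self, zero_mul, mul_zero]
    linarith
  · rcases lt_trichotomy t q with h2 | h2 | h2
    · have h3 := hf.mom_two_lt ha h1 h2
      have p1 : 0 < t - p := by linarith
      have p2 : 0 < q - t := by linarith
      have h4 := mul_lt_mul_of_pos_right h3 (mul_pos p1 p2)
      have h5 : ((t - p)⁻¹ + (q - t)⁻¹) * ((t - p) * (q - t)) = q - p := by
        field_simp; ring
      rw [h5] at h4
      have h6 : (t - p) * (t - q) = -((t - p) * (q - t)) := by ring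
      rw [h6]; linarith
    · rw [h2, sub_self, mul_zero, mul_zero]
      linarith
    · have : 0 < (t - p) * (t - q) := mul_pos (by linarith) (by linarith)
      have := mul_pos hm this
      linarith

/-! ### The edge curve is locally a model curve -/

/-- The interval inside `expC` and `derivC` is an arbitrary choice. Independence of the
representation moves both values to the given [p,q], where they are N/D and the logarithmic
derivative W/(ND). -/
lemma IsDensity.expC_mul_and_derivC [IsProbabilityMeasure μ] (hf : IsDensity μ a b f) {p q s : ℝ}
    (hpq : p ≤ q) (h : AgreesNear f p q s) (hp : s ≠ p) (hq : s ≠ q)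
    (hs : s ∉ μ.support ∨ s ∉ (coMeasure μ).support) :
    expC μ a b s * (s - q) = modelN f p q s ∧
      derivC μ a b s = wron (modelN f p q) q s / (modelN f p q s * (s - q)) := by
  have hN := modelN_ne_zero (f := f) (q := q) hp
  have hD := sub_ne_zero.2 hq
  have hw : wron (modelN f p q) q s / (modelN f p q s * (s - q))
      = deriv (modelN f p q) s / modelN f p q s - 1 / (s - q) := by
    rw [wron]; field_simp
  rw [hw]
  by_cases hs0 : s ∈ μ.support
  · have hs1 : s ∉ (coMeasure μ).support := hs.resolve_left (not_not_intro hs0)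
    have hex := hf.exists_isCoGap hs1
    rw [expC, if_neg (not_not_intro hs0), dif_pos hex, derivC, if_neg (not_not_intro hs0),
      dif_pos hex]
    have hJ := hex.choose_spec
    set J := hex.choose
    have hG := hf.gapModel_of_isCoGap hJ
    have hA := hG.agreesNear hJ.1
    have n1 : s ≠ J.1 := hJ.1.1.ne'
    have n2 : s ≠ J.2 := hJ.1.2.ne
    rw [hf.cauchyOff_eq hG, logDeriv_modelN_eq hf.integrable hpq hG.le h hA hp hq n1 n2]
    refine ⟨?_, rfl⟩
    have := exp_mom_mul_eq hf.integrable hpq hG.le h hA hp hq n1 n2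
    have s2 := sub_ne_zero.2 n2
    rw [modelN]
    field_simp
    linear_combination -this
  · rw [expC, if_pos hs0, derivC, if_pos hs0]
    obtain ⟨r, hr, hG⟩ := hf.exists_gapModel_of_notMem hs0
    have hA := hG.agreesNear (s := s) ⟨by simpa using hr, by simpa using hr⟩
    have n1 : s ≠ s + r := by linarith
    rw [hf.cauchy_eq (s + r), logDeriv_modelN_eq hf.integrable hpq hG.le h hA hp hq n1 n1]
    refine ⟨?_, by ring⟩
    have := exp_mom_mul_eq hf.integrable hpq hG.le h hA hp hq n1 n1
    have s2 := sub_ne_zero.2 n1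
    rw [modelN]
    refine mul_right_cancel₀ s2 ?_
    linear_combination -this

lemma IsDensity.edgeCurve_eq_of_notMem [IsProbabilityMeasure μ] (hf : IsDensity μ a b f)
    {p q s : ℝ} (hpq : p ≤ q) (h : AgreesNear f p q s) (hp : s ≠ p) (hq : s ≠ q)
    (hs : s ∉ μ.support ∨ s ∉ (coMeasure μ).support) (hW : wron (modelN f p q) q s ≠ 0) :
    edgeCurve μ a b s = modelCurve (modelN f p q) q s := by
  obtain ⟨h1, h2⟩ := hf.expC_mul_and_derivC hpq h hp hq hs
  have n1 : ¬ ∃ I, IsGapOne μ s I := fun ⟨I, hI⟩ =>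
    hs.elim (fun h => h (hf.mem_support_of_isGapOne hI).1)
      (fun h => h (hf.mem_support_of_isGapOne hI).2)
  have n2 : ¬ ∃ I, IsGapTwo μ s I := fun ⟨I, hI⟩ =>
    hs.elim (fun h => h (hf.mem_support_of_isGapTwo hI).1)
      (fun h => h (hf.mem_support_of_isGapTwo hI).2)
  have hN := modelN_ne_zero (f := f) (q := q) hp
  have hD := sub_ne_zero.2 hq
  have h1' : expC μ a b s = modelN f p q s / (s - q) := by rw [eq_div_iff hD, h1]
  rw [edgeCurve, dif_neg n1, dif_neg n2, modelCurve, h1', h2]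
  ext
  · simp only
    field_simp
  · simp only
    field_simp

/-- On R₁ and R₂ the comparison of two models carries a factor s - t, which vanishes at the
parameter itself. Continuity allows it to be cancelled there too. -/
lemma eq_at_of_eventually_mul_eq {F G : ℝ → ℝ} {t : ℝ} (hF : ContinuousAt F t)
    (hG : ContinuousAt G t) (h : ∀ᶠ s in 𝓝 t, F s * (s - t) = G s * (s - t)) : F t = G t := by
  have h1 : F =ᶠ[𝓝[≠] t] G := by
    filter_upwards [h.filter_mono nhdsWithin_le_nhds, self_mem_nhdsWithin] with s hs hne
    exact mul_right_cancel₀ (sub_ne_zero.2 hne) hs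
  exact tendsto_nhds_unique_of_eventuallyEq (hF.tendsto.mono_left nhdsWithin_le_nhds)
    (hG.tendsto.mono_left nhdsWithin_le_nhds) h1

lemma AgreesNear.continuousAt_exp_mom {p q t : ℝ} (hf : Integrable f) (h : AgreesNear f p q t) :
    ContinuousAt (fun s => Real.exp (mom ℝ (res f p q) 1 s)) t :=
  (h.hasDerivAt_mom hf 1).continuousAt.rexp

lemma IsDensity.modelN_eq_of_isGapOne [IsProbabilityMeasure μ] (hf : IsDensity μ a b f) {t : ℝ}
    {I J : ℝ × ℝ} (hI : IsGapOne μ t I) (hJ : IsGapOne μ t J) :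
    modelN f I.1 t t = modelN f J.1 t t := by
  have gI := hf.gapModel_of_isGapOne hI
  have gJ := hf.gapModel_of_isGapOne hJ
  have aI := gI.agreesNear hI.1
  have aJ := gJ.agreesNear hJ.1
  exact eq_at_of_eventually_mul_eq (aI.analyticAt_modelN hf.integrable).continuousAt
    (aJ.analyticAt_modelN hf.integrable).continuousAt
    (eventually_modelN_mul_eq hf.integrable gI.le gJ.le aI aJ (fun h => absurd h hI.1.1.ne')
      (fun h => h) (fun h => absurd h hJ.1.1.ne') (fun h => h))

lemma IsDensity.exp_mom_mul_eq_of_isGapTwo [IsProbabilityMeasure μ] (hf : IsDensity μ a b f)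
    {t : ℝ} {I J : ℝ × ℝ} (hI : IsGapTwo μ t I) (hJ : IsGapTwo μ t J) :
    Real.exp (-mom ℝ (res f t I.2) 1 t) * (t - I.2)
      = Real.exp (-mom ℝ (res f t J.2) 1 t) * (t - J.2) := by
  have gI := hf.gapModel_of_isGapTwo hI
  have gJ := hf.gapModel_of_isGapTwo hJ
  have aI := gI.agreesNear hI.1
  have aJ := gJ.agreesNear hJ.1
  have key := eq_at_of_eventually_mul_eq
    (F := fun s => Real.exp (mom ℝ (res f t I.2) 1 s) * (s - J.2))
    (G := fun s => Real.exp (mom ℝ (res f t J.2) 1 s) * (s - I.2)) (t := t)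
    ((aI.continuousAt_exp_mom hf.integrable).mul (by fun_prop))
    ((aJ.continuousAt_exp_mom hf.integrable).mul (by fun_prop)) ?_
  · rw [Real.exp_neg, Real.exp_neg]
    have e1 := Real.exp_ne_zero (mom ℝ (res f t I.2) 1 t)
    have e2 := Real.exp_ne_zero (mom ℝ (res f t J.2) 1 t)
    field_simp
    linear_combination -key
  · filter_upwards [eventually_modelN_mul_eq hf.integrable gI.le gJ.le aI aJ (fun h => h)
      (fun h => absurd h hI.1.2.ne) (fun h => h) (fun h => absurd h hJ.1.2.ne)] with s hs
    simp only [modelN] at hs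
    linear_combination hs

lemma IsDensity.edgeCurve_eq_of_isGapOne [IsProbabilityMeasure μ] (hf : IsDensity μ a b f)
    {t : ℝ} {I : ℝ × ℝ} (hI : IsGapOne μ t I) :
    edgeCurve μ a b t = (t, 1 - modelN f I.1 t t) := by
  have hex : ∃ J, IsGapOne μ t J := ⟨I, hI⟩
  rw [edgeCurve, dif_pos hex, hf.cauchyOff_eq (hf.gapModel_of_isGapOne hex.choose_spec),
    hf.modelN_eq_of_isGapOne hI hex.choose_spec]
  rfl

lemma IsDensity.edgeCurve_eq_of_isGapTwo [IsProbabilityMeasure μ] (hf : IsDensity μ a b f)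
    {t : ℝ} {I : ℝ × ℝ} (hI : IsGapTwo μ t I) :
    edgeCurve μ a b t = (t - Real.exp (-mom ℝ (res f t I.2) 1 t) * (t - I.2),
      1 + Real.exp (-mom ℝ (res f t I.2) 1 t) * (t - I.2)) := by
  have hex : ∃ J, IsGapTwo μ t J := ⟨I, hI⟩
  have n1 : ¬ ∃ J, IsGapOne μ t J := fun ⟨J, hJ⟩ => hf.not_isGapOne_and_isGapTwo hJ hI
  rw [edgeCurve, dif_neg n1, dif_pos hex, hf.cauchyOff_eq (hf.gapModel_of_isGapTwo hex.choose_spec),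
    hf.exp_mom_mul_eq_of_isGapTwo hI hex.choose_spec]

/-- The data of a model for the edge curve near the parameter `t`. -/
structure IsModelAt (μ : Measure ℝ) (a b : ℝ) (f : ℝ → ℝ) (p q t : ℝ) : Prop where
  le : p ≤ q
  agrees : AgreesNear f p q t
  wron_neg : wron (modelN f p q) q t < 0
  curve_eq : edgeCurve μ a b =ᶠ[𝓝 t] modelCurve (modelN f p q) q

/-- By `hp` and `hq` an end-point can lie in I only if it is t, so the generic formula for the edge
holds near t away from t. Only when t is an end-point, on R₁ and R₂, must the value at t be supplied
separately, by `heq`. -/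
lemma IsDensity.isModelAt_of_gapModel [IsProbabilityMeasure μ] (hf : IsDensity μ a b f)
    {I : ℝ × ℝ} {p q t : ℝ} (h : GapModel f I p q) (ht : t ∈ Ioo I.1 I.2) (hne : t = p → t ≠ q)
    (hp : t = p ∨ p ∉ Ioo I.1 I.2) (hq : t = q ∨ q ∉ Ioo I.1 I.2)
    (hs : ∀ s ∈ Ioo I.1 I.2, s ≠ p → s ≠ q → s ∉ μ.support ∨ s ∉ (coMeasure μ).support)
    (heq : (t = p ∨ t = q) → edgeCurve μ a b t = modelCurve (modelN f p q) q t) :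
    IsModelAt μ a b f p q t := by
  have ha := h.agreesNear ht
  have hW := hf.wron_neg h ht hne
  refine ⟨h.le, ha, hW, ?_⟩
  filter_upwards [ha.eventually, isOpen_Ioo.mem_nhds ht,
    eventually_analyticAt_and_wron (ha.analyticAt_modelN hf.integrable) hW.ne] with s h1 h2 h3
  by_cases c1 : s = p
  · have hsp : t = p := hp.resolve_right (not_not_intro (c1 ▸ h2))
    rw [c1.trans hsp.symm]; exact heq (Or.inl hsp)
  by_cases c2 : s = q
  · have hsq : t = q := hq.resolve_right (not_not_intro (c2 ▸ h2))
    rw [c2.trans hsq.symm]; exact heq (Or.inr hsq)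
  exact hf.edgeCurve_eq_of_notMem h.le h1 c1 c2 (hs s h2 c1 c2) h3.2

lemma IsDensity.exists_isModelAt_of_notMem [IsProbabilityMeasure μ] (hf : IsDensity μ a b f)
    {t : ℝ} (ht : t ∉ μ.support) : ∃ c, t < c ∧ IsModelAt μ a b f c c t := by
  obtain ⟨r, hr, h⟩ := hf.notMem_support_iff.1 ht
  have hsub : Ioo (t - r) (t + r) ⊆ μ.supportᶜ := by
    rw [hf.subset_compl_support_iff isOpen_Ioo]
    filter_upwards [h] with y hy hyI
    refine hy ?_
    rw [abs_lt]; constructor <;> linarith [hyI.1, hyI.2]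
  have hG : GapModel f (t - r, t + r) (t + r) (t + r) := by
    refine ⟨by linarith, le_rfl, le_rfl, ?_⟩
    filter_upwards [(hf.subset_compl_support_iff isOpen_Ioo).1 hsub, res_self_ae f (t + r)]
      with y hy hy2 hyI
    rw [hy2, hy hyI]
  have hne : t ≠ t + r := by linarith
  refine ⟨t + r, by linarith, hf.isModelAt_of_gapModel hG ⟨by linarith, by linarith⟩
    (fun h => absurd h hne) (Or.inr fun h => lt_irrefl _ h.2) (Or.inr fun h => lt_irrefl _ h.2)
    (fun s hs _ _ => Or.inl (hsub hs)) (fun h => absurd (h.elim id id) hne)⟩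

lemma IsDensity.isModelAt_of_isCoGap [IsProbabilityMeasure μ] (hf : IsDensity μ a b f)
    {t : ℝ} {I : ℝ × ℝ} (h : IsCoGap μ t I) : IsModelAt μ a b f I.1 I.2 t :=
  hf.isModelAt_of_gapModel (hf.gapModel_of_isCoGap h) h.1
    (fun h1 => absurd h1 h.1.1.ne') (Or.inr fun h1 => lt_irrefl _ h1.1)
    (Or.inr fun h1 => lt_irrefl _ h1.2) (fun _ hs _ _ => Or.inr (h.2 hs))
    (fun h1 => (h1.elim h.1.1.ne' h.1.2.ne).elim)

/-- At t = q the denominator D vanishes and W = -N, so the model formula takes the value (t, 1 -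
N(t)), which is the prescribed one. -/
lemma IsDensity.isModelAt_of_isGapOne [IsProbabilityMeasure μ] (hf : IsDensity μ a b f)
    {t : ℝ} {I : ℝ × ℝ} (h : IsGapOne μ t I) : IsModelAt μ a b f I.1 t t := by
  refine hf.isModelAt_of_gapModel (hf.gapModel_of_isGapOne h) h.1
    (fun h1 => absurd h1 h.1.1.ne') (Or.inr fun h1 => lt_irrefl _ h1.1)
    (Or.inl rfl) (fun _ hs _ hst => ?_) (fun _ => ?_)
  · rcases lt_or_gt_of_ne hst with h1 | h1
    · exact Or.inr (h.2.2 ⟨hs.1, h1⟩)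
    · exact Or.inl (h.2.1 ⟨h1, hs.2⟩)
  · have hN := modelN_ne_zero (f := f) (q := t) h.1.1.ne'
    rw [hf.edgeCurve_eq_of_isGapOne h, modelCurve, wron, sub_self]
    ext
    · simp
    · simp only [mul_zero, zero_sub, sub_zero]
      field_simp
      ring

/-- At t = p the numerator N vanishes, so M = -D and W = e^h D; hence MD/W = -e^{-h}D and M²/W =
e^{-h}D, as prescribed. -/
lemma IsDensity.isModelAt_of_isGapTwo [IsProbabilityMeasure μ] (hf : IsDensity μ a b f)
    {t : ℝ} {I : ℝ × ℝ} (h : IsGapTwo μ t I) : IsModelAt μ a b f t I.2 t := by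
  refine hf.isModelAt_of_gapModel (hf.gapModel_of_isGapTwo h) h.1
    (fun _ => h.1.2.ne) (Or.inl rfl) (Or.inr fun h1 => lt_irrefl _ h1.2)
    (fun _ hs hst _ => ?_) (fun _ => ?_)
  · rcases lt_or_gt_of_ne hst with h1 | h1
    · exact Or.inl (h.2.2 ⟨hs.1, h1⟩)
    · exact Or.inr (h.2.1 ⟨h1, hs.2⟩)
  · have hA := (hf.gapModel_of_isGapTwo h).agreesNear h.1
    have hN : modelN f t I.2 t = 0 := by rw [modelN, sub_self, mul_zero]
    have hW : wron (modelN f t I.2) I.2 t = Real.exp (mom ℝ (res f t I.2) 1 t) * (t - I.2) := by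
      rw [wron, (hA.hasDerivAt_modelN hf.integrable).deriv, hN]; ring
    have hD : t - I.2 ≠ 0 := sub_ne_zero.2 h.1.2.ne
    have hE := Real.exp_ne_zero (mom ℝ (res f t I.2) 1 t)
    rw [hf.edgeCurve_eq_of_isGapTwo h, modelCurve, hW, hN, Real.exp_neg]
    ext
    · simp only
      field_simp
      ring
    · simp only
      field_simp
      ring

variable {μ : Measure ℝ} {a b : ℝ} {f : ℝ → ℝ}

/-! ### The function `f'` and its roots -/

lemma mom_sub_add {𝕜 : Type*} [RCLike 𝕜] {g₁ g₂ g₃ : ℝ → ℝ} (h₁ : Integrable g₁)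
    (h₂ : Integrable g₂) (h₃ : Integrable g₃) {t r : ℝ}
    (v₁ : ∀ᵐ y, |y - t| < r → g₁ y = 0) (v₂ : ∀ᵐ y, |y - t| < r → g₂ y = 0)
    (v₃ : ∀ᵐ y, |y - t| < r → g₃ y = 0) {w : 𝕜} (hw : ‖w - (t : 𝕜)‖ < r) (n : ℕ) :
    mom 𝕜 g₁ n w - mom 𝕜 g₂ n w + mom 𝕜 g₃ n w = mom 𝕜 (fun y => g₁ y - g₂ y + g₃ y) n w := by
  have i1 := integrable_kernel h₁ v₁ hw n
  have i2 := integrable_kernel h₂ v₂ hw n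
  have i3 := integrable_kernel h₃ v₃ hw n
  rw [mom, mom, mom, ← integral_sub i1 i2]
  refine (integral_add (i1.sub i2) i3).symm.trans (integral_congr_ae (Eventually.of_forall ?_))
  intro y
  simp only [Pi.sub_apply]
  push_cast
  ring

/-- The three pieces have densities f, -(1-f) and f, and up to end-points they add up to f -
1_{[χ₂,χ]}, since f vanishes off [a,b]. The hypothesis near t makes each of them vanish there, so
that they are separately integrable against the kernel. -/
lemma IsDensity.fPrime_eq [IsProbabilityMeasure μ] (hf : IsDensity μ a b f) {χ η : ℝ}
    (hη : η ≤ 1) {t r : ℝ} (hv : ∀ᵐ y, |y - t| < r → res f (χ + η - 1) χ y = 0) {w : ℂ}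
    (hw : ‖w - (t : ℂ)‖ < r) :
    fPrime μ a b (χ, η) w = mom ℂ (res f (χ + η - 1) χ) 1 w := by
  set χ₂ := χ + η - 1 with hχ₂
  have hle : χ₂ ≤ χ := by linarith
  have e1 : (∫ x : ℝ in Icc χ b, 1 / (w - (x : ℂ)) ∂μ) = mom ℂ ((Icc χ b).indicator f) 1 w := by
    rw [hf.setIntegral_eq measurableSet_Icc, mom]
    refine integral_congr_ae (Eventually.of_forall fun y => ?_)
    simp
  have e3 : (∫ x : ℝ in Icc a χ₂, 1 / (w - (x : ℂ)) ∂μ) = mom ℂ ((Icc a χ₂).indicator f) 1 w := by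
    rw [hf.setIntegral_eq measurableSet_Icc, mom]
    refine integral_congr_ae (Eventually.of_forall fun y => ?_)
    simp
  have e2 : (∫ x : ℝ in Icc χ₂ χ, 1 / (w - (x : ℂ)) ∂(coMeasure μ))
      = mom ℂ ((Icc χ₂ χ).indicator fun y => 1 - f y) 1 w := by
    rw [hf.setIntegral_co_eq measurableSet_Icc, mom]
    refine integral_congr_ae (Eventually.of_forall fun y => ?_)
    simp
  have v1 : ∀ᵐ y, |y - t| < r → (Icc χ b).indicator f y = 0 := by
    filter_upwards [hv, ae_ne χ] with y hy hne hyt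
    refine indicator_apply_eq_zero.2 fun hmem => ?_
    rw [← hy hyt, res_of_notMem fun h => hne (le_antisymm h.2 hmem.1)]
  have v3 : ∀ᵐ y, |y - t| < r → (Icc a χ₂).indicator f y = 0 := by
    filter_upwards [hv, ae_ne χ₂] with y hy hne hyt
    refine indicator_apply_eq_zero.2 fun hmem => ?_
    rw [← hy hyt, res_of_notMem fun h => hne (le_antisymm hmem.2 h.1)]
  have v2 : ∀ᵐ y, |y - t| < r → (Icc χ₂ χ).indicator (fun y => 1 - f y) y = 0 := by
    filter_upwards [hv] with y hy hyt
    refine indicator_apply_eq_zero.2 fun hmem => ?_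
    have := hy hyt
    rw [res_of_mem hmem] at this
    linarith
  have i2 : Integrable ((Icc χ₂ χ).indicator fun y => 1 - f y) :=
    (integrable_indicator_iff measurableSet_Icc).2
      ((integrableOn_const (by simp) (by simp)).sub hf.integrable.integrableOn)
  show (∫ x : ℝ in Icc χ b, 1 / (w - (x : ℂ)) ∂μ)
    - (∫ x : ℝ in Icc χ₂ χ, 1 / (w - (x : ℂ)) ∂(coMeasure μ))
    + (∫ x : ℝ in Icc a χ₂, 1 / (w - (x : ℂ)) ∂μ) = _
  rw [e1, e2, e3, mom_sub_add (hf.integrable.indicator measurableSet_Icc) i2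
    (hf.integrable.indicator measurableSet_Icc) v1 v2 v3 hw]
  refine congrFun (mom_congr_ae ?_ 1) w
  filter_upwards [ae_ne χ, ae_ne χ₂] with y h1 h2
  by_cases hJ : y ∈ Icc χ₂ χ
  · rw [res_of_mem hJ, indicator_of_mem hJ,
      indicator_of_notMem (fun h => h1 (le_antisymm hJ.2 h.1)),
      indicator_of_notMem (fun h => h2 (le_antisymm h.2 hJ.1))]
    ring
  rw [res_of_notMem hJ, indicator_of_notMem hJ]
  by_cases hab : y ∈ Icc a b
  · rcases lt_or_ge y χ₂ with h3 | h3
    · rw [indicator_of_notMem (fun h => (h3.trans_le hle).not_ge h.1),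
        indicator_of_mem (show y ∈ Icc a χ₂ from ⟨hab.1, h3.le⟩)]
      ring
    · have h4 : χ < y := lt_of_not_ge fun h => hJ ⟨h3, h⟩
      rw [indicator_of_mem (show y ∈ Icc χ b from ⟨h4.le, hab.2⟩),
        indicator_of_notMem (fun h => h2 (le_antisymm h.2 h3))]
      ring
  · have h0 := hf.zero_off y hab
    rw [indicator_apply_eq_zero.2 fun _ => h0, indicator_apply_eq_zero.2 fun _ => h0, h0]
    ring

lemma IsDensity.notMem_fSupport [IsProbabilityMeasure μ] (hf : IsDensity μ a b f) {χ η t : ℝ}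
    (h : AgreesNear f (χ + η - 1) χ t) : t ∉ fSupport μ a b (χ, η) := by
  obtain ⟨r, hr, hv⟩ := h
  set χ₂ := χ + η - 1 with hχ₂
  rintro ((h1 | h2) | h3)
  · revert h1
    show t ∉ (μ.restrict (Icc χ b)).support
    rw [hf.eq]
    refine notMem_support_restrict_withDensity hf.meas hf.nonneg measurableSet_Icc hr ?_
    filter_upwards [hv, ae_ne χ] with y hy hne hyt hmem
    rw [← hy hyt, res_of_notMem fun h => hne (le_antisymm h.2 hmem.1)]
  · revert h2
    show t ∉ ((coMeasure μ).restrict (Icc χ₂ χ)).support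
    rw [hf.coMeasure_eq]
    refine notMem_support_restrict_withDensity hf.measurable_one_sub
      (fun y => sub_nonneg.2 (hf.le_one y)) measurableSet_Icc hr ?_
    filter_upwards [hv] with y hy hyt hmem
    have := hy hyt
    rw [res_of_mem hmem] at this
    linarith
  · revert h3
    show t ∉ (μ.restrict (Icc a χ₂)).support
    rw [hf.eq]
    refine notMem_support_restrict_withDensity hf.meas hf.nonneg measurableSet_Icc hr ?_
    filter_upwards [hv, ae_ne χ₂] with y hy hne hyt hmem
    rw [← hy hyt, res_of_notMem fun h => hne (le_antisymm hmem.2 h.1)]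

/-- The `k`-th derivative at `t` of `f'_{(χ,η)}`, as a moment. -/
noncomputable def jet (f : ℝ → ℝ) (χ η t : ℝ) (k : ℕ) : ℝ :=
  (-1) ^ k * (k.factorial : ℝ) * mom ℝ (res f (χ + η - 1) χ) (k + 1) t

lemma jet_eq_zero_iff {χ η t : ℝ} {k : ℕ} :
    jet f χ η t k = 0 ↔ mom ℝ (res f (χ + η - 1) χ) (k + 1) t = 0 := by
  rw [jet, mul_eq_zero, or_iff_right]
  exact mul_ne_zero (pow_ne_zero _ (by norm_num)) (by exact_mod_cast k.factorial_ne_zero)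

lemma IsDensity.fPrime_eventuallyEq [IsProbabilityMeasure μ] (hf : IsDensity μ a b f) {χ η t : ℝ}
    (hη : η ≤ 1) (h : AgreesNear f (χ + η - 1) χ t) :
    fPrime μ a b (χ, η) =ᶠ[𝓝 (t : ℂ)] mom ℂ (res f (χ + η - 1) χ) 1 := by
  obtain ⟨r, hr, hv⟩ := h
  filter_upwards [Metric.ball_mem_nhds (t : ℂ) hr] with w hw
  exact hf.fPrime_eq hη hv (by simpa [dist_eq_norm] using hw)

lemma IsDensity.iteratedDeriv_fPrime [IsProbabilityMeasure μ] (hf : IsDensity μ a b f)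
    {χ η t : ℝ} (hη : η ≤ 1) (h : AgreesNear f (χ + η - 1) χ t) (k : ℕ) :
    iteratedDeriv k (fPrime μ a b (χ, η)) (t : ℂ) = (jet f χ η t k : ℝ) := by
  rw [(hf.fPrime_eventuallyEq hη h).iteratedDeriv_eq]
  obtain ⟨r, hr, hv⟩ := h
  have := iteratedDeriv_mom (𝕜 := ℂ) (integrable_res hf.integrable _ _) hv k (w := (t : ℂ))
    (by simpa using hr)
  rw [this, mom_ofReal, jet]
  push_cast
  rfl

lemma IsDensity.analyticAt_fPrime [IsProbabilityMeasure μ] (hf : IsDensity μ a b f)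
    {χ η t : ℝ} (hη : η ≤ 1) (h : AgreesNear f (χ + η - 1) χ t) :
    AnalyticAt ℂ (fPrime μ a b (χ, η)) (t : ℂ) := by
  refine AnalyticAt.congr ?_ (hf.fPrime_eventuallyEq hη h).symm
  obtain ⟨r, hr, hv⟩ := h
  exact analyticAt_mom (integrable_res hf.integrable _ _) hr hv 1

lemma IsDensity.isRootOfMult_iff [IsProbabilityMeasure μ] (hf : IsDensity μ a b f)
    {χ η t : ℝ} (hη : η ≤ 1) (h : AgreesNear f (χ + η - 1) χ t) {m : ℕ} (hm : 1 ≤ m) :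
    IsRootOfMult μ a b (χ, η) t m ↔
      (∀ k < m, jet f χ η t k = 0) ∧ jet f χ η t m ≠ 0 := by
  rw [IsRootOfMult, analyticOrderAt_eq_nat_iff_iteratedDeriv_eq_zero (hf.analyticAt_fPrime hη h)]
  simp only [hf.iteratedDeriv_fPrime hη h, Complex.ofReal_eq_zero, ne_eq, hf.notMem_fSupport h,
    not_false_eq_true, true_and]
  rw [and_iff_right (by exact_mod_cast hm)]

lemma IsDensity.isRoot_iff [IsProbabilityMeasure μ] (hf : IsDensity μ a b f)
    {χ η t : ℝ} (hη : η ≤ 1) (h : AgreesNear f (χ + η - 1) χ t) :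
    IsRoot μ a b (χ, η) t ↔ jet f χ η t 0 = 0 := by
  have := hf.iteratedDeriv_fPrime hη h 0
  rw [iteratedDeriv_zero] at this
  rw [IsRoot, this, Complex.ofReal_eq_zero, and_iff_right (hf.notMem_fSupport h)]

/-! ### Sign arguments -/

section signs

variable {χ χ₂ t : ℝ}

lemma AgreesNear.integral_lin (hf : Integrable f) (h : AgreesNear f χ₂ χ t) (c : ℝ) (n : ℕ) :
    Integrable (fun y => res f χ₂ χ y * ((y - c) * ((t - y) ^ (n + 1))⁻¹)) ∧
    ∫ y, res f χ₂ χ y * ((y - c) * ((t - y) ^ (n + 1))⁻¹)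
      = (t - c) * mom ℝ (res f χ₂ χ) (n + 1) t - mom ℝ (res f χ₂ χ) n t := by
  have i1 := (h.integrable_mul hf (n + 1)).const_mul (t - c)
  have i0 := h.integrable_mul hf n
  have e : (fun y => res f χ₂ χ y * ((y - c) * ((t - y) ^ (n + 1))⁻¹)) =ᵐ[volume]
      fun y => (t - c) * (res f χ₂ χ y * ((t - y) ^ (n + 1))⁻¹)
        - res f χ₂ χ y * ((t - y) ^ n)⁻¹ := by
    filter_upwards [ae_ne t] with y hy
    have hy' := sub_ne_zero.2 hy.symm
    field_simp
    ring
  rw [integral_congr_ae e, integrable_congr e, integral_sub i1 i0, integral_const_mul]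
  exact ⟨i1.sub i0, rfl⟩

/-- Expanding (y-χ)(y-χ₂) in powers of t-y turns a statement about the sign of an integrand into a
relation between three consecutive moments. -/
lemma AgreesNear.integral_quad (hf : Integrable f) (h : AgreesNear f χ₂ χ t) (n : ℕ) :
    Integrable (fun y => res f χ₂ χ y * ((y - χ) * (y - χ₂) * ((t - y) ^ (n + 2))⁻¹)) ∧
    ∫ y, res f χ₂ χ y * ((y - χ) * (y - χ₂) * ((t - y) ^ (n + 2))⁻¹)
      = mom ℝ (res f χ₂ χ) n t - ((t - χ) + (t - χ₂)) * mom ℝ (res f χ₂ χ) (n + 1) t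
        + (t - χ) * (t - χ₂) * mom ℝ (res f χ₂ χ) (n + 2) t := by
  have i2 := (h.integrable_mul hf (n + 2)).const_mul ((t - χ) * (t - χ₂))
  have i1 := (h.integrable_mul hf (n + 1)).const_mul ((t - χ) + (t - χ₂))
  have i0 := h.integrable_mul hf n
  have e : (fun y => res f χ₂ χ y * ((y - χ) * (y - χ₂) * ((t - y) ^ (n + 2))⁻¹)) =ᵐ[volume]
      fun y => (res f χ₂ χ y * ((t - y) ^ n)⁻¹
        - ((t - χ) + (t - χ₂)) * (res f χ₂ χ y * ((t - y) ^ (n + 1))⁻¹))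
        + (t - χ) * (t - χ₂) * (res f χ₂ χ y * ((t - y) ^ (n + 2))⁻¹) := by
    filter_upwards [ae_ne t] with y hy
    have hy' := sub_ne_zero.2 hy.symm
    field_simp
    ring
  rw [integral_congr_ae e, integrable_congr e]
  refine ⟨(i0.sub i1).add i2, (integral_add (i0.sub i1) i2).trans ?_⟩
  simp only [Pi.sub_apply]
  rw [integral_sub i0 i1, integral_const_mul, integral_const_mul]
  rfl

/-- Because 0 ≤ f ≤ 1, the signed density f - 1_{[χ₂,χ]} is non-positive exactly where the quadratic
factor may be negative, and non-negative elsewhere. -/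
lemma IsDensity.res_mul_quad_nonneg (hf : IsDensity μ a b f) (hle : χ₂ ≤ χ) (y : ℝ) :
    0 ≤ res f χ₂ χ y * ((y - χ) * (y - χ₂)) := by
  by_cases hJ : y ∈ Icc χ₂ χ
  · rw [res_of_mem hJ]
    exact mul_nonneg_of_nonpos_of_nonpos (by linarith [hf.le_one y])
      (mul_nonpos_of_nonpos_of_nonneg (by linarith [hJ.2]) (by linarith [hJ.1]))
  · rw [res_of_notMem hJ]
    refine mul_nonneg (hf.nonneg y) ?_
    rcases lt_or_ge y χ₂ with h | h
    · exact mul_nonneg_of_nonpos_of_nonpos (by linarith) (by linarith)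
    · have : χ < y := lt_of_not_ge fun h' => hJ ⟨h, h'⟩
      exact mul_nonneg (by linarith) (by linarith)

lemma ae_quad_ne_zero (χ χ₂ t : ℝ) (n : ℕ) :
    ∀ᵐ y : ℝ, (y - χ) * (y - χ₂) * ((t - y) ^ n)⁻¹ ≠ 0 := by
  filter_upwards [ae_ne χ, ae_ne χ₂, ae_ne t] with y h1 h2 h3
  exact mul_ne_zero (mul_ne_zero (sub_ne_zero.2 h1) (sub_ne_zero.2 h2))
    (inv_ne_zero (pow_ne_zero n (sub_ne_zero.2 h3.symm)))

/-- For even n the weight (t-y)^{-n-2} is non-negative. The case n = 0 yields η > 0, and n = 2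
bounds the multiplicity of the root. -/
lemma IsDensity.quad_pos (hf : IsDensity μ a b f) (hle : χ₂ ≤ χ) (h : AgreesNear f χ₂ χ t)
    {n : ℕ} (hn : Even n) :
    0 < mom ℝ (res f χ₂ χ) n t - ((t - χ) + (t - χ₂)) * mom ℝ (res f χ₂ χ) (n + 1) t
        + (t - χ) * (t - χ₂) * mom ℝ (res f χ₂ χ) (n + 2) t := by
  obtain ⟨hi, he⟩ := h.integral_quad hf.integrable n
  rw [← he]
  refine hf.integral_res_mul_pos hle hi (Eventually.of_forall fun y => ?_)
    (ae_quad_ne_zero χ χ₂ t (n + 2))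
  rw [← mul_assoc]
  exact mul_nonneg (hf.res_mul_quad_nonneg hle y)
    (inv_nonneg.2 ((hn.add even_two).pow_nonneg _))

/-- With t to the right of b and χ, t-y keeps its sign where the density lives, so odd n is allowed
as well. For n = 1 this excludes a triple root outside (a,b); the mirror image to the left of a
follows, with reversed sign. -/
lemma IsDensity.quad_pos_of_le (hf : IsDensity μ a b f) (hle : χ₂ ≤ χ)
    (h : AgreesNear f χ₂ χ t) (hχ : χ ≤ t) (hb : b ≤ t) (n : ℕ) :
    0 < mom ℝ (res f χ₂ χ) n t - ((t - χ) + (t - χ₂)) * mom ℝ (res f χ₂ χ) (n + 1) t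
        + (t - χ) * (t - χ₂) * mom ℝ (res f χ₂ χ) (n + 2) t := by
  obtain ⟨hi, he⟩ := h.integral_quad hf.integrable n
  rw [← he]
  refine hf.integral_res_mul_pos hle hi (Eventually.of_forall fun y => ?_)
    (ae_quad_ne_zero χ χ₂ t (n + 2))
  rcases le_or_gt y t with hy | hy
  · rw [← mul_assoc]
    exact mul_nonneg (hf.res_mul_quad_nonneg hle y)
      (inv_nonneg.2 (pow_nonneg (by linarith) _))
  · rw [res_of_notMem (fun hJ => by linarith [hJ.2]),
      hf.zero_off y (fun hab => by linarith [hab.2]), zero_mul]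

lemma IsDensity.neg_quad_pos_of_le (hf : IsDensity μ a b f) (hle : χ₂ ≤ χ)
    (h : AgreesNear f χ₂ χ t) (hχ : t ≤ χ₂) (ha : t ≤ a) {n : ℕ} (hn : Odd n) :
    mom ℝ (res f χ₂ χ) n t - ((t - χ) + (t - χ₂)) * mom ℝ (res f χ₂ χ) (n + 1) t
        + (t - χ) * (t - χ₂) * mom ℝ (res f χ₂ χ) (n + 2) t < 0 := by
  obtain ⟨hi, he⟩ := h.integral_quad hf.integrable n
  rw [← he, ← neg_pos, ← integral_neg]
  have e : (fun y => -(res f χ₂ χ y * ((y - χ) * (y - χ₂) * ((t - y) ^ (n + 2))⁻¹)))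
      = fun y => res f χ₂ χ y * ((y - χ) * (y - χ₂) * ((y - t) ^ (n + 2))⁻¹) := by
    ext y
    have : (y - t) ^ (n + 2) = -(t - y) ^ (n + 2) := by
      rw [← (hn.add_even even_two).neg_pow, neg_sub]
    rw [this, inv_neg]; ring
  have hi' := hi.neg
  simp only [Pi.neg_def] at hi'
  rw [e] at hi' ⊢
  refine hf.integral_res_mul_pos hle hi' (Eventually.of_forall fun y => ?_) ?_
  · rcases le_or_gt t y with hy | hy
    · rw [← mul_assoc]
      exact mul_nonneg (hf.res_mul_quad_nonneg hle y)
        (inv_nonneg.2 (pow_nonneg (by linarith) _))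
    · rw [res_of_notMem (fun hJ => by linarith [hJ.1]),
        hf.zero_off y (fun hab => by linarith [hab.1]), zero_mul]
  · filter_upwards [ae_ne χ, ae_ne χ₂, ae_ne t] with y h1 h2 h3
    exact mul_ne_zero (mul_ne_zero (sub_ne_zero.2 h1) (sub_ne_zero.2 h2))
      (inv_ne_zero (pow_ne_zero _ (sub_ne_zero.2 h3)))

lemma IsDensity.integral_res (hf : IsDensity μ a b f) (hle : χ₂ ≤ χ) (t : ℝ) :
    mom ℝ (res f χ₂ χ) 0 t = 1 - (χ - χ₂) := by
  have e : mom ℝ (res f χ₂ χ) 0 t = ∫ y, (f y - (Icc χ₂ χ).indicator 1 y) := by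
    simp [mom, res]
  have hi : Integrable ((Icc χ₂ χ).indicator (1 : ℝ → ℝ)) :=
    (integrable_indicator_iff measurableSet_Icc).2
      (integrableOn_const (C := (1 : ℝ)) (by simp) (by simp))
  rw [e, integral_sub hf.integrable hi, hf.integral_one, integral_indicator_one measurableSet_Icc]
  simp [hle]

/-- If χ ≥ b, no mass of f is left beyond χ, so (f - 1_{[χ₂,χ]})(y)(y-χ₂) ≤ 0 for every y. Its
integral against (t-y)⁻² would then be negative, but it is the combination of moments assumed to be
zero. -/
lemma IsDensity.lt_right (hf : IsDensity μ a b f) (hle : χ₂ ≤ χ) (h : AgreesNear f χ₂ χ t)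
    (h0 : (t - χ₂) * mom ℝ (res f χ₂ χ) 2 t - mom ℝ (res f χ₂ χ) 1 t = 0) : χ < b := by
  by_contra hcon
  rw [not_lt] at hcon
  obtain ⟨hi, he⟩ := h.integral_lin hf.integrable χ₂ 1
  rw [h0] at he
  have key := hf.integral_res_mul_pos (φ := fun y => -((y - χ₂) * ((t - y) ^ (1 + 1))⁻¹)) hle
    (by simp only [mul_neg]; exact hi.neg) (Eventually.of_forall fun y => ?_) ?_
  · simp only [mul_neg] at key
    rw [integral_neg, he] at key
    simp at key
  · rw [mul_neg, ← mul_assoc, ← neg_mul]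
    refine mul_nonneg ?_ (inv_nonneg.2 (sq_nonneg _))
    rw [neg_nonneg]
    by_cases hJ : y ∈ Icc χ₂ χ
    · rw [res_of_mem hJ]
      exact mul_nonpos_of_nonpos_of_nonneg (by linarith [hf.le_one y]) (by linarith [hJ.1])
    · rw [res_of_notMem hJ]
      rcases lt_or_ge y χ₂ with h1 | h1
      · exact mul_nonpos_of_nonneg_of_nonpos (hf.nonneg y) (by linarith)
      · have : χ < y := lt_of_not_ge fun h' => hJ ⟨h1, h'⟩
        rw [hf.zero_off y (fun hab => by linarith [hab.2]), zero_mul]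
  · filter_upwards [ae_ne χ₂, ae_ne t] with y h2 h3
    exact neg_ne_zero.2 (mul_ne_zero (sub_ne_zero.2 h2)
      (inv_ne_zero (pow_ne_zero _ (sub_ne_zero.2 h3.symm))))

lemma IsDensity.left_lt (hf : IsDensity μ a b f) (hle : χ₂ ≤ χ) (h : AgreesNear f χ₂ χ t)
    (h0 : (t - χ) * mom ℝ (res f χ₂ χ) 2 t - mom ℝ (res f χ₂ χ) 1 t = 0) : a < χ₂ := by
  by_contra hcon
  rw [not_lt] at hcon
  obtain ⟨hi, he⟩ := h.integral_lin hf.integrable χ 1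
  rw [h0] at he
  have key := hf.integral_res_mul_pos (φ := fun y => (y - χ) * ((t - y) ^ (1 + 1))⁻¹) hle
    hi (Eventually.of_forall fun y => ?_) ?_
  · rw [he] at key
    exact lt_irrefl _ key
  · rw [← mul_assoc]
    refine mul_nonneg ?_ (inv_nonneg.2 (sq_nonneg _))
    by_cases hJ : y ∈ Icc χ₂ χ
    · rw [res_of_mem hJ]
      exact mul_nonneg_of_nonpos_of_nonpos (by linarith [hf.le_one y]) (by linarith [hJ.2])
    · rw [res_of_notMem hJ]
      rcases lt_or_ge χ y with h1 | h1
      · exact mul_nonneg (hf.nonneg y) (by linarith)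
      · have : y < χ₂ := lt_of_not_ge fun h' => hJ ⟨h', h1⟩
        rw [hf.zero_off y (fun hab => by linarith [hab.1]), zero_mul]
  · filter_upwards [ae_ne χ, ae_ne t] with y h2 h3
    exact mul_ne_zero (sub_ne_zero.2 h2)
      (inv_ne_zero (pow_ne_zero _ (sub_ne_zero.2 h3.symm)))

end signs

variable {μ : Measure ℝ} {a b : ℝ} {f : ℝ → ℝ}

/-! ### The roots of `f'` on the edge -/

lemma AgreesNear.congr {p q p' q' t : ℝ} (h : AgreesNear f p q t)
    (hev : ∀ᶠ s in 𝓝[≠] t, (s ∈ Icc p q ↔ s ∈ Icc p' q')) : AgreesNear f p' q' t := by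
  obtain ⟨r, hr, h⟩ := h
  obtain ⟨r', hr', h'⟩ := Metric.eventually_nhds_iff.1 (eventually_nhdsWithin_iff.1 hev)
  refine ⟨min r r', lt_min hr hr', ?_⟩
  filter_upwards [h, ae_ne t] with y hy hyt hlt
  rw [← hy (hlt.trans_le (min_le_left _ _))]
  have := h' (y := y) (by rw [Real.dist_eq]; exact hlt.trans_le (min_le_right _ _)) hyt
  by_cases hm : y ∈ Icc p q
  · rw [res_of_mem hm, res_of_mem (this.1 hm)]
  · rw [res_of_notMem hm, res_of_notMem (fun h => hm (this.2 h))]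

lemma hasDerivAt_jet (hf : Integrable f) {χ η t : ℝ} (h : AgreesNear f (χ + η - 1) χ t) (k : ℕ) :
    HasDerivAt (fun s => jet f χ η s k) (jet f χ η t (k + 1)) t := by
  refine ((h.hasDerivAt_mom hf (k + 1)).const_mul _).congr_deriv ?_
  rw [jet, Nat.factorial_succ]
  push_cast
  ring

section position

variable {N : ℝ → ℝ} {q t : ℝ}

lemma sub_modelCurve_fst :
    t - (modelCurve N q t).1 = -((N t - (t - q)) * (t - q)) / wron N q t := by
  simp only [modelCurve]; ring

lemma sub_modelCurve_snd :
    t - ((modelCurve N q t).1 + (modelCurve N q t).2 - 1)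
      = -((N t - (t - q)) * N t) / wron N q t := by
  simp only [modelCurve]; ring

lemma modelCurve_snd_le_one (hW : wron N q t < 0) : (modelCurve N q t).2 ≤ 1 := by
  have := div_nonpos_of_nonneg_of_nonpos (sq_nonneg (N t - (t - q))) hW.le
  simp only [modelCurve]; linarith

lemma modelCurve_snd_lt_one (hW : wron N q t < 0) (hM : N t - (t - q) ≠ 0) :
    (modelCurve N q t).2 < 1 := by
  have := div_neg_of_pos_of_neg (pow_pos (abs_pos.2 hM) 2) hW
  rw [sq_abs] at this
  simp only [modelCurve]; linarith

end position

namespace IsModelAt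

variable {p q t : ℝ}

lemma eventually (h : IsModelAt μ a b f p q t) (hf : Integrable f) :
    ∀ᶠ s in 𝓝 t, IsModelAt μ a b f p q s := by
  have hW := (analyticAt_wron (q := q) (h.agrees.analyticAt_modelN hf)).continuousAt
  filter_upwards [h.agrees.eventually, hW.eventually_lt_const h.wron_neg,
    h.curve_eq.eventuallyEq_nhds] with s h1 h2 h3
  exact ⟨h.le, h1, h2, h3⟩

lemma analyticAt (h : IsModelAt μ a b f p q t) (hf : Integrable f) :
    AnalyticAt ℝ (modelN f p q) t := h.agrees.analyticAt_modelN hf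

lemma modelN_pos (hp : p < t) : 0 < modelN f p q t :=
  mul_pos (Real.exp_pos _) (by linarith)

lemma modelN_neg (hp : t < p) : modelN f p q t < 0 :=
  mul_neg_of_pos_of_neg (Real.exp_pos _) (by linarith)

lemma ne_right_of_eq_left (h : IsModelAt μ a b f p q t) (hp : t = p) : t ≠ q := by
  intro hq
  have h0 : modelN f p q t = 0 := by rw [modelN, hp, sub_self, mul_zero]
  have := h.wron_neg
  rw [wron, h0, hq, sub_self] at this
  simp at this

/-- The signs of `t - χ` and `t - χ₂`, where `(χ,η)` is the point of the edge and
`χ₂ = χ + η - 1`. -/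
lemma position (h : IsModelAt μ a b f p q t) {χ η : ℝ} (hγ : edgeCurve μ a b t = (χ, η)) :
    (t ∉ Icc p q → t ∉ Ioo (χ + η - 1) χ ∧
      (modelN f p q t - (t - q) ≠ 0 → t ∉ Icc (χ + η - 1) χ)) ∧
    (t ∈ Ioo p q → t ∈ Ioo (χ + η - 1) χ) ∧
    (t = q → t = χ ∧ χ + η - 1 < t) ∧ (t = p → t = χ + η - 1 ∧ t < χ) := by
  have hW := h.wron_neg
  have e := h.curve_eq.eq_of_nhds
  rw [hγ] at e
  have e1 := sub_modelCurve_fst (N := modelN f p q) (q := q) (t := t)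
  have e2 := sub_modelCurve_snd (N := modelN f p q) (q := q) (t := t)
  rw [← e] at e1 e2
  simp only at e1 e2
  set N := modelN f p q t with hN
  set W := wron (modelN f p q) q t with hWd
  have hle := h.le
  have f1 : t - χ = (N - (t - q)) * (t - q) / (-W) := by rw [e1, div_neg, neg_div]
  have f2 : t - (χ + η - 1) = (N - (t - q)) * N / (-W) := by rw [e2, div_neg, neg_div]
  have hW' : 0 < -W := by linarith
  refine ⟨fun ht => ?_, fun ht => ?_, fun ht => ?_, fun ht => ?_⟩
  -- Off [p,q] the numbers N and D have the same sign, hence (t-χ)(t-χ₂) = M²ND/W² is non-negative,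
  -- and positive if M ≠ 0.
  · have hND : 0 < N * (t - q) := by
      rw [mem_Icc, not_and_or, not_le, not_le] at ht
      rcases ht with ht | ht
      · exact mul_pos_of_neg_of_neg (modelN_neg ht) (by linarith)
      · exact mul_pos (modelN_pos (by linarith)) (by linarith)
    have hprod : (t - χ) * (t - (χ + η - 1)) = (N - (t - q)) ^ 2 * (N * (t - q)) / (-W) ^ 2 := by
      rw [f1, f2, div_mul_div_comm]; ring
    refine ⟨fun hm => ?_, fun hM hm => ?_⟩
    · have h1 : (t - χ) * (t - (χ + η - 1)) < 0 :=
        mul_neg_of_neg_of_pos (by linarith [hm.2]) (by linarith [hm.1])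
      rw [hprod] at h1
      exact absurd h1 (not_lt.2 (by positivity))
    · have h1 : (t - χ) * (t - (χ + η - 1)) ≤ 0 :=
        mul_nonpos_of_nonpos_of_nonneg (by linarith [hm.2]) (by linarith [hm.1])
      rw [hprod] at h1
      exact absurd h1 (not_le.2 (by positivity))
  -- Inside (p,q) one has N > 0 > D, so M > 0, and the signs of t-χ and t-χ₂ can be read off.
  · have hN0 : 0 < N := modelN_pos ht.1
    have hD0 : t - q < 0 := by linarith [ht.2]
    have h1 : t - χ < 0 := by
      rw [f1]
      exact div_neg_of_neg_of_pos (mul_neg_of_pos_of_neg (by linarith) hD0) hW'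
    have h2 : 0 < t - (χ + η - 1) := by
      rw [f2]
      exact div_pos (mul_pos (by linarith) hN0) hW'
    exact ⟨by linarith, by linarith⟩
  · have hpt : p < t := lt_of_le_of_ne (ht ▸ hle) fun hp => h.ne_right_of_eq_left hp.symm ht
    have hN0 : 0 < N := modelN_pos hpt
    have hD0 : t - q = 0 := by linarith
    rw [hD0] at f1 f2
    have h2 : 0 < t - (χ + η - 1) := by
      rw [f2]
      exact div_pos (mul_pos (by linarith) hN0) hW'
    have h1 : t - χ = 0 := by rw [f1, mul_zero, zero_div]
    exact ⟨by linarith, by linarith⟩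
  · have htq : t < q := lt_of_le_of_ne (ht ▸ hle) (h.ne_right_of_eq_left ht)
    have hN0 : N = 0 := by rw [hN, modelN, ht, sub_self, mul_zero]
    rw [hN0] at f1 f2
    have h2 : t - (χ + η - 1) = 0 := by rw [f2, mul_zero, zero_div]
    have h1 : t - χ < 0 := by
      rw [f1]
      have hD : t - q < 0 := by linarith
      exact div_neg_of_neg_of_pos (mul_neg_of_pos_of_neg (by linarith) hD) hW'
    exact ⟨by linarith, by linarith⟩

/-- The intervals [p,q] and [χ₂,χ] have the same trace on a punctured neighbourhood of t, by
`position`. So f is also the indicator of [χ₂,χ] near t, and t lies in the domain of f'_t. -/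
lemma agreesNear_edge (h : IsModelAt μ a b f p q t) {χ η : ℝ}
    (hγ : edgeCurve μ a b t = (χ, η)) : AgreesNear f (χ + η - 1) χ t := by
  obtain ⟨p1, p2, p3, p4⟩ := h.position hγ
  have hle := h.le
  have hη : η ≤ 1 := by
    have := modelCurve_snd_le_one h.wron_neg
    rwa [← h.curve_eq.eq_of_nhds, hγ] at this
  have evl : ∀ c, t < c → ∀ᶠ s in 𝓝[≠] t, s < c := fun c hc =>
    (eventually_lt_nhds hc).filter_mono nhdsWithin_le_nhds
  have evg : ∀ c, c < t → ∀ᶠ s in 𝓝[≠] t, c < s := fun c hc =>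
    (eventually_gt_nhds hc).filter_mono nhdsWithin_le_nhds
  have evne : ∀ᶠ s in 𝓝[≠] t, s ≠ t := self_mem_nhdsWithin
  have evout : ∀ c d : ℝ, t ∉ Icc c d → ∀ᶠ s in 𝓝[≠] t, s ∉ Icc c d := fun c d hcd =>
    mem_nhdsWithin_of_mem_nhds (isClosed_Icc.isOpen_compl.mem_nhds hcd)
  refine h.agrees.congr ?_
  by_cases hp : t = p
  · obtain ⟨e1, e2⟩ := p4 hp
    have htq : t < q := lt_of_le_of_ne (hp ▸ hle) (h.ne_right_of_eq_left hp)
    filter_upwards [evl q htq, evl χ e2] with s h1 h2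
    rw [mem_Icc, mem_Icc, ← hp, ← e1]
    exact ⟨fun h => ⟨h.1, h2.le⟩, fun h => ⟨h.1, h1.le⟩⟩
  by_cases hq : t = q
  · obtain ⟨e1, e2⟩ := p3 hq
    have hpt : p < t := lt_of_le_of_ne (hq ▸ hle) (Ne.symm hp)
    filter_upwards [evg p hpt, evg _ e2] with s h1 h2
    rw [mem_Icc, mem_Icc, ← hq, ← e1]
    rw [← e1] at h2
    exact ⟨fun h => ⟨h2.le, h.2⟩, fun h => ⟨h1.le, h.2⟩⟩
  by_cases hI : t ∈ Icc p q
  · have hI' : t ∈ Ioo p q := ⟨lt_of_le_of_ne hI.1 (Ne.symm hp), lt_of_le_of_ne hI.2 hq⟩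
    have hJ := p2 hI'
    filter_upwards [evg _ hI'.1, evl _ hI'.2, evg _ hJ.1, evl _ hJ.2] with s h1 h2 h3 h4
    exact iff_of_true ⟨h1.le, h2.le⟩ ⟨h3.le, h4.le⟩
  · obtain ⟨q1, q2⟩ := p1 hI
    by_cases hJ : t ∈ Icc (χ + η - 1) χ
    -- The exceptional case e^C = 1: here χ₂ = χ = t, and the interval is the null set {t}.
    · have hM : modelN f p q t - (t - q) = 0 := by
        by_contra hM; exact q2 hM hJ
      have e1 := sub_modelCurve_fst (N := modelN f p q) (q := q) (t := t)
      have e2 := sub_modelCurve_snd (N := modelN f p q) (q := q) (t := t)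
      rw [← h.curve_eq.eq_of_nhds, hγ, hM] at e1 e2
      simp only [zero_mul, neg_zero, zero_div] at e1 e2
      filter_upwards [evout p q hI, evne] with s h1 h2
      exact iff_of_false h1 fun h => h2 (le_antisymm (by linarith [h.2]) (by linarith [h.1]))
    · filter_upwards [evout p q hI, evout _ _ hJ] with s h1 h2
      exact iff_of_false h1 h2

lemma snd_le_one (h : IsModelAt μ a b f p q t) {χ η : ℝ} (hγ : edgeCurve μ a b t = (χ, η)) :
    η ≤ 1 := by
  have := modelCurve_snd_le_one h.wron_neg
  rwa [← h.curve_eq.eq_of_nhds, hγ] at this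

/-- Both sides express e^C near t, once through [χ₂,χ] and once through [p,q], with the denominators
cleared. If M ≠ 0, then t = χ₂ exactly when t = p, and t = χ exactly when t = q, so the comparison
extends to t itself. -/
lemma exp_jet_eq (h : IsModelAt μ a b f p q t) (hf : Integrable f) {χ η : ℝ}
    (hγ : edgeCurve μ a b t = (χ, η)) (hM : modelN f p q t - (t - q) ≠ 0) :
    ∀ᶠ w in 𝓝 t, Real.exp (jet f χ η w 0) * ((w - q) * (w - (χ + η - 1)))
      = modelN f p q w * (w - χ) := by
  have hη := h.snd_le_one hγ
  obtain ⟨p1, p2, p3, p4⟩ := h.position hγ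
  have hI : t ∈ Icc (χ + η - 1) χ → t ∈ Icc p q := fun hJ => by
    by_contra hI
    exact (p1 hI).2 hM hJ
  have c1 : t = χ + η - 1 → t = p := fun e => by
    have h1 := hI ⟨e.ge, by linarith⟩
    by_contra hp
    by_cases hq : t = q
    · exact absurd e (p3 hq).2.ne'
    · exact absurd e (p2 ⟨lt_of_le_of_ne h1.1 (Ne.symm hp), lt_of_le_of_ne h1.2 hq⟩).1.ne'
  have c2 : t = χ → t = q := fun e => by
    have h1 := hI ⟨by linarith, e.le⟩
    by_contra hq
    by_cases hp : t = p
    · exact absurd e (p4 hp).2.ne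
    · exact absurd e (p2 ⟨lt_of_le_of_ne h1.1 (Ne.symm hp), lt_of_le_of_ne h1.2 hq⟩).2.ne
  filter_upwards [eventually_modelN_mul_eq hf (by linarith) h.le (h.agreesNear_edge hγ) h.agrees c1
    c2 (fun hp => (p4 hp).1) (fun hq => (p3 hq).1)] with s hs
  simp only [jet, pow_zero, Nat.factorial_zero, Nat.cast_one, one_mul, zero_add]
  rw [← hs, modelN]
  ring

/-- The properties of the roots of `f'` at a parameter where neither `e^C` nor its inverse vanishes
and `e^C ≠ 1`. -/
lemma simple (h : IsModelAt μ a b f p q t) (hf : IsDensity μ a b f) {χ η : ℝ}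
    (hγ : edgeCurve μ a b t = (χ, η)) (hM : modelN f p q t - (t - q) ≠ 0) (hp : t ≠ p)
    (hq : t ≠ q) :
    jet f χ η t 0 = 0 ∧ jet f χ η t 1 = 0 ∧ (jet f χ η t 2 = 0 → jet f χ η t 3 ≠ 0) ∧
    (speed (modelN f p q) q t = -((t - q) * (modelN f p q t - (t - q)) * modelN f p q t
      / wron (modelN f p q) q t ^ 2) * jet f χ η t 2) ∧
    (jet f χ η t 2 = 0 → deriv (speed (modelN f p q) q) t
      = -((t - q) * (modelN f p q t - (t - q)) * modelN f p q t
        / wron (modelN f p q) q t ^ 2) * jet f χ η t 3) ∧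
    χ < b ∧ a < χ + η - 1 ∧ 0 < η ∧ η < 1 ∧ (jet f χ η t 2 = 0 → t ∈ Ioo a b) := by
  have hA := h.agreesNear_edge hγ
  have hη := h.snd_le_one hγ
  have hle : χ + η - 1 ≤ χ := by linarith
  have hη1 : η < 1 := by
    have := modelCurve_snd_lt_one h.wron_neg hM
    rwa [← h.curve_eq.eq_of_nhds, hγ] at this
  have e1 := sub_modelCurve_fst (N := modelN f p q) (q := q) (t := t)
  have e2 := sub_modelCurve_snd (N := modelN f p q) (q := q) (t := t)
  rw [← h.curve_eq.eq_of_nhds, hγ] at e1 e2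
  simp only at e1 e2
  obtain ⟨j0, j1, k0, k1⟩ := speed_eq_of_simple (h := fun s => jet f χ η s 0)
    (h₁ := fun s => jet f χ η s 1) (h₂ := fun s => jet f χ η s 2) (h.analyticAt hf.integrable)
    h.wron_neg.ne
    (hA.eventually.mono fun s hs => hasDerivAt_jet hf.integrable hs 0)
    (hA.eventually.mono fun s hs => hasDerivAt_jet hf.integrable hs 1)
    (hasDerivAt_jet hf.integrable hA 2) (h.exp_jet_eq hf.integrable hγ hM) e1 e2
    (sub_ne_zero.2 hq) (modelN_ne_zero hp) hM
  have m1 := jet_eq_zero_iff.1 j0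
  have m2 := jet_eq_zero_iff.1 j1
  simp only [zero_add, Nat.reduceAdd] at m1 m2
  have hb : χ < b := hf.lt_right hle hA (by rw [m1, m2]; ring)
  have ha : a < χ + η - 1 := hf.left_lt hle hA (by rw [m1, m2]; ring)
  -- With m₁ = m₂ = 0 the relation for n = 0 reduces to m₀ = η > 0, and the one for n = 2 forbids m₃
  -- = m₄ = 0.
  have q0 := hf.quad_pos hle hA (n := 0) (by norm_num)
  have q2 := hf.quad_pos hle hA (n := 2) (by norm_num)
  simp only [zero_add, Nat.reduceAdd] at q0 q2
  rw [hf.integral_res hle t, m1, m2] at q0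
  refine ⟨j0, j1, fun j2 j3 => ?_, k0, k1, hb, ha, by linarith, hη1, fun j2 => ⟨?_, ?_⟩⟩
  · rw [m2, jet_eq_zero_iff.1 j2, jet_eq_zero_iff.1 j3] at q2
    simp at q2
  · by_contra hcon
    have := hf.neg_quad_pos_of_le hle hA (by linarith) (not_lt.1 hcon) (n := 1) odd_one
    simp only [Nat.reduceAdd] at this
    rw [m1, m2, jet_eq_zero_iff.1 j2] at this
    simp at this
  · by_contra hcon
    have := hf.quad_pos_of_le hle hA (by linarith) (not_lt.1 hcon) 1
    simp only [Nat.reduceAdd] at this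
    rw [m1, m2, jet_eq_zero_iff.1 j2] at this
    simp at this

/-- The properties of the roots of `f'` at a parameter where `e^C` or its inverse vanishes. -/
lemma double (h : IsModelAt μ a b f p q t) (hf : IsDensity μ a b f) {χ η : ℝ}
    (hγ : edgeCurve μ a b t = (χ, η)) (hpq : t = p ∨ t = q) :
    jet f χ η t 0 = 0 ∧ (jet f χ η t 1 = 0 → jet f χ η t 2 ≠ 0) ∧
    speed (modelN f p q) q t = 2 * ((t - q) + (t - (χ + η - 1))) / wron (modelN f p q) q t
      * jet f χ η t 1 ∧
    (jet f χ η t 1 = 0 → deriv (speed (modelN f p q) q) t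
      = 3 * ((t - q) + (t - (χ + η - 1))) / wron (modelN f p q) q t * jet f χ η t 2) ∧
    (t = q → a < χ + η - 1) ∧ (t = p → χ < b) ∧ 0 < η ∧ η < 1 := by
  have hA := h.agreesNear_edge hγ
  have hη := h.snd_le_one hγ
  have hle : χ + η - 1 ≤ χ := by linarith
  obtain ⟨-, -, p3, p4⟩ := h.position hγ
  have hW := h.wron_neg
  have hM : modelN f p q t - (t - q) ≠ 0 := by
    rcases hpq with hp | hq
    · rw [modelN, hp, sub_self, mul_zero, zero_sub, neg_ne_zero, sub_ne_zero, ← hp]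
      exact h.ne_right_of_eq_left hp
    · rw [hq, sub_self, sub_zero, ← hq]
      exact modelN_ne_zero fun hp => h.ne_right_of_eq_left hp hq
  have hη1 : η < 1 := by
    have := modelCurve_snd_lt_one h.wron_neg hM
    rwa [← h.curve_eq.eq_of_nhds, hγ] at this
  have e1 := sub_modelCurve_fst (N := modelN f p q) (q := q) (t := t)
  have e2 := sub_modelCurve_snd (N := modelN f p q) (q := q) (t := t)
  rw [← h.curve_eq.eq_of_nhds, hγ] at e1 e2
  simp only at e1 e2
  obtain ⟨j0, k0, k1⟩ := speed_eq_of_double (h := fun s => jet f χ η s 0)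
    (h₁ := fun s => jet f χ η s 1) (h₂ := fun s => jet f χ η s 2) (h.analyticAt hf.integrable)
    h.wron_neg.ne
    (hA.eventually.mono fun s hs => hasDerivAt_jet hf.integrable hs 0)
    (hA.eventually.mono fun s hs => hasDerivAt_jet hf.integrable hs 1)
    (hasDerivAt_jet hf.integrable hA 2) (h.exp_jet_eq hf.integrable hγ hM) e1 e2
    (by
      rcases hpq with hp | hq
      · rw [← (p4 hp).1, sub_self, mul_zero]
      · rw [← hq, sub_self, zero_mul])
    (by
      rcases hpq with hp | hq
      · rw [← (p4 hp).1, sub_self, add_zero, sub_ne_zero]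
        exact h.ne_right_of_eq_left hp
      · rw [← hq, sub_self, zero_add, sub_ne_zero]
        exact (p3 hq).2.ne')
  have m1 := jet_eq_zero_iff.1 j0
  simp only [zero_add] at m1
  -- The leading coefficient of the quadratic relation vanishes, so for n = 2 already m₂ and m₃
  -- cannot both be zero: the bound on the multiplicity drops by one.
  have huv : (t - χ) * (t - (χ + η - 1)) = 0 := by
    rcases hpq with hp | hq
    · rw [← (p4 hp).1, sub_self, mul_zero]
    · rw [← (p3 hq).1, sub_self, zero_mul]
  have q0 := hf.quad_pos hle hA (n := 0) (by norm_num)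
  have q2 := hf.quad_pos hle hA (n := 2) (by norm_num)
  simp only [zero_add, Nat.reduceAdd] at q0 q2
  rw [hf.integral_res hle t, m1, huv] at q0
  rw [huv] at q2
  refine ⟨j0, fun j1 j2 => ?_, k0, k1, fun hq => ?_, fun hp => ?_, by linarith, hη1⟩
  · rw [jet_eq_zero_iff.1 j1, jet_eq_zero_iff.1 j2] at q2
    simp at q2
  · refine hf.left_lt hle hA ?_
    rw [m1, ← (p3 hq).1]; ring
  · refine hf.lt_right hle hA ?_
    rw [m1, ← (p4 hp).1]; ring

end IsModelAt

variable {μ : Measure ℝ} {a b : ℝ} {f : ℝ → ℝ}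

/-! ### The local shape of the edge, for each class of parameters -/

section disjoint

variable [IsProbabilityMeasure μ] {t : ℝ}

lemma IsDensity.notMem_RCoMu (hf : IsDensity μ a b f) (ht : t ∉ μ.support) : t ∉ RCoMu μ :=
  fun h => ht (hf.mem_support_of_notMem_co h)

lemma IsDensity.notMem_ROne (hf : IsDensity μ a b f)
    (ht : t ∉ μ.support ∨ t ∉ (coMeasure μ).support) : t ∉ ROne μ := fun ⟨_, hI⟩ =>
  ht.elim (fun h => h (hf.mem_support_of_isGapOne hI).1)
    (fun h => h (hf.mem_support_of_isGapOne hI).2)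

lemma IsDensity.notMem_RTwo (hf : IsDensity μ a b f)
    (ht : t ∉ μ.support ∨ t ∉ (coMeasure μ).support) : t ∉ RTwo μ := fun ⟨_, hI⟩ =>
  ht.elim (fun h => h (hf.mem_support_of_isGapTwo hI).1)
    (fun h => h (hf.mem_support_of_isGapTwo hI).2)

lemma IsDensity.notMem_RTwo_of_mem_ROne (hf : IsDensity μ a b f) (ht : t ∈ ROne μ) :
    t ∉ RTwo μ := fun ⟨_, hJ⟩ => hf.not_isGapOne_and_isGapTwo ht.choose_spec hJ

lemma IsDensity.xVec_eq (hf : IsDensity μ a b f)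
    (ht : t ∉ μ.support ∨ t ∉ (coMeasure μ).support) : xVec μ a b t = (1, expC μ a b t - 1) := by
  rw [xVec, if_neg (hf.notMem_ROne ht), if_neg (hf.notMem_RTwo ht)]

lemma IsDensity.yVec_eq (hf : IsDensity μ a b f)
    (ht : t ∉ μ.support ∨ t ∉ (coMeasure μ).support) : yVec μ a b t = (expC μ a b t - 1, -1) := by
  rw [yVec, if_neg (hf.notMem_ROne ht), if_neg (hf.notMem_RTwo ht)]

end disjoint

lemma mem_shape_of {χ η : ℝ} (h1 : a ≤ χ + η - 1) (h2 : χ ≤ b) (h3 : 0 ≤ η) (h4 : η ≤ 1) :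
    (χ, η) ∈ shape a b :=
  ⟨⟨by linarith, h2⟩, ⟨h3, h4⟩, h2, by simp only; linarith, h1⟩

lemma mem_interior_shape {p : ℝ × ℝ} (h1 : a < p.1 + p.2 - 1) (h2 : p.1 < b) (h3 : 0 < p.2)
    (h4 : p.2 < 1) : p ∈ interior (shape a b) := by
  have ho : IsOpen {p : ℝ × ℝ | (a < p.1 + p.2 - 1 ∧ p.1 < b) ∧ 0 < p.2 ∧ p.2 < 1} := by
    refine IsOpen.and (IsOpen.and ?_ ?_) (IsOpen.and ?_ ?_) <;>
      exact isOpen_lt (by fun_prop) (by fun_prop)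
  exact interior_maximal
    (fun p hp => mem_shape_of hp.1.1.le hp.1.2.le hp.2.1.le hp.2.2.le) ho ⟨⟨h1, h2⟩, h3, h4⟩

lemma isDiscrete_of_eventually_notMem {S : Set ℝ} (h : ∀ t ∈ S, ∀ᶠ s in 𝓝[≠] t, s ∉ S) :
    IsDiscrete S :=
  isDiscrete_iff_nhdsNE.2 fun t ht => inf_principal_eq_bot.2 (h t ht)

/-! ### Parabolas, cusps and multiplicities read off from a model -/

namespace IsModelAt

variable {p q t : ℝ}

/-- Common dichotomy for all classes: j is the first derivative of f'_t not forced to vanish and k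
the next one. The speed is a non-zero multiple of j, and for j = 0 its derivative is a non-zero
multiple of k, so j decides between parabola and cusp. In the cusp case the bound on the
multiplicity supplies k ≠ 0. -/
lemma expansion (h : IsModelAt μ a b f p q t) (hf : Integrable f) {x y : ℝ × ℝ} {ρ σ : ℝ}
    (hσ : σ ≠ 0) (hx1 : t - q = ρ * x.1) (hx2 : modelN f p q t - (t - q) = ρ * x.2)
    (hy1 : y.1 = σ * x.2) (hy2 : y.2 = -σ * x.1) {c e j k : ℝ}
    (hs : speed (modelN f p q) q t = c * j)
    (hd : j = 0 → deriv (speed (modelN f p q) q) t = e * k)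
    (hc : c ≠ 0) (he : e ≠ 0) (hk : j = 0 → k ≠ 0) :
    ∃ a₁ a₂ b₁ b₂ : ℝ, HasExpansion (edgeCurve μ a b) t x y a₁ a₂ b₁ b₂ ∧
      (j ≠ 0 → a₁ = c * ρ * j ∧
        b₁ = -(c * wron (modelN f p q) q t) / (2 * (ρ * σ * (x.1 ^ 2 + x.2 ^ 2))) * j ∧
        IsParabolic (edgeCurve μ a b) t x a₁ b₁) ∧
      (j = 0 → a₂ = e * ρ / 2 * k ∧
        b₂ = -(e * wron (modelN f p q) q t) / (3 * (ρ * σ * (x.1 ^ 2 + x.2 ^ 2))) * k ∧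
        IsFirstOrderCusp a₁ a₂ b₁ b₂) := by
  have hN := h.analyticAt hf
  have hW := h.wron_neg
  obtain ⟨a₂, b₂, hexp, hcusp⟩ := hasExpansion_modelCurve h.curve_eq hN hW.ne hσ hx1 hx2 hy1 hy2
  have hρ : ρ ≠ 0 := by
    rintro rfl
    have h1 : t - q = 0 := by simpa using hx1
    have h2 : modelN f p q t = 0 := by simpa [h1] using hx2
    rw [wron, h1, h2] at hW
    simp at hW
  have hr : x.1 ^ 2 + x.2 ^ 2 ≠ 0 := by
    intro h0
    have h1 : x.1 = 0 := by nlinarith [sq_nonneg x.1, sq_nonneg x.2]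
    have h2 : x.2 = 0 := by nlinarith [sq_nonneg x.1, sq_nonneg x.2]
    rw [h1, mul_zero] at hx1
    rw [hx1, h2, mul_zero, sub_zero] at hx2
    rw [wron, hx1, hx2] at hW
    simp at hW
  have hden : ∀ n : ℝ, n ≠ 0 → n * (ρ * σ * (x.1 ^ 2 + x.2 ^ 2)) ≠ 0 := fun n hn =>
    mul_ne_zero hn (mul_ne_zero (mul_ne_zero hρ hσ) hr)
  refine ⟨_, a₂, _, b₂, hexp, fun hj => ⟨by rw [hs]; ring, by rw [hs]; ring, ?_, ?_, ?_, ?_⟩,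
    fun hj => ?_⟩
  · rw [hs]; exact mul_ne_zero (mul_ne_zero hc hj) hρ
  · rw [hs]
    exact div_ne_zero (neg_ne_zero.2 (mul_ne_zero (mul_ne_zero hc hj) hW.ne)) (hden 2 two_ne_zero)
  · exact hasDerivAt_modelCurve h.curve_eq hN hW.ne hx1 hx2
  · exact curvature_neg h.curve_eq hN hW (by rw [hs]; exact mul_ne_zero hc hj)
  · have hs0 : speed (modelN f p q) q t = 0 := by rw [hs, hj, mul_zero]
    obtain ⟨e1, e2⟩ := hcusp hs0
    have hek := mul_ne_zero he (hk hj)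
    rw [hd hj] at e1 e2
    refine ⟨by rw [e1]; ring, by rw [e2]; ring, by rw [hs0, zero_mul],
      by rw [hs0]; simp, ?_, ?_⟩
    · rw [e1]; exact div_ne_zero (mul_ne_zero hek hρ) two_ne_zero
    · rw [e2]
      exact div_ne_zero (neg_ne_zero.2 (mul_ne_zero hek hW.ne)) (hden 3 three_ne_zero)

lemma contDiffAt_edgeCurve (h : IsModelAt μ a b f p q t) (hf : Integrable f) :
    ContDiffAt ℝ ∞ (edgeCurve μ a b) t :=
  (contDiffAt_modelCurve (h.analyticAt hf) h.wron_neg.ne).congr_of_eventuallyEq h.curve_eq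

variable [IsProbabilityMeasure μ]

lemma fDer_eq_jet (h : IsModelAt μ a b f p q t) (hf : IsDensity μ a b f) {χ η : ℝ}
    (hγ : edgeCurve μ a b t = (χ, η)) (k : ℕ) : fDer μ a b t k = jet f χ η t k := by
  rw [fDer, hγ, hf.iteratedDeriv_fPrime (h.snd_le_one hγ) (h.agreesNear_edge hγ) k,
    Complex.ofReal_re]

lemma fDer_eq (h : IsModelAt μ a b f p q t) (hf : IsDensity μ a b f) (k : ℕ) :
    fDer μ a b t k = jet f (edgeCurve μ a b t).1 (edgeCurve μ a b t).2 t k :=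
  h.fDer_eq_jet hf (Prod.mk.eta).symm k

lemma hasMult_iff (h : IsModelAt μ a b f p q t) (hf : IsDensity μ a b f) {m : ℕ} (hm : 1 ≤ m) :
    HasMult μ a b t m ↔ (∀ k < m, fDer μ a b t k = 0) ∧ fDer μ a b t m ≠ 0 := by
  obtain ⟨⟨χ, η⟩, hγ⟩ : ∃ z, edgeCurve μ a b t = z := ⟨_, rfl⟩
  simp only [h.fDer_eq_jet hf hγ]
  rw [HasMult, hγ]
  exact hf.isRootOfMult_iff (h.snd_le_one hγ) (h.agreesNear_edge hγ) hm

lemma isRoot_iff (h : IsModelAt μ a b f p q t) (hf : IsDensity μ a b f) :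
    IsRoot μ a b (edgeCurve μ a b t) t ↔ fDer μ a b t 0 = 0 := by
  obtain ⟨⟨χ, η⟩, hγ⟩ : ∃ z, edgeCurve μ a b t = z := ⟨_, rfl⟩
  rw [h.fDer_eq_jet hf hγ, hγ]
  exact hf.isRoot_iff (h.snd_le_one hγ) (h.agreesNear_edge hγ)

lemma hasMult_one_iff (h : IsModelAt μ a b f p q t) (hf : IsDensity μ a b f)
    (h0 : fDer μ a b t 0 = 0) : HasMult μ a b t 1 ↔ fDer μ a b t 1 ≠ 0 := by
  have := h.hasMult_iff hf (m := 1) le_rfl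
  rw [Nat.cast_one] at this
  rw [this]
  exact and_iff_right fun k hk => (Nat.lt_one_iff.1 hk) ▸ h0

lemma hasMult_two_iff (h : IsModelAt μ a b f p q t) (hf : IsDensity μ a b f)
    (h0 : fDer μ a b t 0 = 0) :
    HasMult μ a b t 2 ↔ fDer μ a b t 1 = 0 ∧ fDer μ a b t 2 ≠ 0 := by
  have := h.hasMult_iff hf (m := 2) one_le_two
  rw [Nat.cast_ofNat] at this
  rw [this]
  refine and_congr_left fun _ => ⟨fun h' => h' 1 one_lt_two, fun h1 k hk => ?_⟩
  interval_cases k <;> assumption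

lemma hasMult_three_iff (h : IsModelAt μ a b f p q t) (hf : IsDensity μ a b f)
    (h0 : fDer μ a b t 0 = 0) (h1 : fDer μ a b t 1 = 0) :
    HasMult μ a b t 3 ↔ fDer μ a b t 2 = 0 ∧ fDer μ a b t 3 ≠ 0 := by
  have := h.hasMult_iff hf (m := 3) (by norm_num)
  rw [Nat.cast_ofNat] at this
  rw [this]
  refine and_congr_left fun _ => ⟨fun h' => h' 2 (by norm_num), fun h2 k hk => ?_⟩
  interval_cases k <;> assumption

/-- The edge at a parameter outside one of the supports, if `e^C ≠ 1`. -/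
lemma edge_simple (h : IsModelAt μ a b f p q t) (hf : IsDensity μ a b f) (hp : t ≠ p) (hq : t ≠ q)
    (ht : t ∉ μ.support ∨ t ∉ (coMeasure μ).support) (hE : expC μ a b t ≠ 1) :
    edgeCurve μ a b t ∈ interior (shape a b) ∧ fDer μ a b t 0 = 0 ∧ fDer μ a b t 1 = 0 ∧
    (fDer μ a b t 2 = 0 → fDer μ a b t 3 ≠ 0) ∧
    ∃ a₁ a₂ b₁ b₂ : ℝ,
      HasExpansion (edgeCurve μ a b) t (xVec μ a b t) (yVec μ a b t) a₁ a₂ b₁ b₂ ∧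
      (fDer μ a b t 2 ≠ 0 →
        a₁ = -((expC μ a b t - 1) / (expC μ a b t * derivC μ a b t ^ 2)) * fDer μ a b t 2 ∧
        b₁ = 1 / 2 * ((expC μ a b t - 1) / (derivC μ a b t * (1 + (expC μ a b t - 1) ^ 2)))
          * fDer μ a b t 2 ∧
        IsParabolic (edgeCurve μ a b) t (xVec μ a b t) a₁ b₁) ∧
      (fDer μ a b t 2 = 0 →
        a₂ = -(1 / 2) * ((expC μ a b t - 1) / (expC μ a b t * derivC μ a b t ^ 2))
          * fDer μ a b t 3 ∧
        b₂ = 1 / 3 * ((expC μ a b t - 1) / (derivC μ a b t * (1 + (expC μ a b t - 1) ^ 2)))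
          * fDer μ a b t 3 ∧
        IsFirstOrderCusp a₁ a₂ b₁ b₂) := by
  obtain ⟨e1, e2⟩ := hf.expC_mul_and_derivC h.le h.agrees hp hq ht
  have hD := sub_ne_zero.2 hq
  have hN := modelN_ne_zero (f := f) (q := q) hp
  have hW := h.wron_neg.ne
  rw [hf.xVec_eq ht, hf.yVec_eq ht]
  rw [← e1] at hN e2
  -- So (D,M) = D·(1, e^C - 1), which identifies the tangent vector and gives ρ = t - q.
  have hM : modelN f p q t - (t - q) = (t - q) * (expC μ a b t - 1) := by rw [← e1]; ring
  have hE0 := left_ne_zero_of_mul hN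
  have hE1 := sub_ne_zero.2 hE
  have hM0 : modelN f p q t - (t - q) ≠ 0 := by rw [hM]; exact mul_ne_zero hD hE1
  obtain ⟨j0, j1, j23, k0, k1, hb, ha, h0, h1, -⟩ := h.simple hf (Prod.mk.eta).symm hM0 hp hq
  simp only [← h.fDer_eq hf] at j0 j1 j23 k0 k1
  refine ⟨mem_interior_shape ha hb h0 h1, j0, j1, j23, ?_⟩
  have hc : -((t - q) * (modelN f p q t - (t - q)) * modelN f p q t
      / wron (modelN f p q) q t ^ 2) ≠ 0 := by
    refine neg_ne_zero.2 (div_ne_zero (mul_ne_zero (mul_ne_zero hD hM0) ?_) (pow_ne_zero 2 hW))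
    rwa [← e1]
  obtain ⟨a₁, a₂, b₁, b₂, hexp, hpar, hcusp⟩ := h.expansion hf.integrable
    (x := (1, expC μ a b t - 1)) (y := (expC μ a b t - 1, -1)) (ρ := t - q) (σ := 1) one_ne_zero
    (by simp) (by simpa using hM) (by simp) (by simp) k0 k1 hc hc j23
  rw [hM, ← e1] at hpar hcusp
  have hr : (1 : ℝ) + (expC μ a b t - 1) ^ 2 ≠ 0 := by positivity
  refine ⟨a₁, a₂, b₁, b₂, hexp, fun hj => ?_, fun hj => ?_⟩
  · obtain ⟨g1, g2, g3⟩ := hpar hj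
    refine ⟨?_, ?_, g3⟩
    · rw [g1, e2]; field_simp
    · rw [g2, e2]; simp only [one_pow, mul_one]; field_simp
  · obtain ⟨g1, g2, g3⟩ := hcusp hj
    refine ⟨?_, ?_, g3⟩
    · rw [g1, e2]; field_simp
    · rw [g2, e2]; simp only [one_pow, mul_one]; field_simp

lemma mem_Ioo_of_fDer_two_eq_zero (h : IsModelAt μ a b f p q t) (hf : IsDensity μ a b f)
    (hM : modelN f p q t - (t - q) ≠ 0) (hp : t ≠ p) (hq : t ≠ q) (h2 : fDer μ a b t 2 = 0) :
    t ∈ Ioo a b := by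
  rw [h.fDer_eq hf] at h2
  exact (h.simple hf (Prod.mk.eta).symm hM hp hq).2.2.2.2.2.2.2.2.2 h2

/-- Since the function f'_s itself moves with s, its derivative cannot be followed directly. It is,
however, the speed of the curve up to a non-zero factor, and the speed is analytic with a simple
zero at t. -/
lemma eventually_fDer_two_ne_zero (h : IsModelAt μ a b f p q t) (hf : IsDensity μ a b f)
    (hM : modelN f p q t - (t - q) ≠ 0) (hp : t ≠ p) (hq : t ≠ q) (h2 : fDer μ a b t 2 = 0) :
    ∀ᶠ s in 𝓝[≠] t, fDer μ a b s 2 ≠ 0 := by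
  rw [h.fDer_eq hf] at h2
  have hN := h.analyticAt hf.integrable
  obtain ⟨-, -, j3, k0, k1, -⟩ := h.simple hf (Prod.mk.eta).symm hM hp hq
  rw [h2, mul_zero] at k0
  have hk : deriv (speed (modelN f p q) q) t ≠ 0 := by
    rw [k1 h2]
    refine mul_ne_zero (neg_ne_zero.2 (div_ne_zero ?_ (pow_ne_zero 2 h.wron_neg.ne))) (j3 h2)
    exact mul_ne_zero (mul_ne_zero (sub_ne_zero.2 hq) hM) (modelN_ne_zero hp)
  have hne := (analyticAt_speed hN h.wron_neg.ne).differentiableAt.hasDerivAt.eventually_ne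
    (c := 0) hk
  have hMc : ContinuousAt (fun s => modelN f p q s - (s - q)) t :=
    hN.continuousAt.sub (by fun_prop)
  filter_upwards [hne, (h.eventually hf.integrable).filter_mono nhdsWithin_le_nhds,
    (hMc.eventually_ne hM).filter_mono nhdsWithin_le_nhds,
    (continuousAt_id.eventually_ne hp).filter_mono nhdsWithin_le_nhds,
    (continuousAt_id.eventually_ne hq).filter_mono nhdsWithin_le_nhds] with s s1 s2 s3 s4 s5 s6
  rw [s2.fDer_eq hf] at s6
  refine s1 ?_
  rw [(s2.simple hf (Prod.mk.eta).symm s3 s4 s5).2.2.2.1, s6, mul_zero]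

end IsModelAt

variable {μ : Measure ℝ} {a b : ℝ} {f : ℝ → ℝ}

namespace IsDensity

variable {t : ℝ}

lemma hasDerivAt_cauchy (hf : IsDensity μ a b f) (ht : t ∉ μ.support) :
    HasDerivAt (cauchy μ) (-∫ y : ℝ, 1 / (t - y) ^ 2 ∂μ) t ∧
      0 < ∫ y : ℝ, 1 / (t - y) ^ 2 ∂μ := by
  obtain ⟨r, hr, hG⟩ := hf.exists_gapModel_of_notMem ht
  have ht' : t ∈ Ioo (t - r) (t + r) := ⟨by linarith, by linarith⟩
  have e : ∫ y : ℝ, 1 / (t - y) ^ 2 ∂μ = mom ℝ (res f (t + r) (t + r)) 2 t := by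
    rw [mom_congr_ae (res_self_ae f (t + r)), hf.integral_eq, mom]
    simp
  rw [e, hf.cauchy_eq (t + r)]
  exact ⟨by simpa using (hG.agreesNear ht').hasDerivAt_mom hf.integrable 1, hf.mom_two_pos hG ht'⟩

variable [IsProbabilityMeasure μ]

/-! ### Parameters outside the support of `μ` -/

lemma exists_isModelAt_of_mem_RMu (hf : IsDensity μ a b f) (ht : t ∈ RMu μ) :
    ∃ c, t < c ∧ IsModelAt μ a b f c c t ∧ expC μ a b t ≠ 1 ∧ modelN f c c t - (t - c) ≠ 0 := by
  obtain ⟨c, hc, h⟩ := hf.exists_isModelAt_of_notMem ht.1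
  have hE : expC μ a b t ≠ 1 := by
    rw [expC, if_pos ht.1, Ne, Real.exp_eq_one_iff]
    exact ht.2
  refine ⟨c, hc, h, hE, ?_⟩
  rw [← (hf.expC_mul_and_derivC le_rfl h.agrees hc.ne hc.ne (Or.inl ht.1)).1, ← sub_one_mul]
  exact mul_ne_zero (sub_ne_zero.2 hE) (sub_ne_zero.2 hc.ne)

lemma edgeCase_iff_of_mem_RMu (hf : IsDensity μ a b f) (ht : t ∈ RMu μ) (k : ℕ) :
    EdgeCase μ a b t k ↔ (k = 1 ∧ fDer μ a b t 2 ≠ 0) ∨ (k = 2 ∧ fDer μ a b t 2 = 0) := by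
  obtain ⟨c, hc, h, hE, hM⟩ := hf.exists_isModelAt_of_mem_RMu ht
  obtain ⟨hS, h0, h1, h23, -⟩ := h.edge_simple hf hc.ne hc.ne (Or.inl ht.1) hE
  have m2 : HasMult μ a b t 2 ↔ fDer μ a b t 2 ≠ 0 := by simp [h.hasMult_two_iff hf h0, h1]
  have m3 : HasMult μ a b t 3 ↔ fDer μ a b t 2 = 0 := by
    rw [h.hasMult_three_iff hf h0 h1]; exact and_iff_left_of_imp h23
  have he : edgeCurve μ a b t ∈ edgeMu μ a b := by
    refine ⟨interior_subset hS, t, ((h.position (Prod.mk.eta).symm).1 ?_).2 hM, ?_⟩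
    · exact fun h' => hc.not_ge h'.1
    · by_cases hz : fDer μ a b t 2 = 0
      · exact ⟨3, by norm_num, m3.2 hz⟩
      · exact ⟨2, le_rfl, m2.2 hz⟩
  have n1 := hf.notMem_RCoMu ht.1
  have n2 := hf.notMem_ROne (Or.inl ht.1)
  have n3 := hf.notMem_RTwo (Or.inl ht.1)
  have n4 : t ∉ RZero μ := fun h => ht.2 h.2
  rcases k with _ | _ | _ | _ | _ | _ | _ | _ | _ | _ | k <;>
    simp [EdgeCase, he, ht, n1, n2, n3, n4, m2, m3]

lemma isDiscrete_RMu_mult_three (hf : IsDensity μ a b f) :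
    {t | t ∈ RMu μ ∧ HasMult μ a b t 3} ⊆ Ioo a b ∧
      IsDiscrete {t | t ∈ RMu μ ∧ HasMult μ a b t 3} := by
  have key : ∀ t ∈ {t | t ∈ RMu μ ∧ HasMult μ a b t 3}, fDer μ a b t 2 = 0 := by
    rintro t ⟨ht, h3⟩
    obtain ⟨c, hc, h, -⟩ := hf.exists_isModelAt_of_mem_RMu ht
    exact ((h.hasMult_iff hf (m := 3) (by norm_num)).1 h3).1 2 (by norm_num)
  refine ⟨fun t ht => ?_, isDiscrete_of_eventually_notMem fun t ht => ?_⟩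
  · obtain ⟨c, hc, h, -, hM⟩ := hf.exists_isModelAt_of_mem_RMu ht.1
    exact h.mem_Ioo_of_fDer_two_eq_zero hf hM hc.ne hc.ne (key t ht)
  · obtain ⟨c, hc, h, -, hM⟩ := hf.exists_isModelAt_of_mem_RMu ht.1
    filter_upwards [h.eventually_fDer_two_ne_zero hf hM hc.ne hc.ne (key t ht)] with s hs hs'
    exact hs (key s hs')

/-! ### Parameters outside the support of `λ - μ` -/

/-- Inside the gap N > 0 > D, so e^C is negative and the exceptional value 1 does not occur. -/
lemma exists_isModelAt_of_mem_RCoMu (hf : IsDensity μ a b f) (ht : t ∈ RCoMu μ) :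
    ∃ p q, t ∈ Ioo p q ∧ IsModelAt μ a b f p q t ∧ expC μ a b t ≠ 1 ∧
      modelN f p q t - (t - q) ≠ 0 := by
  obtain ⟨⟨p, q⟩, hI⟩ := hf.exists_isCoGap ht
  have hpq : t ∈ Ioo p q := hI.1
  have h : IsModelAt μ a b f p q t := hf.isModelAt_of_isCoGap hI
  have hN : 0 < modelN f p q t := IsModelAt.modelN_pos hpq.1
  refine ⟨p, q, hpq, h, fun hE => ?_, by linarith [hpq.2]⟩
  have := (hf.expC_mul_and_derivC h.le h.agrees hpq.1.ne' hpq.2.ne (Or.inr ht)).1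
  rw [hE] at this
  linarith [hpq.2]

lemma edgeCase_iff_of_mem_RCoMu (hf : IsDensity μ a b f) (ht : t ∈ RCoMu μ) (k : ℕ) :
    EdgeCase μ a b t k ↔ (k = 3 ∧ fDer μ a b t 2 ≠ 0) ∨ (k = 4 ∧ fDer μ a b t 2 = 0) := by
  obtain ⟨p, q, hI, h, hE, hM⟩ := hf.exists_isModelAt_of_mem_RCoMu ht
  obtain ⟨hS, h0, h1, h23, -⟩ := h.edge_simple hf hI.1.ne' hI.2.ne (Or.inr ht) hE
  have m2 : HasMult μ a b t 2 ↔ fDer μ a b t 2 ≠ 0 := by simp [h.hasMult_two_iff hf h0, h1]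
  have m3 : HasMult μ a b t 3 ↔ fDer μ a b t 2 = 0 := by
    rw [h.hasMult_three_iff hf h0 h1]; exact and_iff_left_of_imp h23
  have he : edgeCurve μ a b t ∈ edgeCoMu μ a b := by
    refine ⟨interior_subset hS, t, (h.position (Prod.mk.eta).symm).2.1 hI, ?_⟩
    by_cases hz : fDer μ a b t 2 = 0
    · exact ⟨3, by norm_num, m3.2 hz⟩
    · exact ⟨2, le_rfl, m2.2 hz⟩
  have hs := hf.mem_support_of_notMem_co ht
  have n1 : t ∉ RMu μ := fun h => h.1 hs
  have n2 := hf.notMem_ROne (Or.inr ht)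
  have n3 := hf.notMem_RTwo (Or.inr ht)
  have n4 : t ∉ RZero μ := fun h => h.1 hs
  rcases k with _ | _ | _ | _ | _ | _ | _ | _ | _ | _ | k <;>
    simp [EdgeCase, he, ht, n1, n2, n3, n4, m2, m3]

lemma isDiscrete_RCoMu_mult_three (hf : IsDensity μ a b f) :
    {t | t ∈ RCoMu μ ∧ HasMult μ a b t 3} ⊆ Ioo a b ∧
      IsDiscrete {t | t ∈ RCoMu μ ∧ HasMult μ a b t 3} := by
  have key : ∀ t ∈ {t | t ∈ RCoMu μ ∧ HasMult μ a b t 3}, fDer μ a b t 2 = 0 := by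
    rintro t ⟨ht, h3⟩
    obtain ⟨p, q, hI, h, -⟩ := hf.exists_isModelAt_of_mem_RCoMu ht
    exact ((h.hasMult_iff hf (m := 3) (by norm_num)).1 h3).1 2 (by norm_num)
  refine ⟨fun t ht => ?_, isDiscrete_of_eventually_notMem fun t ht => ?_⟩
  · obtain ⟨p, q, hI, h, -, hM⟩ := hf.exists_isModelAt_of_mem_RCoMu ht.1
    exact h.mem_Ioo_of_fDer_two_eq_zero hf hM hI.1.ne' hI.2.ne (key t ht)
  · obtain ⟨p, q, hI, h, -, hM⟩ := hf.exists_isModelAt_of_mem_RCoMu ht.1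
    filter_upwards [h.eventually_fDer_two_ne_zero hf hM hI.1.ne' hI.2.ne (key t ht)] with s hs hs'
    exact hs (key s hs')

/-! ### Zeros of the Cauchy transform -/

lemma cauchy_pos (hf : IsDensity μ a b f) (ht : t ∉ μ.support) (hb : b ≤ t) :
    0 < cauchy μ t := by
  obtain ⟨c, hc, h⟩ := hf.exists_isModelAt_of_notMem ht
  rw [hf.cauchy_eq c]
  refine hf.integral_res_mul_pos le_rfl (h.agrees.integrable_mul hf.integrable 1) ?_ ?_
  · filter_upwards [res_self_ae f c] with y hy
    rw [hy, pow_one]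
    rcases le_or_gt y t with hyt | hyt
    · exact mul_nonneg (hf.nonneg y) (inv_nonneg.2 (sub_nonneg.2 hyt))
    · rw [hf.zero_off y (fun h => by linarith [h.2]), zero_mul]
  · filter_upwards [ae_ne t] with y hy
    exact inv_ne_zero (pow_ne_zero 1 (sub_ne_zero.2 hy.symm))

lemma cauchy_neg (hf : IsDensity μ a b f) (ht : t ∉ μ.support) (ha : t ≤ a) :
    cauchy μ t < 0 := by
  obtain ⟨c, hc, h⟩ := hf.exists_isModelAt_of_notMem ht
  rw [hf.cauchy_eq c, ← neg_pos, mom_real_eq, ← integral_neg]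
  simp only [← mul_neg]
  refine hf.integral_res_mul_pos le_rfl
    (by simp only [mul_neg]; exact (h.agrees.integrable_mul hf.integrable 1).neg) ?_ ?_
  · filter_upwards [res_self_ae f c] with y hy
    rw [hy, pow_one]
    rcases le_or_gt t y with hyt | hyt
    · exact mul_nonneg (hf.nonneg y) (neg_nonneg.2 (inv_nonpos.2 (sub_nonpos.2 hyt)))
    · rw [hf.zero_off y (fun h => by linarith [h.1]), zero_mul]
  · filter_upwards [ae_ne t] with y hy
    exact neg_ne_zero.2 (inv_ne_zero (pow_ne_zero 1 (sub_ne_zero.2 hy.symm)))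

/-- C' = -∫(t-y)⁻² dμ is strictly negative off the support, so every zero of C is simple and
isolated; and C has a strict sign to the left of a and to the right of b. -/
lemma isDiscrete_RZero (hf : IsDensity μ a b f) :
    RZero μ ⊆ Ioo a b ∧ IsDiscrete (RZero μ) := by
  refine ⟨fun t ht => ⟨?_, ?_⟩, isDiscrete_of_eventually_notMem fun t ht => ?_⟩
  · by_contra hcon
    exact (hf.cauchy_neg ht.1 (not_lt.1 hcon)).ne ht.2
  · by_contra hcon
    exact (hf.cauchy_pos ht.1 (not_lt.1 hcon)).ne' ht.2
  · obtain ⟨h1, h2⟩ := hf.hasDerivAt_cauchy ht.1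
    filter_upwards [h1.eventually_ne (c := 0) (neg_ne_zero.2 h2.ne')] with s hs hs'
    exact hs hs'.2

/-- The edge at a zero of the Cauchy transform. -/
lemma edge_of_mem_RZero (hf : IsDensity μ a b f) (ht : t ∈ RZero μ) :
    edgeCurve μ a b t = (t, 1) ∧ xVec μ a b t = (1, 0) ∧ yVec μ a b t = (0, -1) ∧
    fDer μ a b t 0 = 0 ∧ fDer μ a b t 1 = derivC μ a b t ∧
    derivC μ a b t = -∫ y : ℝ, 1 / (t - y) ^ 2 ∂μ ∧
    ∃ a₁ a₂ b₁ b₂ : ℝ,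
      HasExpansion (edgeCurve μ a b) t (xVec μ a b t) (yVec μ a b t) a₁ a₂ b₁ b₂ ∧
      a₁ = 2 ∧ b₁ = -derivC μ a b t ∧ IsParabolic (edgeCurve μ a b) t (xVec μ a b t) a₁ b₁ := by
  obtain ⟨c, hc, h⟩ := hf.exists_isModelAt_of_notMem ht.1
  have hE : expC μ a b t = 1 := by rw [expC, if_pos ht.1, ht.2, Real.exp_zero]
  obtain ⟨e1, e2⟩ := hf.expC_mul_and_derivC le_rfl h.agrees hc.ne hc.ne (Or.inl ht.1)
  rw [hE, one_mul] at e1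
  have hD := sub_ne_zero.2 hc.ne
  have hW := h.wron_neg.ne
  have hγ : edgeCurve μ a b t = (t, 1) := by
    rw [h.curve_eq.eq_of_nhds, modelCurve, ← e1, sub_self]
    simp
  have hx : xVec μ a b t = (1, 0) := by rw [hf.xVec_eq (Or.inl ht.1), hE, sub_self]
  have hy : yVec μ a b t = (0, -1) := by rw [hf.yVec_eq (Or.inl ht.1), hE, sub_self]
  have hdC : derivC μ a b t = deriv (cauchy μ) t := by rw [derivC, if_pos ht.1]
  have hdC' := (hf.hasDerivAt_cauchy ht.1).1.deriv
  -- With η = 1 the interval [χ₂,χ] is the null set {t}, so f'_t has the same moments as C.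
  have hmom : ∀ n, mom ℝ (res f (t + 1 - 1) t) n = mom ℝ (res f c c) n := fun n => by
    rw [add_sub_cancel_right, mom_congr_ae (res_self_ae f t), mom_congr_ae (res_self_ae f c)]
  have h0 : fDer μ a b t 0 = 0 := by
    rw [h.fDer_eq_jet hf hγ, jet_eq_zero_iff, zero_add, hmom, ← hf.cauchy_eq c, ht.2]
  have h1 : fDer μ a b t 1 = derivC μ a b t := by
    rw [h.fDer_eq_jet hf hγ, jet, hmom, hdC, hf.cauchy_eq c,
      (h.agrees.hasDerivAt_mom hf.integrable 1).deriv]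
    simp
  have hdN : (deriv (modelN f c c) t - 1) * (t - c) = wron (modelN f c c) c t := by
    rw [wron, ← e1]; ring
  -- Since M = 0, the speed is 2(N'-1)/W, and (N'-1)D = W.
  have hs : speed (modelN f c c) c t = 2 / (t - c) * 1 := by
    rw [speed, ← e1, sub_self, zero_mul, sub_zero, eq_div_of_mul_eq hD hdN]
    field_simp
  -- The speed cannot vanish here, so j = 1 is a dummy value that makes the cusp alternative void.
  obtain ⟨a₁, a₂, b₁, b₂, hexp, hpar, -⟩ := h.expansion hf.integrable
    (x := (1, 0)) (y := (0, -1)) (ρ := t - c) (σ := 1) (j := 1) (k := 1) one_ne_zero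
    (by simp) (by simp [← e1]) (by simp) (by simp) hs (fun h => absurd h one_ne_zero)
    (div_ne_zero two_ne_zero hD) one_ne_zero (fun _ => one_ne_zero)
  obtain ⟨g1, g2, g3⟩ := hpar one_ne_zero
  rw [hx, hy]
  refine ⟨hγ, rfl, rfl, h0, h1, hdC.trans hdC', a₁, a₂, b₁, b₂, hexp, ?_, ?_, g3⟩
  · rw [g1]; field_simp
  · rw [g2, e2, ← e1]; simp only [one_pow, mul_one, ne_eq, OfNat.ofNat_ne_zero,
      not_false_eq_true, zero_pow, add_zero]; field_simp

lemma edgeCase_iff_of_mem_RZero (hf : IsDensity μ a b f) (ht : t ∈ RZero μ) (k : ℕ) :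
    EdgeCase μ a b t k ↔ k = 5 := by
  obtain ⟨hγ, -, -, h0, h1, h2, -⟩ := hf.edge_of_mem_RZero ht
  obtain ⟨c, hc, h⟩ := hf.exists_isModelAt_of_notMem ht.1
  have hI := hf.isDiscrete_RZero.1 ht
  have m1 : HasMult μ a b t 1 := by
    rw [h.hasMult_one_iff hf h0, h1, h2]
    exact neg_ne_zero.2 (hf.hasDerivAt_cauchy ht.1).2.ne'
  have he : edgeCurve μ a b t ∈ edgeZero μ a b := by
    have hr := (h.isRoot_iff hf).2 h0
    rw [hγ] at hr ⊢
    exact ⟨mem_shape_of (by linarith [hI.1]) hI.2.le zero_le_one le_rfl, rfl, hr⟩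
  have n1 := hf.notMem_RCoMu ht.1
  have n2 := hf.notMem_ROne (Or.inl ht.1)
  have n3 := hf.notMem_RTwo (Or.inl ht.1)
  have n4 : t ∉ RMu μ := fun h => h.2 ht.2
  rcases k with _ | _ | _ | _ | _ | _ | _ | _ | _ | _ | k <;>
    simp [EdgeCase, he, ht, n1, n2, n3, n4, m1]

/-! ### Common boundary points of the two supports -/

/-- A point of R₁ lies in both supports, whereas every other point of an admissible interval lies
outside one of them. -/
lemma isDiscrete_ROne (hf : IsDensity μ a b f) : ROne μ ⊆ Icc a b ∧ IsDiscrete (ROne μ) := by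
  refine ⟨fun t ⟨I, hI⟩ => hf.supp_subset (hf.mem_support_of_isGapOne hI).1,
    isDiscrete_of_eventually_notMem fun t ⟨I, hI⟩ => ?_⟩
  filter_upwards [mem_nhdsWithin_of_mem_nhds (isOpen_Ioo.mem_nhds hI.1), self_mem_nhdsWithin]
    with s hs hst
  rcases lt_or_gt_of_ne hst with h | h
  · exact hf.notMem_ROne (Or.inr (hI.2.2 ⟨hs.1, h⟩))
  · exact hf.notMem_ROne (Or.inl (hI.2.1 ⟨h, hs.2⟩))

lemma isDiscrete_RTwo (hf : IsDensity μ a b f) : RTwo μ ⊆ Icc a b ∧ IsDiscrete (RTwo μ) := by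
  refine ⟨fun t ⟨I, hI⟩ => hf.supp_subset (hf.mem_support_of_isGapTwo hI).1,
    isDiscrete_of_eventually_notMem fun t ⟨I, hI⟩ => ?_⟩
  filter_upwards [mem_nhdsWithin_of_mem_nhds (isOpen_Ioo.mem_nhds hI.1), self_mem_nhdsWithin]
    with s hs hst
  rcases lt_or_gt_of_ne hst with h | h
  · exact hf.notMem_RTwo (Or.inl (hI.2.2 ⟨hs.1, h⟩))
  · exact hf.notMem_RTwo (Or.inr (hI.2.1 ⟨h, hs.2⟩))

/-- The edge at a right end-point of a gap of `λ - μ` that is a left end-point of a gap of `μ`. -/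
lemma edge_of_mem_ROne (hf : IsDensity μ a b f) (ht : t ∈ ROne μ) :
    (edgeCurve μ a b t).1 = t ∧ (edgeCurve μ a b t).2 ∈ Ioo (0 : ℝ) 1 ∧
    edgeCurve μ a b t ∈ shape a b ∧ fDer μ a b t 0 = 0 ∧
    (fDer μ a b t 1 = 0 → fDer μ a b t 2 ≠ 0) ∧
    ∃ a₁ a₂ b₁ b₂ : ℝ,
      HasExpansion (edgeCurve μ a b) t (xVec μ a b t) (yVec μ a b t) a₁ a₂ b₁ b₂ ∧
      (fDer μ a b t 1 ≠ 0 →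
        (∀ I, IsGapOne μ t I →
          a₁ = -2 * (t - I.1) * Real.exp (cauchyOff μ a b I t) * fDer μ a b t 1) ∧
        b₁ = -fDer μ a b t 1 ∧ IsParabolic (edgeCurve μ a b) t (xVec μ a b t) a₁ b₁) ∧
      (fDer μ a b t 1 = 0 →
        (∀ I, IsGapOne μ t I →
          a₂ = -(3 / 2) * (t - I.1) * Real.exp (cauchyOff μ a b I t) * fDer μ a b t 2) ∧
        b₂ = -fDer μ a b t 2 ∧ IsFirstOrderCusp a₁ a₂ b₁ b₂) := by
  obtain ⟨I, hI⟩ := ht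
  have h := hf.isModelAt_of_isGapOne hI
  have hγ := hf.edgeCurve_eq_of_isGapOne hI
  have hx : xVec μ a b t = (0, 1) := if_pos ⟨I, hI⟩
  have hy : yVec μ a b t = (1, 0) := if_pos ⟨I, hI⟩
  have hN : 0 < modelN f I.1 t t := IsModelAt.modelN_pos hI.1.1
  have hW : wron (modelN f I.1 t) t t = -modelN f I.1 t t := by rw [wron]; ring
  obtain ⟨j0, j12, k0, k1, ha, -, h0, h1⟩ := h.double hf hγ (Or.inr rfl)
  simp only [← h.fDer_eq_jet hf hγ] at j0 j12 k0 k1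
  have hb := (hf.isDiscrete_ROne.1 ⟨I, hI⟩).2
  -- On R₁ one has t-q = 0, t-χ₂ = N and W = -N, so the factors relating k and k' to derivatives of
  -- f'_t become -2 and -3.
  have hc : ∀ n : ℝ, n * (t - t + (t - (t + (1 - modelN f I.1 t t) - 1)))
      / wron (modelN f I.1 t) t t = -n := fun n => by
    rw [hW]; field_simp; ring
  rw [hc] at k0 k1
  obtain ⟨a₁, a₂, b₁, b₂, hexp, hpar, hcusp⟩ := h.expansion hf.integrable
    (x := (0, 1)) (y := (1, 0)) (ρ := modelN f I.1 t t) (σ := 1) one_ne_zero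
    (by simp) (by simp) (by simp) (by simp) k0 k1 (neg_ne_zero.2 two_ne_zero)
    (neg_ne_zero.2 three_ne_zero) j12
  have hJ : ∀ J, IsGapOne μ t J →
      modelN f I.1 t t = (t - J.1) * Real.exp (cauchyOff μ a b J t) := fun J hJ => by
    rw [hf.modelN_eq_of_isGapOne hI hJ, hf.cauchyOff_eq (hf.gapModel_of_isGapOne hJ), modelN,
      mul_comm]
  rw [hx, hy]
  refine ⟨by rw [hγ], by rw [hγ]; exact ⟨h0, h1⟩, by
    rw [hγ]; exact mem_shape_of (ha rfl).le hb h0.le h1.le, j0, j12, a₁, a₂, b₁, b₂, hexp,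
    fun hj => ?_, fun hj => ?_⟩
  · obtain ⟨g1, g2, g3⟩ := hpar hj
    refine ⟨fun J hgap => ?_, ?_, g3⟩
    · rw [g1, hJ J hgap]; ring
    · rw [g2, hW]; simp only [one_pow, mul_one, ne_eq, OfNat.ofNat_ne_zero,
        not_false_eq_true, zero_pow, zero_add]; field_simp
  · obtain ⟨g1, g2, g3⟩ := hcusp hj
    refine ⟨fun J hgap => ?_, ?_, g3⟩
    · rw [g1, hJ J hgap]; ring
    · rw [g2, hW]; simp only [one_pow, mul_one, ne_eq, OfNat.ofNat_ne_zero,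
        not_false_eq_true, zero_pow, zero_add]; field_simp

lemma edgeCase_iff_of_mem_ROne (hf : IsDensity μ a b f) (ht : t ∈ ROne μ) (k : ℕ) :
    EdgeCase μ a b t k ↔ (k = 6 ∧ fDer μ a b t 1 ≠ 0) ∨ (k = 7 ∧ fDer μ a b t 1 = 0) := by
  obtain ⟨e1, e2, hS, h0, h12, -⟩ := hf.edge_of_mem_ROne ht
  have h := hf.isModelAt_of_isGapOne ht.choose_spec
  have m1 : HasMult μ a b t 1 ↔ fDer μ a b t 1 ≠ 0 := h.hasMult_one_iff hf h0
  have m2 : HasMult μ a b t 2 ↔ fDer μ a b t 1 = 0 := by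
    rw [h.hasMult_two_iff hf h0]; exact and_iff_left_of_imp h12
  have he : edgeCurve μ a b t ∈ edgeOne μ a b := by
    refine ⟨hS, e2.2, ?_⟩
    rw [e1]
    exact (h.isRoot_iff hf).2 h0
  obtain ⟨s1, s2⟩ := hf.mem_support_of_isGapOne ht.choose_spec
  have n1 : t ∉ RMu μ := fun h => h.1 s1
  have n2 : t ∉ RCoMu μ := fun h => h s2
  have n3 := hf.notMem_RTwo_of_mem_ROne ht
  have n4 : t ∉ RZero μ := fun h => h.1 s1
  rcases k with _ | _ | _ | _ | _ | _ | _ | _ | _ | _ | k <;>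
    simp [EdgeCase, he, ht, n1, n2, n3, n4, m1, m2]

/-- The edge at a left end-point of a gap of `λ - μ` that is a right end-point of a gap of `μ`. -/
lemma edge_of_mem_RTwo (hf : IsDensity μ a b f) (ht : t ∈ RTwo μ) :
    (edgeCurve μ a b t).1 + (edgeCurve μ a b t).2 - 1 = t ∧
    (edgeCurve μ a b t).2 ∈ Ioo (0 : ℝ) 1 ∧
    edgeCurve μ a b t ∈ shape a b ∧ fDer μ a b t 0 = 0 ∧
    (fDer μ a b t 1 = 0 → fDer μ a b t 2 ≠ 0) ∧
    ∃ a₁ a₂ b₁ b₂ : ℝ,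
      HasExpansion (edgeCurve μ a b) t (xVec μ a b t) (yVec μ a b t) a₁ a₂ b₁ b₂ ∧
      (fDer μ a b t 1 ≠ 0 →
        (∀ I, IsGapTwo μ t I →
          a₁ = 2 * (t - I.2) * Real.exp (-cauchyOff μ a b I t) * fDer μ a b t 1) ∧
        b₁ = 1 / 2 * fDer μ a b t 1 ∧ IsParabolic (edgeCurve μ a b) t (xVec μ a b t) a₁ b₁) ∧
      (fDer μ a b t 1 = 0 →
        (∀ I, IsGapTwo μ t I →
          a₂ = 3 / 2 * (t - I.2) * Real.exp (-cauchyOff μ a b I t) * fDer μ a b t 2) ∧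
        b₂ = 1 / 2 * fDer μ a b t 2 ∧ IsFirstOrderCusp a₁ a₂ b₁ b₂) := by
  have n1 : t ∉ ROne μ := fun h => hf.notMem_RTwo_of_mem_ROne h ht
  have hx : xVec μ a b t = (1, -1) := by rw [xVec, if_neg n1, if_pos ht]
  have hy : yVec μ a b t = (1, 1) := by rw [yVec, if_neg n1, if_pos ht]
  obtain ⟨I, hI⟩ := ht
  have h := hf.isModelAt_of_isGapTwo hI
  have hγ : edgeCurve μ a b t = ((edgeCurve μ a b t).1, (edgeCurve μ a b t).2) :=
    (Prod.mk.eta).symm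
  have hχ := ((h.position hγ).2.2.2 rfl).1
  have hN : modelN f t I.2 t = 0 := by rw [modelN, sub_self, mul_zero]
  have hD : t - I.2 ≠ 0 := sub_ne_zero.2 hI.1.2.ne
  have hE := Real.exp_ne_zero (mom ℝ (res f t I.2) 1 t)
  have hW : wron (modelN f t I.2) I.2 t = Real.exp (mom ℝ (res f t I.2) 1 t) * (t - I.2) := by
    rw [wron, (h.agrees.hasDerivAt_modelN hf.integrable).deriv, hN]; ring
  obtain ⟨j0, j12, k0, k1, -, hb, h0, h1⟩ := h.double hf hγ (Or.inl rfl)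
  simp only [← h.fDer_eq hf] at j0 j12 k0 k1
  have ha := (hf.isDiscrete_RTwo.1 ⟨I, hI⟩).1
  -- On R₂ one has t = χ₂ and W = e^h(t-q), so the factors become 2e^{-h} and 3e^{-h}.
  have hc : ∀ n : ℝ, n * (t - I.2 + (t - ((edgeCurve μ a b t).1 + (edgeCurve μ a b t).2 - 1)))
      / wron (modelN f t I.2) I.2 t = n * Real.exp (-mom ℝ (res f t I.2) 1 t) := fun n => by
    rw [hW, ← hχ, Real.exp_neg, sub_self, add_zero]; field_simp
  rw [hc] at k0 k1
  have hE' := Real.exp_ne_zero (-mom ℝ (res f t I.2) 1 t)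
  obtain ⟨a₁, a₂, b₁, b₂, hexp, hpar, hcusp⟩ := h.expansion hf.integrable
    (x := (1, -1)) (y := (1, 1)) (ρ := t - I.2) (σ := -1) (neg_ne_zero.2 one_ne_zero)
    (by simp) (by simp [hN]) (by simp) (by simp) k0 k1 (mul_ne_zero two_ne_zero hE')
    (mul_ne_zero three_ne_zero hE') j12
  have hJ : ∀ J, IsGapTwo μ t J → Real.exp (-mom ℝ (res f t I.2) 1 t) * (t - I.2)
      = (t - J.2) * Real.exp (-cauchyOff μ a b J t) := fun J hJ => by
    rw [hf.exp_mom_mul_eq_of_isGapTwo hI hJ, hf.cauchyOff_eq (hf.gapModel_of_isGapTwo hJ),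
      mul_comm]
  have hxx : ((1 : ℝ), (-1 : ℝ)).1 ^ 2 + ((1 : ℝ), (-1 : ℝ)).2 ^ 2 = 2 := by norm_num
  rw [hx, hy]
  refine ⟨hχ.symm, ⟨h0, h1⟩, mem_shape_of (hχ ▸ ha) (hb rfl).le h0.le h1.le, j0, j12,
    a₁, a₂, b₁, b₂, hexp, fun hj => ?_, fun hj => ?_⟩
  · obtain ⟨g1, g2, g3⟩ := hpar hj
    refine ⟨fun J hgap => ?_, ?_, g3⟩
    · rw [g1]; linear_combination 2 * fDer μ a b t 1 * hJ J hgap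
    · rw [g2, hW, Real.exp_neg, hxx]; field_simp
  · obtain ⟨g1, g2, g3⟩ := hcusp hj
    refine ⟨fun J hgap => ?_, ?_, g3⟩
    · rw [g1]; linear_combination 3 / 2 * fDer μ a b t 2 * hJ J hgap
    · rw [g2, hW, Real.exp_neg, hxx]; field_simp

lemma edgeCase_iff_of_mem_RTwo (hf : IsDensity μ a b f) (ht : t ∈ RTwo μ) (k : ℕ) :
    EdgeCase μ a b t k ↔ (k = 8 ∧ fDer μ a b t 1 ≠ 0) ∨ (k = 9 ∧ fDer μ a b t 1 = 0) := by
  obtain ⟨e1, e2, hS, h0, h12, -⟩ := hf.edge_of_mem_RTwo ht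
  have h := hf.isModelAt_of_isGapTwo ht.choose_spec
  have m1 : HasMult μ a b t 1 ↔ fDer μ a b t 1 ≠ 0 := h.hasMult_one_iff hf h0
  have m2 : HasMult μ a b t 2 ↔ fDer μ a b t 1 = 0 := by
    rw [h.hasMult_two_iff hf h0]; exact and_iff_left_of_imp h12
  have he : edgeCurve μ a b t ∈ edgeTwo μ a b := by
    refine ⟨hS, e2.2, ?_⟩
    rw [e1]
    exact (h.isRoot_iff hf).2 h0
  obtain ⟨s1, s2⟩ := hf.mem_support_of_isGapTwo ht.choose_spec
  have n1 : t ∉ RMu μ := fun h => h.1 s1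
  have n2 : t ∉ RCoMu μ := fun h => h s2
  have n3 : t ∉ ROne μ := fun h => hf.notMem_RTwo_of_mem_ROne h ht
  have n4 : t ∉ RZero μ := fun h => h.1 s1
  rcases k with _ | _ | _ | _ | _ | _ | _ | _ | _ | _ | k <;>
    simp [EdgeCase, he, ht, n1, n2, n3, n4, m1, m2]

/-! ### The whole parameter set -/

lemma exists_isModelAt (hf : IsDensity μ a b f) (ht : t ∈ REdge μ) :
    ∃ p q, IsModelAt μ a b f p q t := by
  rcases ht with (((ht | ht) | ht) | ht) | ht
  · obtain ⟨c, -, h⟩ := hf.exists_isModelAt_of_notMem ht.1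
    exact ⟨c, c, h⟩
  · obtain ⟨p, q, -, h, -⟩ := hf.exists_isModelAt_of_mem_RCoMu ht
    exact ⟨p, q, h⟩
  · obtain ⟨c, -, h⟩ := hf.exists_isModelAt_of_notMem ht.1
    exact ⟨c, c, h⟩
  · exact ⟨_, _, hf.isModelAt_of_isGapOne ht.choose_spec⟩
  · exact ⟨_, _, hf.isModelAt_of_isGapTwo ht.choose_spec⟩

lemma existsUnique_edgeCase (hf : IsDensity μ a b f) (ht : t ∈ REdge μ) :
    ∃! k : ℕ, EdgeCase μ a b t k := by
  -- In each class except R₀ two case numbers compete, and the vanishing P of one derivative of f'_t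
  -- selects between them.
  have key : ∀ (m n : ℕ) (P : Prop),
      (∀ k, EdgeCase μ a b t k ↔ (k = m ∧ ¬P) ∨ (k = n ∧ P)) → ∃! k, EdgeCase μ a b t k := by
    intro m n P hP
    by_cases h : P
    · exact ⟨n, (hP n).2 (Or.inr ⟨rfl, h⟩), fun k hk => by simpa [h] using (hP k).1 hk⟩
    · exact ⟨m, (hP m).2 (Or.inl ⟨rfl, h⟩), fun k hk => by simpa [h] using (hP k).1 hk⟩
  rcases ht with (((ht | ht) | ht) | ht) | ht
  · exact key _ _ _ (hf.edgeCase_iff_of_mem_RMu ht)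
  · exact key _ _ _ (hf.edgeCase_iff_of_mem_RCoMu ht)
  · exact ⟨5, (hf.edgeCase_iff_of_mem_RZero ht 5).2 rfl,
      fun k hk => (hf.edgeCase_iff_of_mem_RZero ht k).1 hk⟩
  · exact key _ _ _ (hf.edgeCase_iff_of_mem_ROne ht)
  · exact key _ _ _ (hf.edgeCase_iff_of_mem_RTwo ht)

end IsDensity

lemma xVec_yVec (μ : Measure ℝ) (a b t : ℝ) :
    (xVec μ a b t).1 * (yVec μ a b t).1 + (xVec μ a b t).2 * (yVec μ a b t).2 = 0 ∧
      xVec μ a b t ≠ 0 ∧ yVec μ a b t ≠ 0 := by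
  by_cases h1 : t ∈ ROne μ
  · simp [xVec, yVec, h1]
  by_cases h2 : t ∈ RTwo μ
  · simp [xVec, yVec, h1, h2]
  · simp [xVec, yVec, h1, h2]

end GTEdge

/-! ### Assembly over the five parameter classes -/

theorem mainTheorem6 (x : ∀ n : ℕ, Fin n → ℤ) (μ : Measure ℝ) [IsProbabilityMeasure μ] (a b : ℝ)
    (hμ : IsTopRowLimit x μ a b) :
    -- every parameter falls into exactly one of the nine cases
    (∀ t ∈ REdge μ, ∃! k : ℕ, EdgeCase μ a b t k) ∧
    -- the curve is smooth, and the two frame vectors are orthogonal and non-zero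
    (∀ t ∈ REdge μ, ContDiffAt ℝ ∞ (edgeCurve μ a b) t ∧
      (xVec μ a b t).1 * (yVec μ a b t).1 + (xVec μ a b t).2 * (yVec μ a b t).2 = 0 ∧
      xVec μ a b t ≠ 0 ∧ yVec μ a b t ≠ 0) ∧
    -- the local expansion, and its coefficients in each case
    (∀ t ∈ REdge μ, ∃ a₁ a₂ b₁ b₂ : ℝ,
      HasExpansion (edgeCurve μ a b) t (xVec μ a b t) (yVec μ a b t) a₁ a₂ b₁ b₂ ∧
      -- cases 1 and 3
      ((EdgeCase μ a b t 1 ∨ EdgeCase μ a b t 3) →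
        edgeCurve μ a b t ∈ interior (shape a b) ∧
        a₁ = -((expC μ a b t - 1) / (expC μ a b t * derivC μ a b t ^ 2)) * fDer μ a b t 2 ∧
        b₁ = 1 / 2 * ((expC μ a b t - 1) / (derivC μ a b t * (1 + (expC μ a b t - 1) ^ 2)))
          * fDer μ a b t 2 ∧
        IsParabolic (edgeCurve μ a b) t (xVec μ a b t) a₁ b₁) ∧
      -- cases 2 and 4
      ((EdgeCase μ a b t 2 ∨ EdgeCase μ a b t 4) →
        edgeCurve μ a b t ∈ interior (shape a b) ∧
        a₂ = -(1 / 2) * ((expC μ a b t - 1) / (expC μ a b t * derivC μ a b t ^ 2))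
          * fDer μ a b t 3 ∧
        b₂ = 1 / 3 * ((expC μ a b t - 1) / (derivC μ a b t * (1 + (expC μ a b t - 1) ^ 2)))
          * fDer μ a b t 3 ∧
        IsFirstOrderCusp a₁ a₂ b₁ b₂) ∧
      -- case 5
      (EdgeCase μ a b t 5 →
        edgeCurve μ a b t = (t, 1) ∧ xVec μ a b t = (1, 0) ∧ yVec μ a b t = (0, -1) ∧
        a₁ = 2 ∧ b₁ = -derivC μ a b t ∧ b₁ = -fDer μ a b t 1 ∧
        b₁ = ∫ y : ℝ, 1 / (t - y) ^ 2 ∂μ ∧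
        IsParabolic (edgeCurve μ a b) t (xVec μ a b t) a₁ b₁) ∧
      -- case 6
      (EdgeCase μ a b t 6 →
        (edgeCurve μ a b t).1 = t ∧ (edgeCurve μ a b t).2 ∈ Ioo (0 : ℝ) 1 ∧
        (∀ I, IsGapOne μ t I →
          a₁ = -2 * (t - I.1) * Real.exp (cauchyOff μ a b I t) * fDer μ a b t 1) ∧
        b₁ = -fDer μ a b t 1 ∧
        IsParabolic (edgeCurve μ a b) t (xVec μ a b t) a₁ b₁) ∧
      -- case 7
      (EdgeCase μ a b t 7 →
        (edgeCurve μ a b t).1 = t ∧ (edgeCurve μ a b t).2 ∈ Ioo (0 : ℝ) 1 ∧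
        (∀ I, IsGapOne μ t I →
          a₂ = -(3 / 2) * (t - I.1) * Real.exp (cauchyOff μ a b I t) * fDer μ a b t 2) ∧
        b₂ = -fDer μ a b t 2 ∧
        IsFirstOrderCusp a₁ a₂ b₁ b₂) ∧
      -- case 8
      (EdgeCase μ a b t 8 →
        (edgeCurve μ a b t).1 + (edgeCurve μ a b t).2 - 1 = t ∧
        (edgeCurve μ a b t).2 ∈ Ioo (0 : ℝ) 1 ∧
        (∀ I, IsGapTwo μ t I →
          a₁ = 2 * (t - I.2) * Real.exp (-cauchyOff μ a b I t) * fDer μ a b t 1) ∧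
        b₁ = 1 / 2 * fDer μ a b t 1 ∧
        IsParabolic (edgeCurve μ a b) t (xVec μ a b t) a₁ b₁) ∧
      -- case 9
      (EdgeCase μ a b t 9 →
        (edgeCurve μ a b t).1 + (edgeCurve μ a b t).2 - 1 = t ∧
        (edgeCurve μ a b t).2 ∈ Ioo (0 : ℝ) 1 ∧
        (∀ I, IsGapTwo μ t I →
          a₂ = 3 / 2 * (t - I.2) * Real.exp (-cauchyOff μ a b I t) * fDer μ a b t 2) ∧
        b₂ = 1 / 2 * fDer μ a b t 2 ∧
        IsFirstOrderCusp a₁ a₂ b₁ b₂)) ∧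
    -- discreteness of the exceptional parameter sets
    ({t | t ∈ RMu μ ∧ HasMult μ a b t 3} ⊆ Ioo a b ∧
      IsDiscrete {t | t ∈ RMu μ ∧ HasMult μ a b t 3}) ∧
    ({t | t ∈ RCoMu μ ∧ HasMult μ a b t 3} ⊆ Ioo a b ∧
      IsDiscrete {t | t ∈ RCoMu μ ∧ HasMult μ a b t 3}) ∧
    (RZero μ ⊆ Ioo a b ∧ IsDiscrete (RZero μ)) ∧
    (ROne μ ⊆ Icc a b ∧ IsDiscrete (ROne μ)) ∧
    (RTwo μ ⊆ Icc a b ∧ IsDiscrete (RTwo μ)) := by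
  obtain ⟨f, hf⟩ := hμ.exists_isDensity
  refine ⟨fun t ht => hf.existsUnique_edgeCase ht, fun t ht => ?_, fun t ht => ?_,
    hf.isDiscrete_RMu_mult_three, hf.isDiscrete_RCoMu_mult_three, hf.isDiscrete_RZero,
    hf.isDiscrete_ROne, hf.isDiscrete_RTwo⟩
  · obtain ⟨p, q, h⟩ := hf.exists_isModelAt ht
    exact ⟨h.contDiffAt_edgeCurve hf.integrable, xVec_yVec μ a b t⟩
  rcases ht with (((ht | ht) | ht) | ht) | ht
  · obtain ⟨c, hc, h, hE, -⟩ := hf.exists_isModelAt_of_mem_RMu ht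
    obtain ⟨hS, -, -, -, a₁, a₂, b₁, b₂, hexp, hpar, hcusp⟩ :=
      h.edge_simple hf hc.ne hc.ne (Or.inl ht.1) hE
    refine ⟨a₁, a₂, b₁, b₂, hexp, ?_⟩
    simp only [hf.edgeCase_iff_of_mem_RMu ht]
    refine ⟨fun h => ⟨hS, hpar (by simpa using h)⟩, fun h => ⟨hS, hcusp (by simpa using h)⟩, ?_⟩
    simp
  · obtain ⟨p, q, hI, h, hE, -⟩ := hf.exists_isModelAt_of_mem_RCoMu ht
    obtain ⟨hS, -, -, -, a₁, a₂, b₁, b₂, hexp, hpar, hcusp⟩ :=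
      h.edge_simple hf hI.1.ne' hI.2.ne (Or.inr ht) hE
    refine ⟨a₁, a₂, b₁, b₂, hexp, ?_⟩
    simp only [hf.edgeCase_iff_of_mem_RCoMu ht]
    refine ⟨fun h => ⟨hS, hpar (by simpa using h)⟩, fun h => ⟨hS, hcusp (by simpa using h)⟩, ?_⟩
    simp
  · obtain ⟨hγ, hx, hy, -, h1, hC, a₁, a₂, b₁, b₂, hexp, ha, hb, hpar⟩ := hf.edge_of_mem_RZero ht
    refine ⟨a₁, a₂, b₁, b₂, hexp, ?_⟩
    simp only [hf.edgeCase_iff_of_mem_RZero ht]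
    refine ⟨by simp, by simp, fun _ => ⟨hγ, hx, hy, ha, hb, by rw [hb, h1], ?_, hpar⟩, by simp⟩
    rw [hb, hC, neg_neg]
  · obtain ⟨e1, e2, -, -, -, a₁, a₂, b₁, b₂, hexp, hpar, hcusp⟩ := hf.edge_of_mem_ROne ht
    refine ⟨a₁, a₂, b₁, b₂, hexp, ?_⟩
    simp only [hf.edgeCase_iff_of_mem_ROne ht]
    exact ⟨by simp, by simp, by simp, fun h => ⟨e1, e2, hpar (by simpa using h)⟩,
      fun h => ⟨e1, e2, hcusp (by simpa using h)⟩, by simp, by simp⟩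
  · obtain ⟨e1, e2, -, -, -, a₁, a₂, b₁, b₂, hexp, hpar, hcusp⟩ := hf.edge_of_mem_RTwo ht
    refine ⟨a₁, a₂, b₁, b₂, hexp, ?_⟩
    simp only [hf.edgeCase_iff_of_mem_RTwo ht]
    exact ⟨by simp, by simp, by simp, by simp, by simp,
      fun h => ⟨e1, e2, hpar (by simpa using h)⟩, fun h => ⟨e1, e2, hcusp (by simpa using h)⟩⟩
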